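/- Let $k\ge 2$ and $c>0$. Let $T>0$ and let $u$ be a classical solution of $u_t=u_{xx}$ on $[0,2\pi]\times(0,T]$, continuous on $[0,2\pi]\times[0,T]$, with $u\in L^\infty(0,T;W^{k+4,\infty}(0,2\pi))$ in the sense that $\sup_{0\le \tau\le T}\|u(\cdot,\tau)\|_{k+4,\infty}<\infty$; put $q=u_x$. Let $0=x_{1/2}<x_{3/2}<\dots<x_{N+1/2}=2\pi$ be a mesh with cells $\tau_j=(x_{j-1/2},x_{j+1/2})$, lengths $h_j$, centres $x_j$, $\bar h_j=h_j/2$, and $h=\max_j h_j\le c\,h_j$ for all $j$. Let $V_h$ be the functions that are polynomials of degree at most $k$ on every cell, and $(\cdot,\cdot)_j$ the $L^2(\tau_j)$ product. Let $u_h,q_h$ be functions of $t\in[0,T]$, with values in $V_h$ and $u_h$ differentiable in $t$, such that for all $t\in[0,T]$, all $j$ and all $v,w\in V_h$ $$(u_{ht},v)_j=-(q_h,v_x)_j+\hat q_hv^-|_{j+\frac12}-\hat q_hv^+|_{j-\frac12},\qquad (q_h,w)_j=-(u_h,w_x)_j+\hat u_hw^-|_{j+\frac12}-\hat u_hw^+|_{j-\frac12},$$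 where the fluxes are either (flux1) $\hat u_h=u_h^-,\ \hat q_h=q_h^+$ or (flux2) $\hat u_h=u_h^+,\ \hat q_h=q_h^-$. The boundary condition is either periodic ($u(0,t)=u(2\pi,t)$, $u_x(0,t)=u_x(2\pi,t)$, and the one-sided limits of $u_h,q_h$ are continued periodically at $0$ and $2\pi$), with either choice of fluxes, or mixed. For (flux1) the mixed condition is $u(0,t)=g_0(t)$, $u_x(2\pi,t)=g_1(t)$, and then $\hat u_h=g_0(t)$ at $x=0$ and $\hat q_h=g_1(t)$ at $x=2\pi$; for (flux2) it is $u_x(0,t)=g_0(t)$, $u(2\pi,t)=g_1(t)$, and then $\hat q_h=g_0(t)$ at $x=0$ and $\hat u_h=g_1(t)$ at $x=2\pi$. Initial value. Let $L_{j,m}$ be the Legendre polynomial of degree $m$ on $\tau_j$ with value $1$ at $x_{j+1/2}$. Let $P_h^{-}v$ (respectively $P_h^+v$) be the polynomial of degree at most $k$ on $\tau_j$ that has the same moments as $v$ against the polynomials of degree at most $k-1$ and agrees with $v$ at the right (respectively left) end point of $\tau_j$. Let $\bar v_{j,k}$ and $\tilde v_{j,k}$ be the coefficients of $L_{j,k}$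 in the Legendre expansions of $v-P_h^-v$ and $v-P_h^+v$ on $\tau_j$. Put $D_s^{-1}v(x)=\bar h_j^{-1}\int_{x_{j-1/2}}^xv$, $F_1=P_h^+D_s^{-1}L_{j,k}$, $F_2=P_h^-D_s^{-1}L_{j,k}$, $\bar F_1=P_h^-D_s^{-1}F_1$, $\bar F_2=P_h^+D_s^{-1}F_2$. The initial value is given on every cell by $$u_h(\cdot,0)=P_h^-u-\bar h_j^2\,\partial_t\bar u_{j,k}\,\bar F_1-\bar h_j\,\tilde q_{j,k}\,F_2\ \text{ for (flux1)},\qquad u_h(\cdot,0)=P_h^+u-\bar h_j\,\bar q_{j,k}\,F_1-\bar h_j^2\,\partial_t\tilde u_{j,k}\,\bar F_2\ \text{ for (flux2)},$$ everything on the right being taken at $t=0$. Let the interior left (respectively right) Radau points of $\tau_j$ be the zeros of $L_{j,k+1}+L_{j,k}$ (respectively $L_{j,k+1}-L_{j,k}$) in the open cell $\tau_j$. Let $e_{ux,l}(t)$, $e_{ux,r}(t)$ be the maxima of $|u_x-u_{hx}|$, and $e_{qx,l}(t)$, $e_{qx,r}(t)$ the maxima of $|q_x-q_{hx}|$, at time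 $t$ over the interior left and right Radau points of all cells. Then there is a constant $K$ that depends only on $k$ and $c$ such that, for all $t\in[0,T]$, with $B(t)=\sup_{0\le\tau\le t}\|u(\cdot,\tau)\|_{k+4,\infty}$, $$e_{ux,l}(t)\le K(1+t\sqrt h)\,h^{k+1}B(t),\qquad e_{qx,r}(t)\le K(1+\sqrt{th})\,h^{k+1}B(t)$$ for (flux1), and $$e_{ux,r}(t)\le K(1+t\sqrt h)\,h^{k+1}B(t),\qquad e_{qx,l}(t)\le K(1+\sqrt{th})\,h^{k+1}B(t)$$ for (flux2). -/

import Mathlib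

open Polynomial MeasureTheory Set

namespace LDG

noncomputable section

/-! ### Sobolev norms on the interval `Ω = (0, 2π)` -/

/-- The open interval `(0, 2π)`. -/
def Omega : Set ℝ := Ioo 0 (2 * Real.pi)

/-- The closed interval `[0, 2π]`. -/
def OmegaBar : Set ℝ := Icc 0 (2 * Real.pi)

/-- `g` is the `i`-th weak derivative of `f` on `(0, 2π)`. -/
def IsWeakDeriv (i : ℕ) (f g : ℝ → ℝ) : Prop :=
  LocallyIntegrableOn f Omega ∧ LocallyIntegrableOn g Omega ∧
    ∀ φ : ℝ → ℝ, ContDiff ℝ ((⊤ : ℕ∞) : WithTop ℕ∞) φ → HasCompactSupport φ →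
      tsupport φ ⊆ Omega →
      ∫ x in Omega, f x * iteratedDeriv i φ x = (-1) ^ i * ∫ x in Omega, g x * φ x

/-- The norm `‖f‖_{m,∞}` of `W^{m,∞}(0, 2π)`: the largest of the essential suprema of the weak
derivatives of order at most `m`; it is `⊤` when `f` is not in `W^{m,∞}(0, 2π)`. -/
def sobolevNorm (m : ℕ) (f : ℝ → ℝ) : ENNReal :=
  ⨅ (D : ℕ → ℝ → ℝ) (_ : ∀ i ≤ m, IsWeakDeriv i f (D i)),
    ⨆ (i : ℕ) (_ : i ≤ m), eLpNorm (D i) ⊤ (volume.restrict Omega)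

/-- The supremum over `τ ∈ [0, t]` of `‖u(·, τ)‖_{m,∞}`. -/
def sobolevNormUpTo (m : ℕ) (u : ℝ → ℝ → ℝ) (t : ℝ) : ENNReal :=
  ⨆ (τ : ℝ) (_ : τ ∈ Icc 0 t), sobolevNorm m (u τ)

/-! ### The heat equation -/

/-- The spatial derivative on `[0, 2π]` (one-sided at the two end points). -/
def dx (f : ℝ → ℝ) : ℝ → ℝ := derivWithin f OmegaBar

/-- The two choices of alternating numerical fluxes: `minusPlus` is `û = u⁻, q̂ = q⁺`, and
`plusMinus` is `û = u⁺, q̂ = q⁻`. -/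
inductive Flux
  | minusPlus
  | plusMinus

/-- The boundary conditions. Which end carries the Dirichlet datum in the mixed condition depends
on the fluxes, see `BoundaryCondition.Holds`. -/
inductive BoundaryCondition
  | periodic
  | mixed (g₀ g₁ : ℝ → ℝ)

/-- `u t x` satisfies the boundary condition for all times in `[0, T]`. In the mixed case this is
`u(0,t) = g₀(t), u_x(2π,t) = g₁(t)` for the fluxes `minusPlus`, and
`u_x(0,t) = g₀(t), u(2π,t) = g₁(t)` for the fluxes `plusMinus`. -/
def BoundaryCondition.Holds (bc : BoundaryCondition) (fl : Flux) (T : ℝ) (u : ℝ → ℝ → ℝ) : Prop :=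
  ∀ t ∈ Icc 0 T,
    match bc, fl with
    | .periodic, _ => u t 0 = u t (2 * Real.pi) ∧ dx (u t) 0 = dx (u t) (2 * Real.pi)
    | .mixed g₀ g₁, .minusPlus => u t 0 = g₀ t ∧ dx (u t) (2 * Real.pi) = g₁ t
    | .mixed g₀ g₁, .plusMinus => dx (u t) 0 = g₀ t ∧ u t (2 * Real.pi) = g₁ t

/-- `u t x` is a classical solution of `u_t = u_xx` on `[0, 2π] × (0, T]`, with initial value
`u 0` and the given boundary condition. -/
structure IsHeatSolution (fl : Flux) (bc : BoundaryCondition) (T : ℝ) (u : ℝ → ℝ → ℝ) : Prop where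
  continuousOn : ContinuousOn (fun p : ℝ × ℝ => u p.1 p.2) (Icc 0 T ×ˢ OmegaBar)
  contDiffOn : ∀ t ∈ Icc 0 T, ContDiffOn ℝ 2 (u t) OmegaBar
  equation : ∀ t ∈ Ioc 0 T, ∀ x ∈ OmegaBar,
    HasDerivWithinAt (fun s => u s x) (dx (dx (u t)) x) (Icc 0 T) t
  boundary : bc.Holds fl T u

/-! ### Meshes and piecewise polynomials -/

/-- A mesh of `[0, 2π]` with `n + 1` cells. -/
structure Mesh where
  n : ℕ
  node : Fin (n + 2) → ℝ
  strictMono : StrictMono node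
  node_zero : node 0 = 0
  node_last : node (Fin.last (n + 1)) = 2 * Real.pi

namespace Mesh

variable (M : Mesh)

/-- Left end point of the cell `j`. -/
def left (j : Fin (M.n + 1)) : ℝ := M.node j.castSucc

/-- Right end point of the cell `j`. -/
def right (j : Fin (M.n + 1)) : ℝ := M.node j.succ

/-- Length of the cell `j`. -/
def width (j : Fin (M.n + 1)) : ℝ := M.right j - M.left j

/-- The mesh size, the maximum of the cell lengths. -/
def h : ℝ := Finset.univ.sup' Finset.univ_nonempty M.width

/-- The mesh is quasi-uniform with constant `c`. -/
def QuasiUniform (c : ℝ) : Prop := ∀ j, M.h ≤ c * M.width j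

/-- A function on the mesh which is a polynomial on each cell. -/
abbrev PiecewisePoly : Type := Fin (M.n + 1) → ℝ[X]

/-- The left limits `v⁻` at the nodes; at the first node, where `v` has no left limit, the value
`β` is used. -/
def traceMinus (v : M.PiecewisePoly) (β : ℝ) (i : Fin (M.n + 2)) : ℝ :=
  Fin.cases (motive := fun _ => ℝ) β (fun j => (v j).eval (M.right j)) i

/-- The right limits `v⁺` at the nodes; at the last node, where `v` has no right limit, the value
`β` is used. -/
def tracePlus (v : M.PiecewisePoly) (β : ℝ) (i : Fin (M.n + 2)) : ℝ :=
  Fin.lastCases (motive := fun _ => ℝ) β (fun j => (v j).eval (M.left j)) i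

/-- The value taken for `v⁻` at the node `0`: the periodic continuation, or the datum `g`. -/
def firstValue (v : M.PiecewisePoly) : Option ℝ → ℝ
  | none => (v (Fin.last M.n)).eval (2 * Real.pi)
  | some g => g

/-- The value taken for `v⁺` at the node `2π`: the periodic continuation, or the datum `g`. -/
def lastValue (v : M.PiecewisePoly) : Option ℝ → ℝ
  | none => (v 0).eval 0
  | some g => g

end Mesh

/-- The datum `g₀(t)` at `x = 0`, if the boundary condition is not periodic. -/
def BoundaryCondition.firstDatum (t : ℝ) : BoundaryCondition → Option ℝ
  | .periodic => none
  | .mixed g₀ _ => some (g₀ t)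

/-- The datum `g₁(t)` at `x = 2π`, if the boundary condition is not periodic. -/
def BoundaryCondition.lastDatum (t : ℝ) : BoundaryCondition → Option ℝ
  | .periodic => none
  | .mixed _ g₁ => some (g₁ t)

/-! ### The LDG scheme -/

/-- The numerical flux `û` at time `t`. -/
def uFlux (M : Mesh) (fl : Flux) (bc : BoundaryCondition) (t : ℝ) (v : M.PiecewisePoly) :
    Fin (M.n + 2) → ℝ :=
  match fl with
  | .minusPlus => M.traceMinus v (M.firstValue v (bc.firstDatum t))
  | .plusMinus => M.tracePlus v (M.lastValue v (bc.lastDatum t))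

/-- The numerical flux `q̂` at time `t`. -/
def qFlux (M : Mesh) (fl : Flux) (bc : BoundaryCondition) (t : ℝ) (v : M.PiecewisePoly) :
    Fin (M.n + 2) → ℝ :=
  match fl with
  | .minusPlus => M.tracePlus v (M.lastValue v (bc.lastDatum t))
  | .plusMinus => M.traceMinus v (M.firstValue v (bc.firstDatum t))

/-- `(u_h, q_h)` solves the semi-discrete LDG scheme with polynomials of degree at most `k` on
`[0, T]`. -/
structure IsLDGSolution (M : Mesh) (k : ℕ) (fl : Flux) (bc : BoundaryCondition) (T : ℝ)
    (uh qh : ℝ → M.PiecewisePoly) : Prop where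
  natDegree_u : ∀ t ∈ Icc 0 T, ∀ j, (uh t j).natDegree ≤ k
  natDegree_q : ∀ t ∈ Icc 0 T, ∀ j, (qh t j).natDegree ≤ k
  differentiableOn : ∀ j i, DifferentiableOn ℝ (fun s => (uh s j).coeff i) (Icc 0 T)
  equation_u : ∀ t ∈ Icc 0 T, ∀ j, ∀ v : ℝ[X], v.natDegree ≤ k →
    ∫ x in (M.left j)..(M.right j),
        derivWithin (fun s => (uh s j).eval x) (Icc 0 T) t * v.eval x
      = -(∫ x in (M.left j)..(M.right j), (qh t j).eval x * (derivative v).eval x)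
        + qFlux M fl bc t (qh t) j.succ * v.eval (M.right j)
        - qFlux M fl bc t (qh t) j.castSucc * v.eval (M.left j)
  equation_q : ∀ t ∈ Icc 0 T, ∀ j, ∀ w : ℝ[X], w.natDegree ≤ k →
    ∫ x in (M.left j)..(M.right j), (qh t j).eval x * w.eval x
      = -(∫ x in (M.left j)..(M.right j), (uh t j).eval x * (derivative w).eval x)
        + uFlux M fl bc t (uh t) j.succ * w.eval (M.right j)
        - uFlux M fl bc t (uh t) j.castSucc * w.eval (M.left j)

/-! ### Legendre polynomials and Radau points -/

/-- The Legendre polynomial of degree `m` on `[-1, 1]`, with value `1` at `1` (Rodrigues). -/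
def legendre (m : ℕ) : ℝ[X] :=
  C (1 / ((2 : ℝ) ^ m * (m.factorial : ℝ))) * derivative^[m] ((X ^ 2 - 1) ^ m)

/-- The Legendre polynomial of degree `m` transplanted to `[a, b]`. -/
def cellLegendre (a b : ℝ) (m : ℕ) (x : ℝ) : ℝ :=
  (legendre m).eval ((x - (a + b) / 2) / ((b - a) / 2))

/-- The interior left Radau points of degree `k` in the cell `(a, b)`. -/
def leftRadau (a b : ℝ) (k : ℕ) : Set ℝ :=
  {x | x ∈ Ioo a b ∧ cellLegendre a b (k + 1) x + cellLegendre a b k x = 0}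

/-- The interior right Radau points of degree `k` in the cell `(a, b)`. -/
def rightRadau (a b : ℝ) (k : ℕ) : Set ℝ :=
  {x | x ∈ Ioo a b ∧ cellLegendre a b (k + 1) x - cellLegendre a b k x = 0}

/-! ### Gauss-Radau projections -/

/-- `p` is the Gauss-Radau projection of `v` on `[a, b]` which interpolates `v` at the end point
`e`: it has degree at most `k`, it has the same moments as `v` against the polynomials of degree
less than `k`, and it agrees with `v` at `e`. -/
def IsRadauProj (k : ℕ) (a b e : ℝ) (v : ℝ → ℝ) (p : ℝ[X]) : Prop :=
  p.natDegree ≤ k ∧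
    (∀ w : ℝ[X], w.degree < k → ∫ x in a..b, p.eval x * w.eval x = ∫ x in a..b, v x * w.eval x) ∧
    p.eval e = v e

/-- The Gauss-Radau projection (see `radauProj_spec` and `IsRadauProj.unique`). -/
def radauProj (k : ℕ) (a b e : ℝ) (v : ℝ → ℝ) : ℝ[X] :=
  Classical.epsilon (IsRadauProj k a b e v)

theorem radau_injective {k : ℕ} {a b e : ℝ} (hab : a < b) (he : e = a ∨ e = b) {p : ℝ[X]}
    (hp : p.degree < (k + 1 : ℕ))
    (hw : ∀ w : ℝ[X], w.degree < k → ∫ x in a..b, p.eval x * w.eval x = 0)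
    (hpe : p.eval e = 0) : p = 0 := by
  obtain ⟨r, rfl⟩ := dvd_iff_isRoot.mpr hpe
  by_contra hne
  have hr : r ≠ 0 := right_ne_zero_of_mul hne
  have hdeg : r.degree < k := by
    rw [degree_mul, degree_X_sub_C, degree_eq_natDegree hr] at hp
    rw [degree_eq_natDegree hr]
    norm_cast at hp ⊢
    omega
  have hint := hw r hdeg
  obtain ⟨c, hc, hrc⟩ : ∃ c ∈ Ioo a b, r.eval c ≠ 0 := by
    by_contra hcon
    push Not at hcon
    exact hr (eq_zero_of_infinite_isRoot r ((Ioo_infinite hab).mono fun x hx => hcon x hx))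
  have hsq : 0 < r.eval c * r.eval c := mul_self_pos.mpr hrc
  rcases he with rfl | rfl
  · have : 0 < ∫ x in e..b, ((X - C e) * r).eval x * r.eval x := by
      refine intervalIntegral.integral_pos hab (by fun_prop) (fun x hx => ?_)
        ⟨c, ⟨hc.1.le, hc.2.le⟩, ?_⟩
      · simp only [eval_mul, eval_sub, eval_X, eval_C, mul_assoc]
        exact mul_nonneg (by linarith [hx.1]) (mul_self_nonneg _)
      · simp only [eval_mul, eval_sub, eval_X, eval_C, mul_assoc]
        exact mul_pos (by linarith [hc.1]) hsq
    linarith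
  · have : 0 < ∫ x in a..e, -(((X - C e) * r).eval x * r.eval x) := by
      refine intervalIntegral.integral_pos hab (by fun_prop) (fun x hx => ?_)
        ⟨c, ⟨hc.1.le, hc.2.le⟩, ?_⟩
      · simp only [eval_mul, eval_sub, eval_X, eval_C, mul_assoc]
        nlinarith [mul_nonneg (sub_nonneg.mpr hx.2) (mul_self_nonneg (r.eval x))]
      · simp only [eval_mul, eval_sub, eval_X, eval_C, mul_assoc]
        nlinarith [mul_pos (sub_pos.mpr hc.2) hsq]
    rw [intervalIntegral.integral_neg] at this
    linarith

theorem IsRadauProj.unique {k : ℕ} {a b e : ℝ} {v : ℝ → ℝ} (hab : a < b) (he : e = a ∨ e = b)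
    {p p' : ℝ[X]} (hp : IsRadauProj k a b e v p) (hp' : IsRadauProj k a b e v p') : p = p' := by
  have hlt : ∀ q : ℝ[X], q.natDegree ≤ k → q.degree < (k + 1 : ℕ) := fun q hq =>
    lt_of_le_of_lt (natDegree_le_iff_degree_le.mp hq) (by exact_mod_cast Nat.lt_succ_self k)
  refine sub_eq_zero.mp (radau_injective (k := k) hab he ?_ (fun w hw => ?_) ?_)
  · exact hlt _ ((natDegree_sub_le p p').trans (max_le hp.1 hp'.1))
  · simp only [eval_sub, sub_mul]
    rw [intervalIntegral.integral_sub, hp.2.1 w hw, hp'.2.1 w hw, sub_self]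
    all_goals exact Continuous.intervalIntegrable (by fun_prop) _ _
  · rw [eval_sub, hp.2.2, hp'.2.2, sub_self]

theorem radauProj_spec {k : ℕ} {a b e : ℝ} {v : ℝ → ℝ} (hab : a < b) (he : e = a ∨ e = b)
    (hv : ContinuousOn v (Icc a b)) : IsRadauProj k a b e v (radauProj k a b e v) := by
  refine Classical.epsilon_spec (p := IsRadauProj k a b e v) ?_
  let V := degreeLT ℝ (k + 1)
  have ii : ∀ (p : ℝ[X]) (i : ℕ),
      IntervalIntegrable (fun x => p.eval x * x ^ i) volume a b := fun p i =>
    Continuous.intervalIntegrable (by fun_prop) _ _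
  let L : V →ₗ[ℝ] (Fin k → ℝ) × ℝ :=
    { toFun := fun p => (fun i => ∫ x in a..b, p.1.eval x * x ^ (i : ℕ), p.1.eval e)
      map_add' := fun p q => by
        ext i
        · simp only [Submodule.coe_add, eval_add, add_mul, Prod.mk_add_mk, Pi.add_apply]
          exact intervalIntegral.integral_add (ii _ _) (ii _ _)
        · simp
      map_smul' := fun c p => by
        ext i
        · simp only [Submodule.coe_smul, eval_smul, smul_eq_mul, mul_assoc, Prod.smul_mk,
            Pi.smul_apply, RingHom.id_apply]
          exact intervalIntegral.integral_const_mul _ _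
        · simp }
  have key : ∀ (f : ℝ → ℝ), ContinuousOn f (Icc a b) → ∀ w : ℝ[X], w.degree < k →
      ∫ x in a..b, f x * w.eval x
        = ∑ i ∈ Finset.range k, w.coeff i * ∫ x in a..b, f x * x ^ i := by
    intro f hf w hw
    have hw' : ∀ x, f x * w.eval x = ∑ i ∈ Finset.range k, w.coeff i * (f x * x ^ i) := by
      intro x
      by_cases h0 : w = 0
      · simp [h0]
      · rw [eval_eq_sum_range' ((natDegree_lt_iff_degree_lt h0).mpr hw), Finset.mul_sum]
        exact Finset.sum_congr rfl fun i _ => by ring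
    simp only [hw']
    rw [intervalIntegral.integral_finsetSum]
    · simp only [intervalIntegral.integral_const_mul]
    · intro i _
      refine ContinuousOn.intervalIntegrable ?_
      rw [uIcc_of_le hab.le]
      fun_prop
  have hinj : Function.Injective L := by
    rw [← LinearMap.ker_eq_bot, LinearMap.ker_eq_bot']
    intro p hp
    have h1 : ∀ i : Fin k, ∫ x in a..b, p.1.eval x * x ^ (i : ℕ) = 0 := fun i =>
      congrFun (congrArg Prod.fst hp) i
    have h2 : p.1.eval e = 0 := congrArg Prod.snd hp
    refine Subtype.ext (radau_injective (k := k) hab he (mem_degreeLT.mp p.2) (fun w hw => ?_) h2)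
    rw [key (fun x => p.1.eval x) (by fun_prop) w hw]
    exact Finset.sum_eq_zero fun i hi => by rw [h1 ⟨i, Finset.mem_range.mp hi⟩, mul_zero]
  have hfin : Module.finrank ℝ V = Module.finrank ℝ ((Fin k → ℝ) × ℝ) := by
    rw [(degreeLTEquiv ℝ (k + 1)).finrank_eq]
    simp
  have : FiniteDimensional ℝ V := (degreeLTEquiv ℝ (k + 1)).symm.finiteDimensional
  obtain ⟨p, hp⟩ := (LinearMap.injective_iff_surjective_of_finrank_eq_finrank hfin).mp hinj
    (fun i => ∫ x in a..b, v x * x ^ (i : ℕ), v e)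
  have hpd : p.1.degree < (k + 1 : ℕ) := mem_degreeLT.mp p.2
  refine ⟨p.1, ?_, fun w hw => ?_, congrArg Prod.snd hp⟩
  · exact Nat.lt_succ_iff.mp (by
      by_cases h0 : p.1 = 0
      · simp [h0]
      · exact (natDegree_lt_iff_degree_lt h0).mpr hpd)
  · rw [key (fun x => p.1.eval x) (by fun_prop) w hw, key v hv w hw]
    refine Finset.sum_congr rfl fun i hi => ?_
    have h1 : ∫ x in a..b, p.1.eval x * x ^ i = ∫ x in a..b, v x * x ^ i :=
      congrFun (congrArg Prod.fst hp) ⟨i, Finset.mem_range.mp hi⟩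
    rw [h1]

/-! ### The corrected interpolant that initializes the scheme -/

/-- `D_s⁻¹ v (x)`, the primitive from the left end point, scaled by the half-length. -/
def Dinv (a b : ℝ) (v : ℝ → ℝ) (x : ℝ) : ℝ := ((b - a) / 2)⁻¹ * ∫ y in a..x, v y

/-- `F₁ = P⁺ D_s⁻¹ L_k`. -/
def F₁ (k : ℕ) (a b : ℝ) : ℝ[X] := radauProj k a b a (Dinv a b (cellLegendre a b k))

/-- `F₂ = P⁻ D_s⁻¹ L_k`. -/
def F₂ (k : ℕ) (a b : ℝ) : ℝ[X] := radauProj k a b b (Dinv a b (cellLegendre a b k))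

/-- `F̄₁ = P⁻ D_s⁻¹ F₁`. -/
def F₁bar (k : ℕ) (a b : ℝ) : ℝ[X] := radauProj k a b b (Dinv a b fun x => (F₁ k a b).eval x)

/-- `F̄₂ = P⁺ D_s⁻¹ F₂`. -/
def F₂bar (k : ℕ) (a b : ℝ) : ℝ[X] := radauProj k a b a (Dinv a b fun x => (F₂ k a b).eval x)

/-- The coefficient of `L_k` in the Legendre expansion of `v - P⁻ v`. -/
def coeffMinus (k : ℕ) (a b : ℝ) (v : ℝ → ℝ) : ℝ :=
  -v b + 1 / (b - a) * ∫ x in a..b,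
    v x * ∑ m ∈ Finset.range (k + 1), (2 * (m : ℝ) + 1) * cellLegendre a b m x

/-- The coefficient of `L_k` in the Legendre expansion of `v - P⁺ v`. -/
def coeffPlus (k : ℕ) (a b : ℝ) (v : ℝ → ℝ) : ℝ :=
  (-1) ^ (k + 1) * v a + 1 / (b - a) * ∫ x in a..b,
    v x * ∑ m ∈ Finset.range (k + 1), (-1) ^ (k + m) * (2 * (m : ℝ) + 1) * cellLegendre a b m x

/-- The corrected interpolant `u_I` (two correction steps) of `u` at time `t`, on the cell
`[a, b]`. With `h̄ = (b - a) / 2` it is `P⁻u - (h̄² G₁ F̄₁ + h̄ Q₀ F₂)` for the first choice of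
fluxes and `P⁺u - (h̄ Q₀ F₁ + h̄² G₁ F̄₂)` for the second one, where `G₁` is the time derivative
of the `L_k`-coefficient of `u - P^∓ u` and `Q₀` is the `L_k`-coefficient of `u_x - P^± u_x`. -/
def interpolant (k : ℕ) (fl : Flux) (T : ℝ) (u : ℝ → ℝ → ℝ) (t a b : ℝ) : ℝ[X] :=
  match fl with
  | .minusPlus =>
    radauProj k a b b (u t) -
      (C (((b - a) / 2) ^ 2 * derivWithin (fun s => coeffMinus k a b (u s)) (Icc 0 T) t)
          * F₁bar k a b
        + C ((b - a) / 2 * coeffPlus k a b (dx (u t))) * F₂ k a b)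
  | .plusMinus =>
    radauProj k a b a (u t) -
      (C ((b - a) / 2 * coeffMinus k a b (dx (u t))) * F₁ k a b
        + C (((b - a) / 2) ^ 2 * derivWithin (fun s => coeffPlus k a b (u s)) (Icc 0 T) t)
          * F₂bar k a b)

/-! ### The derivative errors -/

/-- The maximum over the cells `j`, and over the points `x` of the set `R a b` of a cell `(a, b)`,
of `|v_x(x) - v_{h,x}(x)|`. -/
def derivError (M : Mesh) (R : ℝ → ℝ → Set ℝ) (v : ℝ → ℝ) (vh : M.PiecewisePoly) : ENNReal :=
  ⨆ (j : Fin (M.n + 1)) (x : ℝ) (_ : x ∈ R (M.left j) (M.right j)),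
    ENNReal.ofReal |dx v x - (derivative (vh j)).eval x|

end

end LDG

namespace LDG
noncomputable section

/-! ### Smoothing estimates for the semigroup of `-N†N` and the error equations -/

section Semigroup

variable {E : Type*} [NormedAddCommGroup E] [InnerProductSpace ℝ E]

open scoped InnerProductSpace

/-! The discrete solution is compared not with `u, q` but with corrected Gauss-Radau interpolants
`u_I, q_I`; the differences are estimated by parabolic smoothing and then differentiated by an
inverse inequality.

Consistency. The Radau projection of `u` reproduces the flux and the term `(u, w_x)` exactly, but
the projection of `q` leaves a multiple of `L_k` in the mass term. For `v` of mean zero the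
corrector `C v = P D_s⁻¹ v` satisfies `(C v, w_x) = -(v, w) / h̄`
(`integral_corrector_mul_derivative`), so subtracting a corrector removes a residual and leaves one
that is smaller by a factor `h̄`. After two such steps (`interp_consistency`) the residual is `h̄²`
times a Radau coefficient, which makes it `O(h^{k+3})`. The second step needs a corrector of mean
zero, which holds for `k ≥ 2`.

Error equations. In orthonormal coordinates the alternating fluxes make the two discrete derivatives
negative adjoints of each other (`adjoint_uOp`). Hence the coordinates `x, y` of `u_I - u_h, q_I -
q_h` satisfy `y = N x + g`, `x' = -N†y - W'`, and `x(0) = 0` by the choice of the initial value.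
Both `g` and `W` have size `G = O(h^{k+3})`, but the available regularity only gives `W' = O(G/h)`
and `g' = O(G/h²)`.

Smoothing. Using `W'` on all of `[0,t]` would cost `G t / h`. Instead `x(t)` is tested against the
backward flow `exp(-(t-s) N†N) φ`, on which each factor `N` or `N†` costs `(t-s)^{-1/2}`
(`exists_adjoint_flow`). Away from the final time, `W'` is integrated by parts in time and the
derivative falls on the flow; near the final time `W'`, and for `y` also `g'`, is used directly.
Cutting at the distances `h` and `h²` from `t` yields `‖x‖ ≲ G (h^{-1/2} + t)` and `‖y‖ ≲ G
(h^{-1/2} + √t)` (`norm_x_le`, `norm_y_le`). The inverse inequality costs `h^{-3/2}`, which gives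
exactly the rates of the theorem.

Superconvergence of the interpolant. For `p` of degree `k+1`, the derivative of `p - P p` vanishes
at the interior Radau points of the opposite family (`eval_derivative_eq_zero_of_radau`), and the
correctors change derivatives only by `O(h^{k+1})`.

Regularity. Weak derivatives up to order `k+4` become `k+3` classical ones, the last of them
Lipschitz (`IsTower`). The heat equation then exchanges one time derivative for two space
derivatives under every sup-bounded functional, up to and including `t = 0` (`time_deriv_uniform`).
-/

theorem abs_inner_le_of_le {x y : E} {a b : ℝ} (hx : ‖x‖ ≤ a) (hy : ‖y‖ ≤ b) : |⟪x, y⟫_ℝ| ≤ a * b :=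
  (abs_real_inner_le_norm x y).trans
    (mul_le_mul hx hy (norm_nonneg _) ((norm_nonneg _).trans hx))

theorem norm_le_of_forall_inner_le {x : E} {C : ℝ} (h : ∀ φ : E, ‖φ‖ = 1 → |⟪x, φ⟫_ℝ| ≤ C)
    (hC : 0 ≤ C) : ‖x‖ ≤ C := by
  by_cases hx : x = 0
  · simpa [hx] using hC
  have hx' : ‖x‖ ≠ 0 := norm_ne_zero_iff.mpr hx
  have := h (‖x‖⁻¹ • x) (by rw [norm_smul, norm_inv, norm_norm, inv_mul_cancel₀ hx'])
  rw [inner_smul_right, real_inner_self_eq_norm_sq, sq, ← mul_assoc, inv_mul_cancel₀ hx', one_mul,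
    abs_of_nonneg (norm_nonneg x)] at this
  exact this

variable [FiniteDimensional ℝ E]

local notation:max N "†" => LinearMap.adjoint N

theorem exp_neg_mul_le_one_div {l σ : ℝ} (hσ : 0 < σ) : l * Real.exp (-(l * σ)) ≤ 1 / σ := by
  rw [le_div_iff₀ hσ, Real.exp_neg, mul_right_comm, ← div_eq_mul_inv,
    div_le_one (Real.exp_pos _)]
  linarith [Real.add_one_le_exp (l * σ)]

/-- In an eigenbasis of the symmetric operator `N†N`, with eigenvalues `l ≥ 0`, the flow is
multiplication by `e^{-lσ}`, and `‖N v‖² = ⟨v, N†N v⟩`. The bounds thus reduce to `l^{j/2} e^{-lσ} ≤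
σ^{-j/2}` for `j = 1, 2, 3`. They do not depend on `N`, hence not on the mesh. -/
theorem exists_adjoint_flow (N : E →ₗ[ℝ] E) (ψ : E) :
    ∃ z : ℝ → E, z 0 = ψ ∧ (∀ σ, HasDerivAt z (-(N† (N (z σ)))) σ) ∧
      (∀ σ, 0 ≤ σ → ‖z σ‖ ≤ ‖ψ‖) ∧
      ∀ σ, 0 < σ → ‖N (z σ)‖ ≤ ‖ψ‖ / √σ ∧ ‖N† (N (z σ))‖ ≤ ‖ψ‖ / σ ∧
        ‖N (N† (N (z σ)))‖ ≤ ‖ψ‖ / (σ * √σ) := by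
  have hA : (N† ∘ₗ N).IsSymmetric := fun x y => by
    simp [LinearMap.adjoint_inner_left, LinearMap.adjoint_inner_right]
  let b := hA.eigenvectorBasis rfl
  let l := hA.eigenvalues rfl
  have hl : ∀ i, 0 ≤ l i := fun i => by
    have h1 := hA.apply_eigenvectorBasis rfl i
    have h2 : ⟪N (b i), N (b i)⟫_ℝ = l i := by
      rw [← LinearMap.adjoint_inner_right]
      change ⟪b i, (N† ∘ₗ N) (b i)⟫_ℝ = l i
      rw [h1, inner_smul_right, real_inner_self_eq_norm_sq, b.norm_eq_one]
      simp [l]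
    rw [← h2]
    exact real_inner_self_nonneg
  let c : Fin (Module.finrank ℝ E) → ℝ := fun i => ⟪b i, ψ⟫_ℝ
  let v : (Fin (Module.finrank ℝ E) → ℝ) → E := fun f => ∑ i, (f i * c i) • b i
  have hv_inner : ∀ f g, ⟪v f, v g⟫_ℝ = ∑ i, f i * g i * c i ^ 2 := fun f g => by
    simp only [v]
    rw [b.orthonormal.inner_sum]
    exact Finset.sum_congr rfl fun i _ => by simp; ring
  have hv_one : v (fun _ => 1) = ψ := by
    simp only [v, one_mul, c]
    exact b.sum_repr' ψ
  have hψ : ‖ψ‖ ^ 2 = ∑ i, c i ^ 2 := by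
    rw [← hv_one, ← real_inner_self_eq_norm_sq, hv_inner]
    simp
  have hv_norm : ∀ f C, 0 ≤ C → (∀ i, |f i| ≤ C) → ‖v f‖ ≤ C * ‖ψ‖ := fun f C hC hf => by
    refine abs_le_of_sq_le_sq' ?_ (by positivity) |>.2
    rw [mul_pow, hψ, ← real_inner_self_eq_norm_sq, hv_inner, Finset.mul_sum]
    refine Finset.sum_le_sum fun i _ => mul_le_mul_of_nonneg_right ?_ (sq_nonneg _)
    rw [← sq, ← sq_abs]
    exact pow_le_pow_left₀ (abs_nonneg _) (hf i) 2
  have hv_A : ∀ f, N† (N (v f)) = v (fun i => l i * f i) := fun f => by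
    change (N† ∘ₗ N) (v f) = _
    simp only [v, map_sum, map_smul]
    refine Finset.sum_congr rfl fun i _ => ?_
    rw [hA.apply_eigenvectorBasis rfl i, smul_smul]
    congr 1
    simp [l]
    ring
  have hv_N : ∀ f, ‖N (v f)‖ = ‖v (fun i => √(l i) * f i)‖ := fun f => by
    rw [← sq_eq_sq₀ (norm_nonneg _) (norm_nonneg _), ← real_inner_self_eq_norm_sq,
      ← real_inner_self_eq_norm_sq, ← LinearMap.adjoint_inner_right, hv_A, hv_inner, hv_inner]
    refine Finset.sum_congr rfl fun i _ => ?_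
    have := Real.mul_self_sqrt (hl i)
    linear_combination (-(f i ^ 2 * c i ^ 2)) * this
  let z : ℝ → E := fun σ => v fun i => Real.exp (-(l i * σ))
  have hle : ∀ i σ, 0 ≤ σ → Real.exp (-(l i * σ)) ≤ 1 := fun i σ hσ =>
    Real.exp_le_one_iff.mpr (neg_nonpos.mpr (mul_nonneg (hl i) hσ))
  have hhalf : ∀ i σ, 0 < σ → √(l i) * Real.exp (-(l i * σ)) ≤ 1 / √σ := fun i σ hσ => by
    refine abs_le_of_sq_le_sq' ?_ (by positivity) |>.2
    rw [mul_pow, Real.sq_sqrt (hl i), div_pow, one_pow, Real.sq_sqrt hσ.le, sq, ← mul_assoc]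
    calc _ ≤ l i * Real.exp (-(l i * σ)) * 1 :=
          mul_le_mul_of_nonneg_left (hle i σ hσ.le) (mul_nonneg (hl i) (Real.exp_pos _).le)
      _ ≤ 1 / σ := by rw [mul_one]; exact exp_neg_mul_le_one_div hσ
  refine ⟨z, ?_, fun σ => ?_, fun σ hσ => ?_, fun σ hσ => ⟨?_, ?_, ?_⟩⟩
  · simp only [z, mul_zero, neg_zero, Real.exp_zero]
    exact hv_one
  · rw [hv_A]
    have : -(v fun i => l i * Real.exp (-(l i * σ)))
        = ∑ i, (Real.exp (-(l i * σ)) * (-(l i)) * c i) • b i := by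
      simp only [v, ← Finset.sum_neg_distrib, ← neg_smul]
      exact Finset.sum_congr rfl fun i _ => by congr 1; ring
    rw [this]
    refine HasDerivAt.fun_sum fun i _ => ?_
    refine HasDerivAt.smul_const (HasDerivAt.mul_const (HasDerivAt.exp ?_) _) _
    simpa using ((hasDerivAt_id σ).const_mul (l i)).fun_neg
  · simpa using hv_norm _ 1 zero_le_one fun i => by
      rw [abs_of_pos (Real.exp_pos _)]; exact hle i σ hσ
  · rw [hv_N, div_eq_mul_one_div, mul_comm]
    refine hv_norm _ _ (by positivity) fun i => ?_
    rw [abs_of_nonneg (by positivity)]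
    exact hhalf i σ hσ
  · rw [hv_A, div_eq_mul_one_div, mul_comm]
    refine hv_norm _ _ (by positivity) fun i => ?_
    rw [abs_of_nonneg (mul_nonneg (hl i) (Real.exp_pos _).le)]
    exact exp_neg_mul_le_one_div hσ
  · rw [hv_A, hv_N, div_eq_mul_one_div, mul_comm]
    refine hv_norm _ _ (by positivity) fun i => ?_
    have := hl i
    rw [abs_of_nonneg (by positivity)]
    have hs2 : Real.exp (-(l i * σ)) = Real.exp (-(l i * (σ / 2))) * Real.exp (-(l i * (σ / 2))) := by
      rw [← Real.exp_add]; congr 1; ring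
    -- With `y² = lσ` this is `y³ ≤ 1 + y² + y⁴/2 ≤ e^{y²}`.
    have hx : l i * σ * √(l i * σ) ≤ Real.exp (l i * σ) := by
      set y := √(l i * σ) with hy
      have hyy : l i * σ = y ^ 2 := (Real.sq_sqrt (by positivity)).symm
      rw [hyy]
      have hy0 : 0 ≤ y := Real.sqrt_nonneg _
      have h3 := Real.quadratic_le_exp_of_nonneg (sq_nonneg y)
      nlinarith [sq_nonneg (y - 1), sq_nonneg (y ^ 2 - y)]
    rw [Real.exp_neg, le_div_iff₀ (by positivity)]
    rw [Real.sqrt_mul this] at hx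
    calc _ = (l i * σ * (√(l i) * √σ)) * (Real.exp (l i * σ))⁻¹ := by ring
      _ ≤ 1 := by rwa [← div_eq_mul_inv, div_le_one (Real.exp_pos _)]

/-- A mean value inequality with a variable bound, on `[a, b]`. -/
theorem abs_sub_le_of_deriv_bound {a b : ℝ} (hab : a ≤ b) {p p' B B' : ℝ → ℝ}
    (hp : ∀ s ∈ Icc a b, HasDerivWithinAt p (p' s) (Icc a b) s) (hB : ContinuousOn B (Icc a b))
    (hB' : ∀ s ∈ Ico a b, HasDerivAt B (B' s) s) (h : ∀ s ∈ Ico a b, |p' s| ≤ B' s) :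
    |p b - p a| ≤ B b - B a := by
  have := image_norm_le_of_norm_deriv_right_le_deriv_boundary' (f := fun s => p s - p a)
    (f' := p') (a := a) (b := b) (B := fun s => B s - B a) (B' := B')
    (fun s hs => ((hp s hs).continuousWithinAt).sub continuousWithinAt_const)
    (fun s hs => ((hp s ⟨hs.1, hs.2.le⟩).sub_const (p a)).mono_of_mem_nhdsWithin
      (Icc_mem_nhdsGE_of_mem hs)) (by simp)
    (hB.sub continuousOn_const) (fun s hs => ((hB' s hs).sub_const _).hasDerivWithinAt)
    (fun s hs => by simpa using h s hs) (right_mem_Icc.mpr hab)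
  simpa using this

/-- The right-hand side is the increment of an explicit antiderivative. The condition `b < T` keeps
the non-integrable singularities out of the interval. -/
theorem abs_sub_le_of_singular_deriv_bound {a b T α₀ α₁ α₂ α₃ : ℝ} (hab : a ≤ b) (hb : b < T)
    {p p' : ℝ → ℝ} (hp : ∀ s ∈ Icc a b, HasDerivWithinAt p (p' s) (Icc a b) s)
    (h : ∀ s ∈ Ico a b, |p' s| ≤ α₀ + α₁ / √(T - s) + α₂ / (T - s) + α₃ / ((T - s) * √(T - s))) :
    |p b - p a| ≤ α₀ * (b - a) + 2 * α₁ * (√(T - a) - √(T - b))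
      + α₂ * (Real.log (T - a) - Real.log (T - b)) + 2 * α₃ * (1 / √(T - b) - 1 / √(T - a)) := by
  have hd : ∀ s ∈ Icc a b, HasDerivAt (fun s => α₀ * s - 2 * α₁ * √(T - s) - α₂ * Real.log (T - s)
      + 2 * α₃ * (√(T - s))⁻¹)
      (α₀ + α₁ / √(T - s) + α₂ / (T - s) + α₃ / ((T - s) * √(T - s))) s := fun s hs => by
    have hpos : 0 < T - s := by linarith [hs.2]
    have h1 : HasDerivAt (fun s => T - s) (-1) s := by
      simpa using (hasDerivAt_id s).const_sub T
    have h2 := h1.sqrt hpos.ne'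
    have h3 := h1.log hpos.ne'
    have h4 := h2.fun_inv (Real.sqrt_pos.mpr hpos).ne'
    refine ((((hasDerivAt_id s).const_mul α₀).sub (h2.const_mul (2 * α₁))).sub
      (h3.const_mul α₂)).add (h4.const_mul (2 * α₃)) |>.congr_deriv ?_
    rw [Real.sq_sqrt hpos.le]
    have := (Real.sqrt_pos.mpr hpos).ne'
    field_simp
    ring
  have := abs_sub_le_of_deriv_bound hab hp (fun s hs => (hd s hs).continuousAt.continuousWithinAt)
    (fun s hs => hd s ⟨hs.1, hs.2.le⟩) h
  refine this.trans (le_of_eq ?_)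
  simp only [one_div]
  ring

/-- Only the integrable singularity is present, so the interval may reach `T`, where the
antiderivative is merely continuous. -/
theorem abs_sub_le_of_singular_deriv_bound_end {a T α₀ α₁ : ℝ} (hab : a ≤ T)
    {p p' : ℝ → ℝ} (hp : ∀ s ∈ Icc a T, HasDerivWithinAt p (p' s) (Icc a T) s)
    (h : ∀ s ∈ Ico a T, |p' s| ≤ α₀ + α₁ / √(T - s)) :
    |p T - p a| ≤ α₀ * (T - a) + 2 * α₁ * √(T - a) := by
  have hd : ∀ s ∈ Ico a T, HasDerivAt (fun s => α₀ * s - 2 * α₁ * √(T - s))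
      (α₀ + α₁ / √(T - s)) s := fun s hs => by
    have hpos : 0 < T - s := by linarith [hs.2]
    have h1 : HasDerivAt (fun s => T - s) (-1) s := by
      simpa using (hasDerivAt_id s).const_sub T
    have h2 := h1.sqrt hpos.ne'
    refine (((hasDerivAt_id s).const_mul α₀).sub (h2.const_mul (2 * α₁))) |>.congr_deriv ?_
    have := (Real.sqrt_pos.mpr hpos).ne'
    field_simp
    ring
  have := abs_sub_le_of_deriv_bound hab hp (by fun_prop) hd h
  refine this.trans (le_of_eq ?_)
  simp
  ring

/-- The error equations `x' = -N†y - W'`, `y = Nx + g` on `[0, T]` with `x(0) = 0`, where `g` and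
`W` have size `G` and vary on the time scales `h²` and `h`. -/
structure IsErrorSystem (N : E →ₗ[ℝ] E) (T h G : ℝ) (x y g g' W W' : ℝ → E) : Prop where
  zero : x 0 = 0
  eq_y : ∀ s ∈ Icc 0 T, y s = N (x s) + g s
  deriv_x : ∀ s ∈ Icc 0 T, HasDerivWithinAt x (-(N† (y s)) - W' s) (Icc 0 T) s
  deriv_g : ∀ s ∈ Icc 0 T, HasDerivWithinAt g (g' s) (Icc 0 T) s
  deriv_W : ∀ s ∈ Icc 0 T, HasDerivWithinAt W (W' s) (Icc 0 T) s
  norm_g : ∀ s ∈ Icc 0 T, ‖g s‖ ≤ G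
  norm_W : ∀ s ∈ Icc 0 T, ‖W s‖ ≤ G
  norm_deriv_W : ∀ s ∈ Icc 0 T, ‖W' s‖ ≤ G / h
  norm_deriv_g : ∀ s ∈ Icc 0 T, ‖g' s‖ ≤ G / h ^ 2

/-- The test function runs backwards in time, so its derivative has the sign that cancels the
dissipative term of `w'`. -/
theorem hasDerivWithinAt_inner_flow {N : E →ₗ[ℝ] E} {z : ℝ → E}
    (hz : ∀ σ, HasDerivAt z (-(N† (N (z σ)))) σ) {w : ℝ → E} {w' : E} {I J : Set ℝ} {s T : ℝ}
    (hw : HasDerivWithinAt w w' I s) (hJ : J ⊆ I) :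
    HasDerivWithinAt (fun s => ⟪w s, z (T - s)⟫_ℝ)
      (⟪w', z (T - s)⟫_ℝ + ⟪w s, N† (N (z (T - s)))⟫_ℝ) J s := by
  have h1 : HasDerivAt (fun s => z (T - s)) (N† (N (z (T - s)))) s := by
    have := (hz (T - s)).scomp s ((hasDerivAt_id s).const_sub T)
    simpa [Function.comp_def] using this
  have := (hw.mono hJ).inner ℝ (h1.hasDerivWithinAt (s := J))
  rwa [add_comm] at this

theorem neg_log_le_inv_sqrt {h : ℝ} (h0 : 0 < h) : -Real.log h ≤ 2 * (1 / √h) := by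
  have h1 := Real.add_one_le_exp (Real.log (1 / √h))
  rw [Real.exp_log (by positivity), one_div, Real.log_inv, Real.log_sqrt h0.le] at h1
  rw [one_div]
  linarith

theorem log_le_two_mul_sqrt {t : ℝ} (h0 : 0 < t) : Real.log t ≤ 2 * √t := by
  have h1 := Real.add_one_le_exp (Real.log √t)
  rw [Real.exp_log (by positivity), Real.log_sqrt h0.le] at h1
  linarith

/-! ### Duality estimates for the error equations -/

namespace IsErrorSystem

variable {N : E →ₗ[ℝ] E} {T h G : ℝ} {x y g g' W W' : ℝ → E}

/-- Pairing `x` with the backward flow leaves `-⟨W', z⟩ - ⟨g, N z⟩`. The second term integrates to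
`O(G √T)`. On `[T-h, T]` the first contributes `(G/h) h`. On `[0, T-h]` the pairing of `x + W`
replaces it by `⟨W, N†N z⟩ = O(G/(T-s))`, whose integral `G log(T/h)` is absorbed by `G (h^{-1/2} +
T)`. -/
theorem norm_x_le (H : IsErrorSystem N T h G x y g g' W W') (hT : 0 ≤ T) (h0 : 0 < h) (h1 : h ≤ 1) :
    ‖x T‖ ≤ 8 * G * (1 / √h + T) := by
  have hG : 0 ≤ G := (norm_nonneg _).trans (H.norm_g 0 (left_mem_Icc.mpr hT))
  have hsh : 1 ≤ 1 / √h := by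
    rw [le_div_iff₀ (by positivity), one_mul]
    exact Real.sqrt_le_one.mpr h1
  have hsT : 2 * √T ≤ 1 + T := by nlinarith [sq_nonneg (√T - 1), Real.sq_sqrt hT]
  refine norm_le_of_forall_inner_le (fun φ hφ => ?_) (by positivity)
  obtain ⟨z, hz0, hz, hz1, hz2⟩ := exists_adjoint_flow N φ
  rw [hφ] at hz1 hz2
  have hend : ∀ a, 0 ≤ a → a ≤ T →
      |⟪x T, φ⟫_ℝ - ⟪x a, z (T - a)⟫_ℝ| ≤ G / h * (T - a) + 2 * G * √(T - a) := by
    intro a ha haT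
    have hsub : Icc a T ⊆ Icc 0 T := Icc_subset_Icc_left ha
    have := abs_sub_le_of_singular_deriv_bound_end (p := fun s => ⟪x s, z (T - s)⟫_ℝ) (T := T)
      (α₀ := G / h) (α₁ := G) haT
      (fun s hs => hasDerivWithinAt_inner_flow hz (H.deriv_x s (hsub hs)) hsub) fun s hs => by
        have hs' := hsub ⟨hs.1, hs.2.le⟩
        have hσ : 0 < T - s := by linarith [hs.2]
        have e : ⟪-(N† (y s)) - W' s, z (T - s)⟫_ℝ + ⟪x s, N† (N (z (T - s)))⟫_ℝ
            = -⟪W' s, z (T - s)⟫_ℝ - ⟪g s, N (z (T - s))⟫_ℝ := by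
          rw [H.eq_y s hs', inner_sub_left, inner_neg_left, LinearMap.adjoint_inner_left,
            LinearMap.adjoint_inner_right, inner_add_left]
          ring
        rw [e]
        refine (abs_sub _ _).trans (add_le_add ?_ ?_)
        · rw [abs_neg]
          simpa using abs_inner_le_of_le (H.norm_deriv_W s hs') (hz1 _ hσ.le)
        · rw [div_eq_mul_one_div]
          exact abs_inner_le_of_le (H.norm_g s hs') (hz2 _ hσ).1
    simpa [hz0] using this
  -- For `T < h` the final piece is the whole interval, and it starts from `x(0) = 0`.
  rcases lt_or_ge T h with hTh | hTh
  · have h2 := hend 0 le_rfl hT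
    rw [H.zero, inner_zero_left, sub_zero, sub_zero] at h2
    have : G / h * T ≤ G := by
      rw [div_mul_eq_mul_div, div_le_iff₀ h0]
      exact mul_le_mul_of_nonneg_left hTh.le hG
    nlinarith
  · have hb : T - h ∈ Icc 0 T := ⟨by linarith, by linarith⟩
    have h2 := hend (T - h) hb.1 hb.2
    have hsub : Icc 0 (T - h) ⊆ Icc 0 T := Icc_subset_Icc_right hb.2
    have h3 := abs_sub_le_of_singular_deriv_bound (p := fun s => ⟪x s + W s, z (T - s)⟫_ℝ) (T := T)
      (α₀ := 0) (α₁ := G) (α₂ := G) (α₃ := 0) hb.1 (by linarith)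
      (fun s hs => hasDerivWithinAt_inner_flow hz
        ((H.deriv_x s (hsub hs)).add (H.deriv_W s (hsub hs))) hsub) fun s hs => by
        have hs' := hsub ⟨hs.1, hs.2.le⟩
        have hσ : 0 < T - s := by linarith [hs.2]
        have e : ⟪-(N† (y s)) - W' s + W' s, z (T - s)⟫_ℝ + ⟪x s + W s, N† (N (z (T - s)))⟫_ℝ
            = -⟪g s, N (z (T - s))⟫_ℝ + ⟪W s, N† (N (z (T - s)))⟫_ℝ := by
          rw [sub_add_cancel, H.eq_y s hs', inner_neg_left, LinearMap.adjoint_inner_left,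
            inner_add_left, inner_add_left, LinearMap.adjoint_inner_right]
          ring
        rw [e, zero_add, zero_div, add_zero]
        refine (abs_add_le _ _).trans (add_le_add ?_ ?_)
        · rw [abs_neg, div_eq_mul_one_div]
          exact abs_inner_le_of_le (H.norm_g s hs') (hz2 _ hσ).1
        · rw [div_eq_mul_one_div]
          exact abs_inner_le_of_le (H.norm_W s hs') (hz2 _ hσ).2.1
    simp only [H.zero, zero_add, sub_zero, sub_sub_cancel, inner_add_left] at h2 h3
    have h4 := abs_inner_le_of_le (H.norm_W 0 (left_mem_Icc.mpr hT)) (hz1 T hT)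
    have h5 := abs_inner_le_of_le (H.norm_W _ hb) (hz1 h h0.le)
    have h6 : G / h * h = G := div_mul_cancel₀ _ h0.ne'
    have h7 : Real.log T - Real.log h ≤ 2 * (1 / √h) + T := by
      have := neg_log_le_inv_sqrt h0
      have := Real.log_le_sub_one_of_pos (h0.trans_le hTh)
      linarith
    have h8 := mul_le_mul_of_nonneg_left h7 hG
    have h9 := mul_le_mul_of_nonneg_left hsT hG
    have h10 := mul_le_mul_of_nonneg_left hsh hG
    have h11 := mul_nonneg hG hT
    rw [abs_le] at h2 h3 h4 h5 ⊢
    constructor <;> linarith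

/-- There are three regimes. Within `h²` of `T` the pairing of `y` uses `g'` and `W'` directly.
Between the distances `h²` and `h` the pairing of `N x` avoids `g'` and costs `(G/h) √h`. Beyond `h`
the pairing of `N (x + W)` avoids `W'` too, at the price of `⟨W, N†N N†z⟩ = O(G (T-s)^{-3/2})`,
which integrates to `O(G h^{-1/2})`. The terms with `g` give logarithms. -/
theorem norm_y_le (H : IsErrorSystem N T h G x y g g' W W') (hT : 0 ≤ T) (h0 : 0 < h) (h1 : h ≤ 1) :
    ‖y T‖ ≤ 20 * G * (1 / √h + √T) := by
  have hG : 0 ≤ G := (norm_nonneg _).trans (H.norm_g 0 (left_mem_Icc.mpr hT))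
  have hsh : 1 ≤ 1 / √h := by
    rw [le_div_iff₀ (by positivity), one_mul]
    exact Real.sqrt_le_one.mpr h1
  have hlog := neg_log_le_inv_sqrt h0
  have hG1 := mul_le_mul_of_nonneg_left hsh hG
  have hG2 := mul_nonneg hG (Real.sqrt_nonneg T)
  have hG3 := mul_le_mul_of_nonneg_left hlog hG
  have hh2 : h ^ 2 ≤ h := by nlinarith
  refine norm_le_of_forall_inner_le (fun φ hφ => ?_) (by positivity)
  -- `N x` evolves by `-N N† y`, so the dual flow is that of `N N†`, the flow attached to the
  -- operator `N†`.
  obtain ⟨z, hz0, hz, hz1, hz2⟩ := exists_adjoint_flow (N†) φ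
  rw [hφ] at hz1 hz2
  simp only [LinearMap.adjoint_adjoint] at hz2
  have hz' : ∀ σ, HasDerivAt z (-((N†)† (N† (z σ)))) σ := hz
  have hyg : ∀ s ∈ Icc 0 T, HasDerivWithinAt (fun s => N (x s)) (-(N (N† (y s))) - N (W' s))
      (Icc 0 T) s := fun s hs => by
    have := (N.toContinuousLinearMap.hasFDerivAt (x := x s)).comp_hasDerivWithinAt s (H.deriv_x s hs)
    simpa [Function.comp_def] using this
  have hNW : ∀ s ∈ Icc 0 T, HasDerivWithinAt (fun s => N (W s)) (N (W' s))
      (Icc 0 T) s := fun s hs => by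
    have := (N.toContinuousLinearMap.hasFDerivAt (x := W s)).comp_hasDerivWithinAt s (H.deriv_W s hs)
    simpa [Function.comp_def] using this
  have hend : ∀ a, 0 ≤ a → a ≤ T → |⟪y T, φ⟫_ℝ - ⟪N (x a) + g a, z (T - a)⟫_ℝ|
      ≤ G / h ^ 2 * (T - a) + 2 * (G / h) * √(T - a) := by
    intro a ha haT
    have hsub : Icc a T ⊆ Icc 0 T := Icc_subset_Icc_left ha
    have := abs_sub_le_of_singular_deriv_bound_end
      (p := fun s => ⟪N (x s) + g s, z (T - s)⟫_ℝ) (T := T)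
      (α₀ := G / h ^ 2) (α₁ := G / h) haT
      (fun s hs => hasDerivWithinAt_inner_flow hz'
        ((hyg s (hsub hs)).add (H.deriv_g s (hsub hs))) hsub) fun s hs => by
        have hs' := hsub ⟨hs.1, hs.2.le⟩
        have hσ : 0 < T - s := by linarith [hs.2]
        have e : ⟪-(N (N† (y s))) - N (W' s) + g' s, z (T - s)⟫_ℝ
              + ⟪N (x s) + g s, (N†)† (N† (z (T - s)))⟫_ℝ
            = ⟪g' s, z (T - s)⟫_ℝ - ⟪W' s, N† (z (T - s))⟫_ℝ := by
          rw [← H.eq_y s hs', inner_add_left, inner_sub_left, inner_neg_left,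
            LinearMap.adjoint_adjoint, ← LinearMap.adjoint_inner_right N,
            ← LinearMap.adjoint_inner_right N, LinearMap.adjoint_inner_left]
          ring
        rw [e]
        refine (abs_sub _ _).trans (add_le_add ?_ ?_)
        · simpa using abs_inner_le_of_le (H.norm_deriv_g s hs') (hz1 _ hσ.le)
        · rw [div_eq_mul_one_div (G / h)]
          exact abs_inner_le_of_le (H.norm_deriv_W s hs') (hz2 _ hσ).1
    simpa [hz0, ← H.eq_y T (right_mem_Icc.mpr hT)] using this
  have hmid : ∀ a b, 0 ≤ a → a ≤ b → b < T →
      |⟪N (x b), z (T - b)⟫_ℝ - ⟪N (x a), z (T - a)⟫_ℝ|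
      ≤ 2 * (G / h) * (√(T - a) - √(T - b)) + G * (Real.log (T - a) - Real.log (T - b)) := by
    intro a b ha hab hb
    have hsub : Icc a b ⊆ Icc 0 T := Icc_subset_Icc ha hb.le
    have := abs_sub_le_of_singular_deriv_bound
      (p := fun s => ⟪N (x s), z (T - s)⟫_ℝ) (T := T)
      (α₀ := 0) (α₁ := G / h) (α₂ := G) (α₃ := 0) hab hb
      (fun s hs => hasDerivWithinAt_inner_flow hz' (hyg s (hsub hs)) hsub) fun s hs => by
        have hs' := hsub ⟨hs.1, hs.2.le⟩
        have hσ : 0 < T - s := by linarith [hs.2]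
        have e : ⟪-(N (N† (y s))) - N (W' s), z (T - s)⟫_ℝ
              + ⟪N (x s), (N†)† (N† (z (T - s)))⟫_ℝ
            = -⟪W' s, N† (z (T - s))⟫_ℝ - ⟪g s, N (N† (z (T - s)))⟫_ℝ := by
          rw [inner_sub_left, inner_neg_left, LinearMap.adjoint_adjoint,
            ← LinearMap.adjoint_inner_right N, ← LinearMap.adjoint_inner_right N,
            LinearMap.adjoint_inner_left, H.eq_y s hs', inner_add_left]
          ring
        rw [e, zero_add, zero_div, add_zero]
        refine (abs_sub _ _).trans (add_le_add ?_ ?_)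
        · rw [abs_neg, div_eq_mul_one_div (G / h)]
          exact abs_inner_le_of_le (H.norm_deriv_W s hs') (hz2 _ hσ).1
        · rw [div_eq_mul_one_div G]
          exact abs_inner_le_of_le (H.norm_g s hs') (hz2 _ hσ).2.1
    simpa using this
  have hd1 : G / h ^ 2 * h ^ 2 = G := div_mul_cancel₀ _ (by positivity)
  have hd2 : G / h * h = G := div_mul_cancel₀ _ h0.ne'
  have hd3 : G / h * √h = G * (1 / √h) := by
    have := Real.mul_self_sqrt h0.le
    have h' : √h ≠ 0 := by positivity
    field_simp
    nlinarith
  -- If `T < h²`, the last regime is everything; the pairing then starts from `y(0) = g(0)`, which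
  -- is small but not zero.
  rcases lt_or_ge T (h ^ 2) with hT2 | hT2
  · have h2 := hend 0 le_rfl hT
    have h4 := abs_inner_le_of_le (H.norm_g 0 (left_mem_Icc.mpr hT)) (hz1 T hT)
    have h5 : √T ≤ h := by rw [Real.sqrt_le_left h0.le]; exact hT2.le
    have h6 : G / h * √T ≤ G / h * h := by gcongr
    have h7 : G / h ^ 2 * T ≤ G / h ^ 2 * h ^ 2 := by gcongr
    simp only [H.zero, map_zero, zero_add, sub_zero] at h2
    rw [abs_le] at h2 h4 ⊢
    constructor <;> linarith
  have hT0 : 0 < T := (by positivity : 0 < h ^ 2).trans_le hT2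
  have hb2 : T - h ^ 2 ∈ Icc 0 T := ⟨by linarith, by nlinarith⟩
  have h2 := hend (T - h ^ 2) hb2.1 hb2.2
  have h3 := abs_inner_le_of_le (H.norm_g _ hb2) (hz1 (h ^ 2) (by positivity))
  rcases lt_or_ge T h with hTh | hTh
  · have h4 := hmid 0 (T - h ^ 2) le_rfl hb2.1 (by nlinarith)
    simp only [H.zero, map_zero, inner_zero_left, sub_zero, sub_sub_cancel, inner_add_left,
      Real.sqrt_sq h0.le, Real.log_pow] at h2 h4
    have h5 : G / h * √T ≤ G / h * √h := by gcongr
    have h6 : G * Real.log T ≤ G * Real.log h := by gcongr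
    push_cast at h4
    rw [abs_le] at h2 h3 h4 ⊢
    constructor <;> linarith
  · have hb1 : T - h ∈ Icc 0 T := ⟨by linarith, by linarith⟩
    have h4 := hmid (T - h) (T - h ^ 2) hb1.1 (by linarith) (by nlinarith)
    have hsub : Icc 0 (T - h) ⊆ Icc 0 T := Icc_subset_Icc_right hb1.2
    have h5 := abs_sub_le_of_singular_deriv_bound (p := fun s => ⟪N (x s) + N (W s), z (T - s)⟫_ℝ)
      (T := T) (α₀ := 0) (α₁ := 0) (α₂ := G) (α₃ := G) hb1.1 (by linarith)
      (fun s hs => hasDerivWithinAt_inner_flow hz'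
        ((hyg s (hsub hs)).add (hNW s (hsub hs))) hsub) fun s hs => by
        have hs' := hsub ⟨hs.1, hs.2.le⟩
        have hσ : 0 < T - s := by linarith [hs.2]
        have e : ⟪-(N (N† (y s))) - N (W' s) + N (W' s), z (T - s)⟫_ℝ
              + ⟪N (x s) + N (W s), (N†)† (N† (z (T - s)))⟫_ℝ
            = -⟪g s, N (N† (z (T - s)))⟫_ℝ + ⟪W s, N† (N (N† (z (T - s))))⟫_ℝ := by
          rw [sub_add_cancel, inner_neg_left, LinearMap.adjoint_adjoint,
            ← LinearMap.adjoint_inner_right N, LinearMap.adjoint_inner_left, H.eq_y s hs',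
            inner_add_left, inner_add_left, LinearMap.adjoint_inner_right]
          ring
        rw [e, zero_add, zero_div, zero_add]
        refine (abs_add_le _ _).trans (add_le_add ?_ ?_)
        · rw [abs_neg, div_eq_mul_one_div]
          exact abs_inner_le_of_le (H.norm_g s hs') (hz2 _ hσ).2.1
        · rw [div_eq_mul_one_div]
          exact abs_inner_le_of_le (H.norm_W s hs') (hz2 _ hσ).2.2
    simp only [H.zero, map_zero, zero_add, sub_zero, sub_sub_cancel, inner_add_left,
      Real.sqrt_sq h0.le, Real.log_pow] at h2 h4 h5
    -- The boundary term at `s = 0` costs `G/√T`. It is absorbed by the `-2G/√T` in the increment of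
    -- the antiderivative in `h5`.
    have h6 := abs_inner_le_of_le (H.norm_W 0 (left_mem_Icc.mpr hT)) (hz2 T hT0).1
    have h7 := abs_inner_le_of_le (H.norm_W _ hb1) (hz2 h h0).1
    rw [LinearMap.adjoint_inner_right] at h6 h7
    have h8 := mul_le_mul_of_nonneg_left (log_le_two_mul_sqrt hT0) hG
    have h9 : 0 ≤ G * (1 / √T) := by positivity
    push_cast at h4
    rw [abs_le] at h2 h3 h4 h5 h6 h7 ⊢
    constructor <;> linarith

end IsErrorSystem

end Semigroup

/-! ### Legendre polynomials -/

theorem intervalIntegrable_eval (p : ℝ[X]) (a b : ℝ) :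
    IntervalIntegrable (fun x => p.eval x) volume a b :=
  p.continuous.intervalIntegrable _ _

theorem integral_eval_mul_derivative (p q : ℝ[X]) (a b : ℝ) :
    ∫ x in a..b, p.eval x * (derivative q).eval x
      = p.eval b * q.eval b - p.eval a * q.eval a
        - ∫ x in a..b, (derivative p).eval x * q.eval x :=
  intervalIntegral.integral_mul_deriv_eq_deriv_mul (fun x _ => p.hasDerivAt x)
    (fun x _ => q.hasDerivAt x) (intervalIntegrable_eval _ _ _) (intervalIntegrable_eval _ _ _)

theorem eval_iterate_derivative_sq_sub_one {m i : ℕ} (hi : i < m) {x : ℝ} (hx : x ^ 2 = 1) :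
    (derivative^[i] ((X ^ 2 - 1 : ℝ[X]) ^ m)).eval x = 0 := by
  obtain ⟨r, hr⟩ := pow_sub_dvd_iterate_derivative_of_pow_dvd i (dvd_refl ((X ^ 2 - 1 : ℝ[X]) ^ m))
  rw [hr, eval_mul, eval_pow]
  simp [hx, Nat.sub_ne_zero_of_lt hi]

/-- Rodrigues' formula is integrated by parts `m` times: the lower derivatives of `(x² - 1)^m`
vanish at `±1`, and the `m`-th derivative of `p` is zero. -/
theorem integral_legendre_mul_eq_zero {m : ℕ} {p : ℝ[X]} (hp : p.degree < m) :
    ∫ x in (-1 : ℝ)..1, (legendre m).eval x * p.eval x = 0 := by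
  have key : ∀ i ≤ m, ∫ x in (-1 : ℝ)..1,
      (derivative^[m] ((X ^ 2 - 1 : ℝ[X]) ^ m)).eval x * p.eval x
        = (-1) ^ i * ∫ x in (-1 : ℝ)..1,
          (derivative^[m - i] ((X ^ 2 - 1 : ℝ[X]) ^ m)).eval x * (derivative^[i] p).eval x := by
    intro i
    induction i with
    | zero => simp
    | succ i ih =>
      intro hi
      rw [ih (by omega), Function.iterate_succ_apply', integral_eval_mul_derivative,
        eval_iterate_derivative_sq_sub_one (by omega) (by norm_num),
        eval_iterate_derivative_sq_sub_one (by omega) (by norm_num),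
        ← Function.iterate_succ_apply' derivative, show (m - (i + 1)).succ = m - i by omega]
      ring
  have h0 : derivative^[m] p = 0 := by
    by_cases hp0 : p = 0
    · simp [hp0]
    · exact iterate_derivative_eq_zero ((natDegree_lt_iff_degree_lt hp0).mpr hp)
  have := key m le_rfl
  simp only [h0, eval_zero, mul_zero, intervalIntegral.integral_zero] at this
  simp only [legendre, eval_mul, eval_C, mul_assoc, intervalIntegral.integral_const_mul, this,
    mul_zero]

/-- Writing `(x² - 1)^m = (x - 1)^m (x + 1)^m`, the `m`-th derivative at `1` is `m! (x + 1)^m`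
there. -/
theorem eval_one_legendre (m : ℕ) : (legendre m).eval 1 = 1 := by
  have h := aeval_iterate_derivative_self ((X ^ 2 - 1 : ℝ[X]) ^ m) m (1 : ℝ)
    (p' := (X + 1) ^ m) (by rw [Algebra.algebraMap_self, Polynomial.map_id, ← mul_pow]; congr 1; simp; ring)
  simp only [coe_aeval_eq_eval] at h
  rw [legendre, eval_mul, eval_C, h]
  have : (m.factorial : ℝ) ≠ 0 := by positivity
  simp only [eval_pow, eval_add, eval_X, eval_one, nsmul_eq_mul]
  norm_num
  field_simp

theorem eval_neg_one_legendre (m : ℕ) : (legendre m).eval (-1) = (-1) ^ m := by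
  have h := aeval_iterate_derivative_self ((X ^ 2 - 1 : ℝ[X]) ^ m) m (-1 : ℝ)
    (p' := (X - 1) ^ m) (by rw [Algebra.algebraMap_self, Polynomial.map_id, ← mul_pow]; congr 1; simp; ring)
  simp only [coe_aeval_eq_eval] at h
  rw [legendre, eval_mul, eval_C, h]
  have : (m.factorial : ℝ) ≠ 0 := by positivity
  simp only [eval_pow, eval_sub, eval_X, eval_one, nsmul_eq_mul]
  rw [show (-1 - 1 : ℝ) = -1 * 2 by norm_num, mul_pow]
  field_simp

theorem natDegree_legendre_le (m : ℕ) : (legendre m).natDegree ≤ m := by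
  refine (natDegree_C_mul_le _ _).trans ((natDegree_iterate_derivative _ _).trans ?_)
  have : ((X ^ 2 - 1 : ℝ[X]) ^ m).natDegree ≤ m * 2 :=
    natDegree_pow_le_of_le m (by compute_degree)
  omega

theorem coeff_legendre_ne_zero (m : ℕ) : (legendre m).coeff m ≠ 0 := by
  rw [legendre, coeff_C_mul, coeff_iterate_derivative]
  have h1 : ((X ^ 2 - 1 : ℝ[X]) ^ m).coeff (m + m) = 1 := by
    have := coeff_pow_of_natDegree_le (p := (X ^ 2 - 1 : ℝ[X])) (n := 2) (m := m)
      (by compute_degree)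
    rw [show m + m = m * 2 by ring, this]
    simp [coeff_one, coeff_X_pow]
  rw [h1]
  have : (m + m).descFactorial m ≠ 0 := by simp [Nat.descFactorial_eq_zero_iff_lt]
  have : ((m + m).descFactorial m : ℝ) ≠ 0 := by exact_mod_cast this
  simp only [nsmul_eq_mul, mul_one]
  positivity

theorem natDegree_legendre (m : ℕ) : (legendre m).natDegree = m :=
  natDegree_eq_of_le_of_coeff_ne_zero (natDegree_legendre_le m) (coeff_legendre_ne_zero m)

/-- With `I` the integral, `x L' - m L` has degree below `m`, so `∫ x L L' = m I` by orthogonality.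
Integrating the same integral by parts gives `m I = 2 - (1 + m) I`. -/
theorem integral_legendre_sq (m : ℕ) :
    ∫ x in (-1 : ℝ)..1, (legendre m).eval x * (legendre m).eval x = 2 / (2 * m + 1) := by
  set L := legendre m
  set I := ∫ x in (-1 : ℝ)..1, L.eval x * L.eval x with hI
  have h1 : ∫ x in (-1 : ℝ)..1, L.eval x * (X * derivative L).eval x = m * I := by
    have hlow : (X * derivative L - C (m : ℝ) * L).degree < (m : WithBot ℕ) := by
      rw [degree_lt_iff_coeff_zero]
      intro i hi
      rcases hi.eq_or_lt with rfl | hi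
      · cases m with
        | zero => simp
        | succ n =>
          rw [coeff_sub, coeff_X_mul, coeff_derivative, coeff_C_mul]
          push_cast
          ring
      · rw [coeff_sub, coeff_C_mul, coeff_eq_zero_of_natDegree_lt (n := i) (p := L)
          (by rw [natDegree_legendre]; exact hi)]
        cases i with
        | zero => omega
        | succ n =>
          rw [coeff_X_mul, coeff_derivative, coeff_eq_zero_of_natDegree_lt (n := n + 1) (p := L)
            (by rw [natDegree_legendre]; exact hi)]
          simp
    have h2 := integral_legendre_mul_eq_zero hlow
    simp only [eval_sub, mul_sub, eval_mul (p := C _), eval_C] at h2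
    rw [intervalIntegral.integral_sub (Continuous.intervalIntegrable (by fun_prop) _ _)
      (Continuous.intervalIntegrable (by fun_prop) _ _)] at h2
    have h3 : ∫ x in (-1 : ℝ)..1, (legendre m).eval x * (m * L.eval x) = m * I := by
      rw [hI, ← intervalIntegral.integral_const_mul]
      congr 1; ext x; ring
    linarith
  have h2 := integral_eval_mul_derivative (X * L) L (-1) 1
  have h3 : ∫ x in (-1 : ℝ)..1, (derivative (X * L)).eval x * L.eval x = I + m * I := by
    rw [← h1, hI, ← intervalIntegral.integral_add (Continuous.intervalIntegrable (by fun_prop) _ _)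
      (Continuous.intervalIntegrable (by fun_prop) _ _)]
    congr 1; ext x; simp; ring
  have h4 : ∫ x in (-1 : ℝ)..1, (X * L).eval x * (derivative L).eval x = m * I := by
    rw [← h1]; congr 1; ext x; simp; ring
  have h5 : ((-1 : ℝ) ^ m) * (-1) ^ m = 1 := by rw [← mul_pow]; norm_num
  rw [h3, h4, eval_mul, eval_mul, eval_X, eval_X, eval_one_legendre, eval_neg_one_legendre] at h2
  rw [eq_div_iff (by positivity)]
  linarith

theorem exists_legendre_bound (k : ℕ) : ∃ C : ℝ, 1 ≤ C ∧ ∀ m ≤ k, ∀ x ∈ Icc (-1 : ℝ) 1,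
    |(legendre m).eval x| ≤ C ∧ |(derivative (legendre m)).eval x| ≤ C := by
  have h1 : ∀ p : ℝ[X], ∃ C, ∀ x ∈ Icc (-1 : ℝ) 1, |p.eval x| ≤ C := fun p => by
    obtain ⟨C, hC⟩ := isCompact_Icc.exists_bound_of_continuousOn (s := Icc (-1 : ℝ) 1)
      p.continuous.continuousOn
    exact ⟨C, fun x hx => hC x hx⟩
  choose B hB using h1
  refine ⟨1 + ∑ m ∈ Finset.range (k + 1), (|B (legendre m)| + |B (derivative (legendre m))|),
    le_add_of_nonneg_right (by positivity), fun m hm x hx => ?_⟩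
  have h2 := Finset.single_le_sum (s := Finset.range (k + 1))
    (f := fun m => |B (legendre m)| + |B (derivative (legendre m))|)
    (fun i _ => by positivity) (Finset.mem_range.mpr (Nat.lt_succ_of_le hm))
  have h3 := hB (legendre m) x hx
  have h4 := hB (derivative (legendre m)) x hx
  have h5 := le_abs_self (B (legendre m))
  have h6 := le_abs_self (B (derivative (legendre m)))
  have h7 := abs_nonneg (B (legendre m))
  have h8 := abs_nonneg (B (derivative (legendre m)))
  constructor <;> linarith

/-! ### Legendre polynomials on a cell -/

/-- The Legendre polynomial of degree `m` transplanted to `[a, b]`, as a polynomial. -/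
def cellPoly (a b : ℝ) (m : ℕ) : ℝ[X] :=
  (legendre m).comp (C (2 / (b - a)) * (X - C ((a + b) / 2)))

theorem eval_cellPoly (a b : ℝ) (m : ℕ) (x : ℝ) :
    (cellPoly a b m).eval x = cellLegendre a b m x := by
  rw [cellPoly, cellLegendre, eval_comp]
  congr 1
  simp only [eval_mul, eval_C, eval_sub, eval_X]
  rw [div_div_eq_mul_div]
  ring

section Cell

variable {a b : ℝ}

theorem eval_cellPoly_right (hab : a < b) (m : ℕ) : (cellPoly a b m).eval b = 1 := by
  rw [eval_cellPoly, cellLegendre]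
  have : (b - (a + b) / 2) / ((b - a) / 2) = 1 := by
    have : b - a ≠ 0 := by linarith
    field_simp; ring
  rw [this, eval_one_legendre]

theorem eval_cellPoly_left (hab : a < b) (m : ℕ) : (cellPoly a b m).eval a = (-1) ^ m := by
  rw [eval_cellPoly, cellLegendre]
  have : (a - (a + b) / 2) / ((b - a) / 2) = -1 := by
    have : b - a ≠ 0 := by linarith
    field_simp; ring
  rw [this, eval_neg_one_legendre]

theorem natDegree_cellPoly (hab : a < b) (m : ℕ) : (cellPoly a b m).natDegree = m := by
  have : 2 / (b - a) ≠ 0 := div_ne_zero two_ne_zero (by linarith)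
  rw [cellPoly, natDegree_comp, natDegree_legendre, natDegree_C_mul this, natDegree_X_sub_C, mul_one]

theorem integral_comp_cell (hab : a < b) (q : ℝ[X]) :
    ∫ x in a..b, (q.comp (C (2 / (b - a)) * (X - C ((a + b) / 2)))).eval x
      = (b - a) / 2 * ∫ x in (-1 : ℝ)..1, q.eval x := by
  have hne : b - a ≠ 0 := by linarith
  have h := intervalIntegral.integral_comp_mul_sub (a := a) (b := b) (fun x => q.eval x)
    (c := 2 / (b - a)) (div_ne_zero two_ne_zero hne) (2 / (b - a) * ((a + b) / 2))
  have e1 : 2 / (b - a) * a - 2 / (b - a) * ((a + b) / 2) = -1 := by field_simp; ring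
  have e2 : 2 / (b - a) * b - 2 / (b - a) * ((a + b) / 2) = 1 := by field_simp; ring
  rw [e1, e2, inv_div, smul_eq_mul] at h
  rw [← h]
  congr 1; ext x
  simp [eval_comp, mul_sub]

theorem comp_cell_comp_cell (hab : a < b) (p : ℝ[X]) :
    (p.comp (C ((b - a) / 2) * X + C ((a + b) / 2))).comp
      (C (2 / (b - a)) * (X - C ((a + b) / 2))) = p := by
  have hne : b - a ≠ 0 := by linarith
  rw [comp_assoc]
  have : (C ((b - a) / 2) * X + C ((a + b) / 2) : ℝ[X]).comp
      (C (2 / (b - a)) * (X - C ((a + b) / 2))) = X := by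
    simp only [add_comp, mul_comp, C_comp, X_comp]
    rw [← mul_assoc, ← C_mul, show (b - a) / 2 * (2 / (b - a)) = 1 by field_simp]
    simp
  rw [this, comp_X]

theorem integral_cellPoly_mul_eq_zero (hab : a < b) {m : ℕ} {p : ℝ[X]} (hp : p.degree < m) :
    ∫ x in a..b, (cellPoly a b m).eval x * p.eval x = 0 := by
  set p' := p.comp (C ((b - a) / 2) * X + C ((a + b) / 2)) with hp'
  have hdeg : p'.degree < m := by
    by_cases h0 : p' = 0
    · rw [h0, degree_zero]; exact WithBot.bot_lt_coe m
    have hp0 : p ≠ 0 := fun h => h0 (by rw [hp', h, zero_comp])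
    rw [← natDegree_lt_iff_degree_lt h0]
    rw [← natDegree_lt_iff_degree_lt hp0] at hp
    refine lt_of_le_of_lt natDegree_comp_le (lt_of_le_of_lt ?_ hp)
    calc _ ≤ p.natDegree * 1 := Nat.mul_le_mul_left _ (by compute_degree)
      _ = _ := mul_one _
  have h := integral_comp_cell hab (legendre m * p')
  rw [mul_comp, comp_cell_comp_cell hab] at h
  simp only [eval_mul] at h
  rw [integral_legendre_mul_eq_zero hdeg, mul_zero] at h
  exact h

theorem integral_cellPoly_sq (hab : a < b) (m : ℕ) :
    ∫ x in a..b, (cellPoly a b m).eval x * (cellPoly a b m).eval x = (b - a) / (2 * m + 1) := by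
  have h := integral_comp_cell hab (legendre m * legendre m)
  simp only [mul_comp, eval_mul] at h
  rw [cellPoly, h, integral_legendre_sq]
  field_simp

theorem integral_cellPoly_mul_cellPoly (hab : a < b) (m n : ℕ) :
    ∫ x in a..b, (cellPoly a b m).eval x * (cellPoly a b n).eval x
      = if m = n then (b - a) / (2 * m + 1) else 0 := by
  have hdeg : ∀ m n, m < n → (cellPoly a b m).degree < n := fun m n h => by
    refine lt_of_le_of_lt degree_le_natDegree ?_
    rw [natDegree_cellPoly hab]
    exact_mod_cast h
  split_ifs with h
  · rw [h, integral_cellPoly_sq hab]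
  · rcases lt_or_gt_of_ne h with h | h
    · rw [← integral_cellPoly_mul_eq_zero hab (hdeg _ _ h)]
      congr 1; ext x; ring
    · exact integral_cellPoly_mul_eq_zero hab (hdeg _ _ h)

/-- The coefficient of the Legendre polynomial of degree `m` in the expansion of `v`. -/
def legendreCoeff (a b : ℝ) (v : ℝ → ℝ) (m : ℕ) : ℝ :=
  (2 * m + 1) / (b - a) * ∫ x in a..b, v x * (cellPoly a b m).eval x

theorem legendreCoeff_cellPoly (hab : a < b) (m n : ℕ) :
    legendreCoeff a b (fun x => (cellPoly a b n).eval x) m = if m = n then 1 else 0 := by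
  rw [legendreCoeff, integral_cellPoly_mul_cellPoly hab]
  have hne : b - a ≠ 0 := by linarith
  by_cases h : m = n
  · subst h
    simp only [if_true]
    field_simp
  · simp [h, Ne.symm h]

/-- Both sides are linear in `p` and the cell Legendre polynomials of degree at most `k` span, so it
suffices to take `p` among them, where orthogonality applies. -/
theorem eq_sum_legendreCoeff (hab : a < b) {k : ℕ} {p : ℝ[X]} (hp : p.natDegree ≤ k) :
    p = ∑ m ∈ Finset.range (k + 1), C (legendreCoeff a b (fun x => p.eval x) m) * cellPoly a b m := by
  let S : Polynomial.Sequence ℝ := ⟨cellPoly a b, fun i => by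
    rw [degree_eq_natDegree (fun h => by
      have := eval_cellPoly_right hab i
      rw [h, eval_zero] at this
      exact zero_ne_one this), natDegree_cellPoly hab]⟩
  have hmem : p ∈ Submodule.span ℝ (S '' Iio (k + 1)) := by
    rw [S.span_degreeLT fun i _ => isUnit_iff_ne_zero.mpr (leadingCoeff_ne_zero.mpr (S.ne_zero i)),
      mem_degreeLT]
    exact lt_of_le_of_lt (natDegree_le_iff_degree_le.mp hp) (by exact_mod_cast Nat.lt_succ_self k)
  clear hp
  induction hmem using Submodule.span_induction with
  | mem p hp =>
    obtain ⟨i, hi, rfl⟩ := hp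
    change cellPoly a b i = ∑ m ∈ Finset.range (k + 1),
      C (legendreCoeff a b (fun x => (cellPoly a b i).eval x) m) * cellPoly a b m
    simp only [legendreCoeff_cellPoly hab]
    rw [Finset.sum_eq_single i]
    · simp
    · intro j _ hj; simp [hj]
    · intro h; exact absurd (Finset.mem_range.mpr hi) h
  | zero => simp [legendreCoeff]
  | add p q _ _ hp hq =>
    have : ∀ m, legendreCoeff a b (fun x => (p + q).eval x) m
        = legendreCoeff a b (fun x => p.eval x) m + legendreCoeff a b (fun x => q.eval x) m :=
      fun m => by
        simp only [legendreCoeff, eval_add, add_mul]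
        rw [intervalIntegral.integral_add (Continuous.intervalIntegrable (by fun_prop) _ _)
          (Continuous.intervalIntegrable (by fun_prop) _ _), mul_add]
    simp_rw [this, C_add, add_mul, Finset.sum_add_distrib]
    rw [← hp, ← hq]
  | smul c p _ hp =>
    have : ∀ m, legendreCoeff a b (fun x => (c • p).eval x) m
        = c * legendreCoeff a b (fun x => p.eval x) m := fun m => by
      simp only [legendreCoeff, eval_smul, smul_eq_mul, mul_assoc,
        intervalIntegral.integral_const_mul]
      ring
    simp_rw [this, C_mul, mul_assoc]
    rw [← Finset.mul_sum, ← hp, smul_eq_C_mul]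

end Cell

/-! ### Gauss-Radau projections on a cell -/

section RadauCell

variable {a b e : ℝ} {k : ℕ}

theorem intervalIntegrable_mul_eval (hab : a < b) {f : ℝ → ℝ} (hf : ContinuousOn f (Icc a b))
    (p : ℝ[X]) : IntervalIntegrable (fun x => f x * p.eval x) volume a b := by
  refine ContinuousOn.intervalIntegrable ?_
  rw [uIcc_of_le hab.le]
  fun_prop

theorem integral_mul_eval_congr (hab : a < b) {f g : ℝ → ℝ} (hf : ContinuousOn f (Icc a b))
    (hg : ContinuousOn g (Icc a b))
    (h : ∀ m ≤ k, ∫ x in a..b, f x * (cellPoly a b m).eval x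
      = ∫ x in a..b, g x * (cellPoly a b m).eval x) {w : ℝ[X]} (hw : w.natDegree ≤ k) :
    ∫ x in a..b, f x * w.eval x = ∫ x in a..b, g x * w.eval x := by
  have key : ∀ f : ℝ → ℝ, ContinuousOn f (Icc a b) → ∫ x in a..b, f x * w.eval x
      = ∑ m ∈ Finset.range (k + 1), legendreCoeff a b (fun x => w.eval x) m
        * ∫ x in a..b, f x * (cellPoly a b m).eval x := by
    intro f hf
    simp only [← intervalIntegral.integral_const_mul]
    rw [← intervalIntegral.integral_finsetSum fun m _ =>
      (intervalIntegrable_mul_eval hab hf _).const_mul _]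
    congr 1
    ext x
    conv_lhs => rw [eq_sum_legendreCoeff hab hw, eval_finsetSum, Finset.mul_sum]
    refine Finset.sum_congr rfl fun m _ => ?_
    rw [eval_mul, eval_C]
    ring
  rw [key f hf, key g hg]
  refine Finset.sum_congr rfl fun m hm => ?_
  rw [h m (Nat.lt_succ_iff.mp (Finset.mem_range.mp hm))]

theorem eval_cellPoly_end_sq (hab : a < b) (he : e = a ∨ e = b) (m : ℕ) :
    (cellPoly a b m).eval e * (cellPoly a b m).eval e = 1 := by
  rcases he with rfl | rfl
  · rw [eval_cellPoly_left hab, ← mul_pow]; norm_num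
  · rw [eval_cellPoly_right hab, one_mul]

theorem end_mem_Icc (hab : a < b) (he : e = a ∨ e = b) : e ∈ Icc a b := by
  rcases he with rfl | rfl
  exacts [left_mem_Icc.mpr hab.le, right_mem_Icc.mpr hab.le]

/-- The coefficient of `L_k` in the Legendre expansion of `v - P v`, where `P` is the Gauss-Radau
projection which interpolates at `e`. -/
def radauCoeff (k : ℕ) (a b e : ℝ) (v : ℝ → ℝ) : ℝ :=
  (cellPoly a b k).eval e *
    (∑ m ∈ Finset.range (k + 1), legendreCoeff a b v m * (cellPoly a b m).eval e - v e)

theorem coeffMinus_eq (hab : a < b) {v : ℝ → ℝ} (hv : ContinuousOn v (Icc a b)) :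
    coeffMinus k a b v = radauCoeff k a b b v := by
  have : (fun x => v x * ∑ m ∈ Finset.range (k + 1), (2 * (m : ℝ) + 1) * cellLegendre a b m x)
      = fun x => ∑ m ∈ Finset.range (k + 1), (2 * (m : ℝ) + 1) *
        (v x * (cellPoly a b m).eval x) := by
    ext x
    rw [Finset.mul_sum]
    refine Finset.sum_congr rfl fun m _ => ?_
    rw [eval_cellPoly]; ring
  rw [coeffMinus, this, intervalIntegral.integral_finsetSum fun m _ =>
      (intervalIntegrable_mul_eval hab hv _).const_mul _]
  simp only [radauCoeff, eval_cellPoly_right hab, legendreCoeff, one_mul, mul_one,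
    intervalIntegral.integral_const_mul, Finset.mul_sum]
  rw [neg_add_eq_sub]
  congr 1
  exact Finset.sum_congr rfl fun m _ => by ring

theorem coeffPlus_eq (hab : a < b) {v : ℝ → ℝ} (hv : ContinuousOn v (Icc a b)) :
    coeffPlus k a b v = radauCoeff k a b a v := by
  have : (fun x => v x * ∑ m ∈ Finset.range (k + 1),
        (-1) ^ (k + m) * (2 * (m : ℝ) + 1) * cellLegendre a b m x)
      = fun x => ∑ m ∈ Finset.range (k + 1), (-1) ^ (k + m) * (2 * (m : ℝ) + 1) *
        (v x * (cellPoly a b m).eval x) := by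
    ext x
    rw [Finset.mul_sum]
    refine Finset.sum_congr rfl fun m _ => ?_
    rw [eval_cellPoly]; ring
  rw [coeffPlus, this, intervalIntegral.integral_finsetSum fun m _ =>
      (intervalIntegrable_mul_eval hab hv _).const_mul _]
  simp only [radauCoeff, eval_cellPoly_left hab, legendreCoeff,
    intervalIntegral.integral_const_mul, Finset.mul_sum, mul_sub]
  rw [pow_succ, mul_neg_one, neg_mul, neg_add_eq_sub]
  congr 1
  exact Finset.sum_congr rfl fun m _ => by rw [pow_add]; ring

/-- The Gauss-Radau projection in terms of Legendre polynomials. -/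
def radauFormula (k : ℕ) (a b e : ℝ) (v : ℝ → ℝ) : ℝ[X] :=
  ∑ m ∈ Finset.range (k + 1), C (legendreCoeff a b v m) * cellPoly a b m
    - C (radauCoeff k a b e v) * cellPoly a b k

theorem natDegree_radauFormula_le (hab : a < b) (v : ℝ → ℝ) :
    (radauFormula k a b e v).natDegree ≤ k := by
  refine (natDegree_sub_le _ _).trans (max_le ?_ ?_)
  · refine natDegree_sum_le_of_forall_le _ _ fun m hm => (natDegree_C_mul_le _ _).trans ?_
    rw [natDegree_cellPoly hab]
    exact Nat.lt_succ_iff.mp (Finset.mem_range.mp hm)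
  · exact (natDegree_C_mul_le _ _).trans (natDegree_cellPoly hab k).le

theorem integral_radauFormula_mul_cellPoly (hab : a < b) (v : ℝ → ℝ) {n : ℕ} (hn : n ≤ k) :
    ∫ x in a..b, (radauFormula k a b e v).eval x * (cellPoly a b n).eval x
      = (∫ x in a..b, v x * (cellPoly a b n).eval x)
        - if n = k then radauCoeff k a b e v * ((b - a) / (2 * k + 1)) else 0 := by
  have hne : b - a ≠ 0 := by linarith
  have e1 : ∀ x, (radauFormula k a b e v).eval x * (cellPoly a b n).eval x
      = ∑ m ∈ Finset.range (k + 1), legendreCoeff a b v m *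
          ((cellPoly a b m).eval x * (cellPoly a b n).eval x)
        - radauCoeff k a b e v * ((cellPoly a b k).eval x * (cellPoly a b n).eval x) := fun x => by
    simp only [radauFormula, eval_sub, eval_finsetSum, eval_mul, eval_C, sub_mul, Finset.sum_mul,
      mul_assoc]
  simp only [e1]
  rw [intervalIntegral.integral_sub (Continuous.intervalIntegrable (by fun_prop) _ _)
      (Continuous.intervalIntegrable (by fun_prop) _ _),
    intervalIntegral.integral_finsetSum fun m _ =>
      (Continuous.intervalIntegrable (by fun_prop) _ _)]
  simp only [intervalIntegral.integral_const_mul, integral_cellPoly_mul_cellPoly hab]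
  congr 1
  · rw [Finset.sum_eq_single n]
    · rw [if_pos rfl, legendreCoeff]
      field_simp
    · intro m _ hm; rw [if_neg hm, mul_zero]
    · intro h; exact absurd (Finset.mem_range.mpr (Nat.lt_succ_of_le hn)) h
  · simp only [eq_comm (a := k)]
    split_ifs <;> simp

theorem isRadauProj_radauFormula (hab : a < b) (he : e = a ∨ e = b) {v : ℝ → ℝ}
    (hv : ContinuousOn v (Icc a b)) : IsRadauProj k a b e v (radauFormula k a b e v) := by
  refine ⟨natDegree_radauFormula_le hab v, fun w hw => ?_, ?_⟩
  · rcases k with _ | k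
    · have : w = 0 := degree_eq_bot.mp (Nat.WithBot.lt_zero_iff.mp (by simpa using hw))
      simp [this]
    refine integral_mul_eval_congr (k := k) hab (radauFormula (k + 1) a b e v).continuousOn hv
      (fun n hn => ?_) ?_
    · rw [integral_radauFormula_mul_cellPoly hab v (hn.trans k.le_succ), if_neg (by omega), sub_zero]
    · by_cases h0 : w = 0
      · simp [h0]
      · exact Nat.lt_succ_iff.mp ((natDegree_lt_iff_degree_lt h0).mpr hw)
  -- As `L_k(e)² = 1`, subtracting `radauCoeff` times `L_k` corrects the value at `e` to exactly `v
  -- e`.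
  · have h := eval_cellPoly_end_sq hab he k
    simp only [radauFormula, eval_sub, eval_finsetSum, eval_mul, eval_C, radauCoeff]
    linear_combination (-(∑ m ∈ Finset.range (k + 1),
      legendreCoeff a b v m * (cellPoly a b m).eval e - v e)) * h

theorem radauProj_eq (hab : a < b) (he : e = a ∨ e = b) {v : ℝ → ℝ}
    (hv : ContinuousOn v (Icc a b)) : radauProj k a b e v = radauFormula k a b e v :=
  (radauProj_spec hab he hv).unique hab he (isRadauProj_radauFormula hab he hv)

theorem radauCoeff_eval (hab : a < b) {p : ℝ[X]} (hp : p.natDegree ≤ k) :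
    radauCoeff k a b e (fun x => p.eval x) = 0 := by
  have h := congrArg (eval e) (eq_sum_legendreCoeff hab hp)
  simp only [eval_finsetSum, eval_mul, eval_C] at h
  rw [radauCoeff, ← h, sub_self, mul_zero]

theorem legendreCoeff_sub (hab : a < b) {v w : ℝ → ℝ} (hv : ContinuousOn v (Icc a b))
    (hw : ContinuousOn w (Icc a b)) (m : ℕ) :
    legendreCoeff a b (fun x => v x - w x) m = legendreCoeff a b v m - legendreCoeff a b w m := by
  simp only [legendreCoeff, sub_mul]
  rw [intervalIntegral.integral_sub (intervalIntegrable_mul_eval hab hv _)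
    (intervalIntegrable_mul_eval hab hw _), mul_sub]

theorem radauCoeff_sub (hab : a < b) {v w : ℝ → ℝ} (hv : ContinuousOn v (Icc a b))
    (hw : ContinuousOn w (Icc a b)) :
    radauCoeff k a b e (fun x => v x - w x) = radauCoeff k a b e v - radauCoeff k a b e w := by
  simp only [radauCoeff, legendreCoeff_sub hab hv hw, sub_mul, Finset.sum_sub_distrib]
  ring

theorem radauFormula_sub (hab : a < b) {v w : ℝ → ℝ} (hv : ContinuousOn v (Icc a b))
    (hw : ContinuousOn w (Icc a b)) :
    radauFormula k a b e (fun x => v x - w x) = radauFormula k a b e v - radauFormula k a b e w := by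
  simp only [radauFormula, legendreCoeff_sub hab hv hw, radauCoeff_sub hab hv hw, sub_mul,
    Finset.sum_sub_distrib, C_sub]
  ring

theorem abs_eval_cellPoly_le {C : ℝ} (hab : a < b)
    (hC : ∀ m ≤ k, ∀ x ∈ Icc (-1 : ℝ) 1,
      |(legendre m).eval x| ≤ C ∧ |(derivative (legendre m)).eval x| ≤ C)
    {m : ℕ} (hm : m ≤ k) {x : ℝ} (hx : x ∈ Icc a b) :
    |(cellPoly a b m).eval x| ≤ C ∧ |(derivative (cellPoly a b m)).eval x| ≤ 2 * C / (b - a) := by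
  have hpos : 0 < b - a := by linarith
  have hx' : 2 / (b - a) * (x - (a + b) / 2) ∈ Icc (-1 : ℝ) 1 := by
    rw [div_mul_eq_mul_div]
    constructor
    · rw [le_div_iff₀ hpos]; linarith [hx.1]
    · rw [div_le_iff₀ hpos]; linarith [hx.2]
  obtain ⟨h1, h2⟩ := hC m hm _ hx'
  refine ⟨by simpa [cellPoly, eval_comp] using h1, ?_⟩
  have : (derivative (cellPoly a b m)).eval x
      = 2 / (b - a) * (derivative (legendre m)).eval (2 / (b - a) * (x - (a + b) / 2)) := by
    rw [cellPoly, derivative_comp]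
    simp [eval_comp]
  rw [this, abs_mul, abs_of_pos (by positivity : 0 < 2 / (b - a)), mul_comm 2 C, mul_div_assoc,
    mul_comm C]
  gcongr

theorem abs_legendreCoeff_le {C S : ℝ} (hab : a < b) (hC1 : 1 ≤ C)
    (hC : ∀ m ≤ k, ∀ x ∈ Icc (-1 : ℝ) 1,
      |(legendre m).eval x| ≤ C ∧ |(derivative (legendre m)).eval x| ≤ C)
    {m : ℕ} (hm : m ≤ k) {v : ℝ → ℝ} (hS : ∀ x ∈ Icc a b, |v x| ≤ S) :
    |legendreCoeff a b v m| ≤ (2 * k + 1) * C * S := by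
  have hpos : 0 < b - a := by linarith
  have hS0 : 0 ≤ S := (abs_nonneg _).trans (hS a (left_mem_Icc.mpr hab.le))
  have h1 : ‖∫ x in a..b, v x * (cellPoly a b m).eval x‖ ≤ S * C * |b - a| := by
    refine intervalIntegral.norm_integral_le_of_norm_le_const fun x hx => ?_
    rw [uIoc_of_le hab.le] at hx
    rw [Real.norm_eq_abs, abs_mul]
    exact mul_le_mul (hS x ⟨hx.1.le, hx.2⟩) (abs_eval_cellPoly_le hab hC hm ⟨hx.1.le, hx.2⟩).1
      (abs_nonneg _) hS0
  rw [Real.norm_eq_abs, abs_of_pos hpos] at h1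
  have hmk : (m : ℝ) ≤ k := by exact_mod_cast hm
  rw [legendreCoeff, abs_mul, abs_of_pos (by positivity)]
  calc _ ≤ (2 * k + 1) / (b - a) * (S * C * (b - a)) := by gcongr
    _ = _ := by field_simp

/-- Stability of the Gauss-Radau projections. -/
theorem exists_radau_bound (k : ℕ) : ∃ C : ℝ, 1 ≤ C ∧ ∀ a b e : ℝ, a < b → (e = a ∨ e = b) →
    ∀ (v : ℝ → ℝ) (S : ℝ), (∀ x ∈ Icc a b, |v x| ≤ S) →
      |radauCoeff k a b e v| ≤ C * S ∧
      ∀ x ∈ Icc a b, |(radauFormula k a b e v).eval x| ≤ C * S ∧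
        |(derivative (radauFormula k a b e v)).eval x| ≤ C * S / (b - a) := by
  obtain ⟨C, hC1, hC⟩ := exists_legendre_bound k
  -- `D` bounds the Radau coefficient and `D'` the projection; the factor `2` used below comes from
  -- the affine map when the projection is differentiated.
  set D := C * ((k + 1) * ((2 * k + 1) * C * C) + 1) with hD
  set D' := (k + 1) * ((2 * k + 1) * C * C) + D * C with hD'
  have hD0 : 1 ≤ D := by
    have : 0 ≤ ((k : ℝ) + 1) * ((2 * k + 1) * C * C) := by positivity
    nlinarith
  have hDD : D ≤ D' := by
    have : 0 ≤ ((k : ℝ) + 1) * ((2 * k + 1) * C * C) := by positivity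
    nlinarith
  refine ⟨2 * D', by linarith, fun a b e hab he v S hS => ?_⟩
  have hpos : 0 < b - a := by linarith
  have hS0 : 0 ≤ S := (abs_nonneg _).trans (hS a (left_mem_Icc.mpr hab.le))
  have hsum : ∀ (y : ℕ → ℝ) (Y : ℝ), (∀ m ≤ k, |y m| ≤ Y) →
      |∑ m ∈ Finset.range (k + 1), legendreCoeff a b v m * y m|
        ≤ (k + 1) * ((2 * k + 1) * C * S * Y) := fun y Y hY => by
    refine (Finset.abs_sum_le_sum_abs _ _).trans ?_
    calc _ ≤ ∑ m ∈ Finset.range (k + 1), ((2 * k + 1) * C * S * Y) := by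
          refine Finset.sum_le_sum fun m hm => ?_
          have hm' := Nat.lt_succ_iff.mp (Finset.mem_range.mp hm)
          rw [abs_mul]
          exact mul_le_mul (abs_legendreCoeff_le hab hC1 hC hm' hS) (hY m hm') (abs_nonneg _)
            (by positivity)
      _ = _ := by simp
  have hee := end_mem_Icc hab he
  have hκ : |radauCoeff k a b e v| ≤ D * S := by
    rw [radauCoeff, abs_mul]
    have h1 := hsum (fun m => (cellPoly a b m).eval e) C
      fun m hm => (abs_eval_cellPoly_le hab hC hm hee).1
    calc _ ≤ C * ((k + 1) * ((2 * k + 1) * C * S * C) + S) := by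
          refine mul_le_mul (abs_eval_cellPoly_le hab hC le_rfl hee).1
            ((abs_sub _ _).trans (add_le_add h1 (hS e hee))) (abs_nonneg _) (by linarith)
      _ = _ := by rw [hD]; ring
  refine ⟨hκ.trans (by gcongr; linarith), fun x hx => ⟨?_, ?_⟩⟩
  · have h1 := hsum (fun m => (cellPoly a b m).eval x) C
      fun m hm => (abs_eval_cellPoly_le hab hC hm hx).1
    simp only [radauFormula, eval_sub, eval_finsetSum, eval_mul, eval_C]
    calc _ ≤ (k + 1) * ((2 * k + 1) * C * S * C) + D * S * C := by
          refine (abs_sub _ _).trans (add_le_add h1 ?_)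
          rw [abs_mul]
          exact mul_le_mul hκ (abs_eval_cellPoly_le hab hC le_rfl hx).1 (abs_nonneg _)
            (by positivity)
      _ = D' * S := by rw [hD']; ring
      _ ≤ _ := by gcongr; linarith
  · have h1 := hsum (fun m => (derivative (cellPoly a b m)).eval x) (2 * C / (b - a))
      fun m hm => (abs_eval_cellPoly_le hab hC hm hx).2
    simp only [radauFormula, derivative_sub, derivative_sum, derivative_C_mul, eval_sub,
      eval_finsetSum, eval_mul, eval_C]
    calc _ ≤ (k + 1) * ((2 * k + 1) * C * S * (2 * C / (b - a))) + D * S * (2 * C / (b - a)) := by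
          refine (abs_sub _ _).trans (add_le_add h1 ?_)
          rw [abs_mul]
          exact mul_le_mul hκ (abs_eval_cellPoly_le hab hC le_rfl hx).2 (abs_nonneg _)
            (by positivity)
      _ = _ := by rw [hD']; field_simp

/-! ### Superconvergence of the Gauss-Radau projection at the Radau points -/

/-- Consider `R = (x - e') r'`. Integrating `∫ R L_m` by parts for `m < k`, the boundary terms
vanish because `(x - e') L_m` vanishes at `e'` and `r` at `e`; the remaining integral tests `r` with
degree below `k`. So `R` is a combination of `L_k` and `L_{k+1}` that vanishes at `e'`, hence a
multiple of the Radau polynomial vanishing there. Its other zeros are zeros of `r'`. -/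
theorem eval_derivative_eq_zero_of_radau {e' : ℝ} (hab : a < b)
    (hee : e = a ∧ e' = b ∨ e = b ∧ e' = a) {r : ℝ[X]}
    (hr : r.natDegree ≤ k + 1) (hw : ∀ w : ℝ[X], w.degree < k → ∫ x in a..b, r.eval x * w.eval x = 0)
    (hre : r.eval e = 0) {x : ℝ} (hx : x ∈ Ioo a b)
    (hx0 : (cellPoly a b (k + 1)).eval x
      + (cellPoly a b k).eval e * (cellPoly a b (k + 1)).eval e * (cellPoly a b k).eval x = 0) :
    (derivative r).eval x = 0 := by
  set R := (X - C e') * derivative r with hR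
  have hRdeg : R.natDegree ≤ k + 1 := by
    refine natDegree_mul_le.trans ?_
    have := natDegree_derivative_le r
    rw [natDegree_X_sub_C]
    omega
  have hRm : ∀ m < k, legendreCoeff a b (fun x => R.eval x) m = 0 := fun m hm => by
    set w := (X - C e') * cellPoly a b m with hw'
    have h1 := integral_eval_mul_derivative w r a b
    have h2 : w.eval b * r.eval b - w.eval a * r.eval a = 0 := by
      rcases hee with ⟨rfl, rfl⟩ | ⟨rfl, rfl⟩ <;> simp [hw', hre]
    have h3 : ∫ x in a..b, (derivative w).eval x * r.eval x = 0 := by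
      rw [← hw (derivative w)]
      · congr 1; ext x; ring
      · have hwd : w.natDegree ≤ k := by
          refine natDegree_mul_le.trans ?_
          rw [natDegree_X_sub_C, natDegree_cellPoly hab]
          omega
        by_cases hw0 : w = 0
        · rw [hw0, derivative_zero, degree_zero]; exact WithBot.bot_lt_coe k
        · refine (degree_derivative_lt hw0).trans_le ?_
          exact natDegree_le_iff_degree_le.mp hwd
    rw [h2, h3, sub_zero] at h1
    rw [legendreCoeff, ← mul_zero ((2 * (m : ℝ) + 1) / (b - a)), ← h1]
    congr 2
    ext x
    simp only [hR, hw', eval_mul]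
    ring
  have hRsum := eq_sum_legendreCoeff hab hRdeg
  rw [Finset.sum_range_succ, Finset.sum_range_succ, Finset.sum_eq_zero fun m hm => by
    rw [hRm m (Finset.mem_range.mp hm), C_0, zero_mul], zero_add] at hRsum
  set β := legendreCoeff a b (fun x => R.eval x) k
  set α := legendreCoeff a b (fun x => R.eval x) (k + 1)
  have he' : R.eval e' = 0 := by simp [hR]
  have hev : ∀ y, R.eval y = β * (cellPoly a b k).eval y + α * (cellPoly a b (k + 1)).eval y :=
    fun y => by
      conv_lhs => rw [hRsum]
      simp
  have hRx : R.eval x = 0 := by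
    rw [hev] at he' ⊢
    have hp : ((-1 : ℝ) ^ k) * (-1) ^ k = 1 := by rw [← mul_pow]; norm_num
    have hk2 : (cellPoly a b k).eval e * (cellPoly a b (k + 1)).eval e * α = β := by
      rcases hee with ⟨rfl, rfl⟩ | ⟨rfl, rfl⟩
      · rw [eval_cellPoly_right hab, eval_cellPoly_right hab] at he'
        rw [eval_cellPoly_left hab, eval_cellPoly_left hab, pow_succ]
        linear_combination (-α) * hp - he'
      · rw [eval_cellPoly_left hab, eval_cellPoly_left hab, pow_succ] at he'
        rw [eval_cellPoly_right hab, eval_cellPoly_right hab]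
        linear_combination (β - α) * hp - (-1) ^ k * he'
    rw [← hk2]
    linear_combination α * hx0
  rw [hR, eval_mul] at hRx
  refine (mul_eq_zero.mp hRx).resolve_left ?_
  rw [eval_sub, eval_X, eval_C, sub_eq_zero]
  rcases hee with ⟨_, rfl⟩ | ⟨_, rfl⟩
  exacts [hx.2.ne, hx.1.ne']

end RadauCell

section Corrector

variable {a b e : ℝ} {k : ℕ}

/-! ### Correction functions -/

theorem hasDerivAt_Dinv (v : ℝ[X]) (x : ℝ) :
    HasDerivAt (Dinv a b fun x => v.eval x) (2 / (b - a) * v.eval x) x := by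
  rw [← inv_div]
  exact (intervalIntegral.integral_hasDerivAt_right (intervalIntegrable_eval v a x)
    (v.continuous.stronglyMeasurableAtFilter _ _) v.continuous.continuousAt).const_mul _

theorem continuousOn_Dinv (v : ℝ[X]) (s : Set ℝ) :
    ContinuousOn (Dinv a b fun x => v.eval x) s :=
  fun x _ => (hasDerivAt_Dinv v x).continuousAt.continuousWithinAt

theorem abs_Dinv_le (hab : a < b) {v : ℝ[X]} {S : ℝ} (hS : ∀ x ∈ Icc a b, |v.eval x| ≤ S) :
    ∀ x ∈ Icc a b, |Dinv a b (fun x => v.eval x) x| ≤ 2 * S := by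
  intro x hx
  have hpos : 0 < b - a := by linarith
  have hS0 : 0 ≤ S := (abs_nonneg _).trans (hS a (left_mem_Icc.mpr hab.le))
  have h1 : ‖∫ y in a..x, v.eval y‖ ≤ S * |x - a| := by
    refine intervalIntegral.norm_integral_le_of_norm_le_const fun y hy => ?_
    rw [uIoc_of_le hx.1] at hy
    exact hS y ⟨hy.1.le, hy.2.trans hx.2⟩
  rw [Real.norm_eq_abs, abs_of_nonneg (sub_nonneg.mpr hx.1)] at h1
  rw [Dinv, abs_mul, abs_of_pos (by positivity)]
  calc _ ≤ ((b - a) / 2)⁻¹ * (S * (b - a)) := by gcongr; exact h1.trans (by gcongr; exact hx.2)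
    _ = 2 * S := by field_simp

/-- The operator `v ↦ P D_s⁻¹ v`, with the Gauss-Radau projection `P` interpolating at `e`. -/
def corrector (k : ℕ) (a b e : ℝ) (v : ℝ[X]) : ℝ[X] :=
  radauFormula k a b e (Dinv a b fun x => v.eval x)

theorem natDegree_corrector_le (hab : a < b) (v : ℝ[X]) : (corrector k a b e v).natDegree ≤ k :=
  natDegree_radauFormula_le hab _

theorem F₁_eq (hab : a < b) : F₁ k a b = corrector k a b a (cellPoly a b k) := by
  rw [F₁, corrector, ← radauProj_eq hab (Or.inl rfl) (continuousOn_Dinv _ _)]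
  simp only [eval_cellPoly]

theorem F₂_eq (hab : a < b) : F₂ k a b = corrector k a b b (cellPoly a b k) := by
  rw [F₂, corrector, ← radauProj_eq hab (Or.inr rfl) (continuousOn_Dinv _ _)]
  simp only [eval_cellPoly]

theorem F₁bar_eq (hab : a < b) :
    F₁bar k a b = corrector k a b b (corrector k a b a (cellPoly a b k)) := by
  rw [F₁bar, corrector, ← radauProj_eq hab (Or.inr rfl) (continuousOn_Dinv _ _), F₁_eq hab]

theorem F₂bar_eq (hab : a < b) :
    F₂bar k a b = corrector k a b a (corrector k a b b (cellPoly a b k)) := by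
  rw [F₂bar, corrector, ← radauProj_eq hab (Or.inl rfl) (continuousOn_Dinv _ _), F₂_eq hab]

theorem Dinv_right_eq_zero {v : ℝ[X]} (hv : ∫ x in a..b, v.eval x = 0) :
    Dinv a b (fun x => v.eval x) b = 0 := by
  rw [Dinv, hv, mul_zero]

theorem Dinv_left_eq_zero (v : ℝ → ℝ) : Dinv a b v a = 0 := by
  rw [Dinv, intervalIntegral.integral_same, mul_zero]

/-- For `v` of mean zero `D_s⁻¹ v` vanishes at both end points, so corrections never disturb the
flux values of the projection. -/
theorem eval_corrector_end (hab : a < b) (he : e = a ∨ e = b) {v : ℝ[X]}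
    (hv : ∫ x in a..b, v.eval x = 0) : (corrector k a b e v).eval e = 0 := by
  rw [corrector, (isRadauProj_radauFormula hab he (continuousOn_Dinv _ _)).2.2]
  rcases he with rfl | rfl
  exacts [Dinv_left_eq_zero _, Dinv_right_eq_zero hv]

theorem degree_derivative_lt_of_natDegree_le (hk : 0 < k) {w : ℝ[X]} (hw : w.natDegree ≤ k) :
    (derivative w).degree < k := by
  by_cases h0 : derivative w = 0
  · rw [h0, degree_zero]; exact WithBot.bot_lt_coe k
  · rw [← natDegree_lt_iff_degree_lt h0]
    exact (natDegree_derivative_le w).trans_lt (by omega)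

/-- The projection is invisible to `w'`, of degree below `k`, and `D_s⁻¹ v` can be integrated by
parts without boundary terms. This identity trades a mass residual for one smaller by a factor of
the cell length. -/
theorem integral_corrector_mul_derivative (hk : 0 < k) (hab : a < b) (he : e = a ∨ e = b) {v : ℝ[X]}
    (hv : ∫ x in a..b, v.eval x = 0) {w : ℝ[X]} (hw : w.natDegree ≤ k) :
    ∫ x in a..b, (corrector k a b e v).eval x * (derivative w).eval x
      = -(2 / (b - a) * ∫ x in a..b, v.eval x * w.eval x) := by
  rw [corrector, (isRadauProj_radauFormula hab he (continuousOn_Dinv _ _)).2.1 _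
    (degree_derivative_lt_of_natDegree_le hk hw),
    intervalIntegral.integral_mul_deriv_eq_deriv_mul (fun x _ => hasDerivAt_Dinv v x)
      (fun x _ => w.hasDerivAt x) (Continuous.intervalIntegrable (by fun_prop) _ _)
      (intervalIntegrable_eval _ _ _),
    Dinv_right_eq_zero hv, Dinv_left_eq_zero]
  simp only [mul_assoc, intervalIntegral.integral_const_mul]
  ring

theorem integral_cellPoly_eq_zero (hk : 0 < k) (hab : a < b) :
    ∫ x in a..b, (cellPoly a b k).eval x = 0 := by
  have := integral_cellPoly_mul_eq_zero hab (m := k) (p := 1) (by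
    rw [degree_one]; exact_mod_cast hk)
  simpa using this

/-- Testing the corrector identity with `w = x`, orthogonality of `L_k` to `x` makes the mean
vanish. For `k = 1` this fails, and no second correction step would be possible. -/
theorem integral_corrector_cellPoly_eq_zero (hk : 2 ≤ k) (hab : a < b) (he : e = a ∨ e = b) :
    ∫ x in a..b, (corrector k a b e (cellPoly a b k)).eval x = 0 := by
  have h := integral_corrector_mul_derivative (show 0 < k by omega) hab he
    (integral_cellPoly_eq_zero (by omega : 0 < k) hab) (w := X)
    (natDegree_X_le.trans (by omega))
  rw [integral_cellPoly_mul_eq_zero hab (by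
    rw [degree_X]; exact_mod_cast (by omega : 1 < k)), mul_zero, neg_zero] at h
  simpa using h

theorem exists_corrector_bound (k : ℕ) : ∃ C : ℝ, 1 ≤ C ∧ ∀ a b e e' : ℝ, a < b →
    (e = a ∨ e = b) → (e' = a ∨ e' = b) → ∀ x ∈ Icc a b,
      |(corrector k a b e (cellPoly a b k)).eval x| ≤ C ∧
      |(derivative (corrector k a b e (cellPoly a b k))).eval x| ≤ C / (b - a) ∧
      |(corrector k a b e (corrector k a b e' (cellPoly a b k))).eval x| ≤ C ∧
      |(derivative (corrector k a b e (corrector k a b e' (cellPoly a b k)))).eval x|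
        ≤ C / (b - a) := by
  obtain ⟨C₀, hC₀, h0⟩ := exists_legendre_bound k
  obtain ⟨C₁, hC₁, h1⟩ := exists_radau_bound k
  have h01 : 1 ≤ C₀ * C₁ := by nlinarith
  have hle : C₁ * (2 * C₀) ≤ C₁ * (2 * (C₁ * (2 * C₀))) := by nlinarith
  refine ⟨C₁ * (2 * (C₁ * (2 * C₀))), by nlinarith, fun a b e e' hab he he' x hx => ?_⟩
  have hpos : 0 < b - a := by linarith
  have hc := fun x hx => (abs_eval_cellPoly_le hab h0 (le_refl k) (x := x) hx).1
  have hF := fun e he => h1 a b e hab he _ _ (abs_Dinv_le hab hc)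
  have hFb := h1 a b e hab he _ _ (abs_Dinv_le hab fun x hx => ((hF e' he').2 x hx).1)
  refine ⟨((hF e he).2 x hx).1.trans hle, ((hF e he).2 x hx).2.trans ?_, (hFb.2 x hx).1,
    (hFb.2 x hx).2⟩
  gcongr

end Corrector

/-! ### Taylor approximation -/

/-- `f i`, for `i ≤ n`, are the successive derivatives of `f 0` on the set `I`; they are bounded by
`B`, and the last one is Lipschitz with constant `B`. -/
structure IsTower (n : ℕ) (B : ℝ) (I : Set ℝ) (f : ℕ → ℝ → ℝ) : Prop where
  hasDeriv : ∀ i < n, ∀ x ∈ I, HasDerivWithinAt (f i) (f (i + 1) x) I x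
  bound : ∀ i ≤ n, ∀ x ∈ I, |f i x| ≤ B
  lipschitz : ∀ x ∈ I, ∀ y ∈ I, |f n x - f n y| ≤ B * |x - y|

/-- The Taylor polynomial of degree `m` of `f i` at `a`. -/
def towerPoly (f : ℕ → ℝ → ℝ) (a : ℝ) (i m : ℕ) : ℝ[X] :=
  ∑ l ∈ Finset.range (m + 1), C (f (i + l) a / (l.factorial : ℝ)) * (X - C a) ^ l

theorem natDegree_towerPoly_le (f : ℕ → ℝ → ℝ) (a : ℝ) (i m : ℕ) :
    (towerPoly f a i m).natDegree ≤ m := by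
  refine natDegree_sum_le_of_forall_le _ _ fun l hl => (natDegree_C_mul_le _ _).trans ?_
  rw [natDegree_pow, natDegree_X_sub_C, mul_one]
  exact Nat.lt_succ_iff.mp (Finset.mem_range.mp hl)

theorem derivative_towerPoly (f : ℕ → ℝ → ℝ) (a : ℝ) (i m : ℕ) :
    derivative (towerPoly f a i (m + 1)) = towerPoly f a (i + 1) m := by
  rw [towerPoly, towerPoly, Finset.sum_range_succ', derivative_add, derivative_sum]
  simp only [pow_zero, mul_one, derivative_C, add_zero]
  refine Finset.sum_congr rfl fun l _ => ?_
  rw [derivative_C_mul, derivative_X_sub_C_pow, Nat.add_sub_cancel, ← mul_assoc, ← C_mul]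
  congr 2
  rw [show i + (l + 1) = i + 1 + l by ring, Nat.factorial_succ]
  have : (l.factorial : ℝ) ≠ 0 := by positivity
  push_cast
  field_simp

theorem eval_towerPoly (f : ℕ → ℝ → ℝ) (a : ℝ) (i m : ℕ) : (towerPoly f a i m).eval a = f i a := by
  rw [towerPoly, Finset.sum_range_succ', eval_add, eval_finsetSum]
  simp

namespace IsTower

variable {n : ℕ} {B : ℝ} {I : Set ℝ} {f : ℕ → ℝ → ℝ}

theorem continuousOn (H : IsTower n B I f) {i : ℕ} (hi : i ≤ n) : ContinuousOn (f i) I := by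
  rcases hi.eq_or_lt with rfl | hi
  · exact (LipschitzOnWith.of_dist_le' (K := B) fun x hx y hy => by
      rw [Real.dist_eq, Real.dist_eq]; exact H.lipschitz x hx y hy).continuousOn
  · exact fun x hx => (H.hasDeriv i hi x hx).continuousWithinAt

theorem lipschitz_of_le (H : IsTower n B I f) (hI : Convex ℝ I) {i : ℕ} (hi : i ≤ n) {x y : ℝ}
    (hx : x ∈ I) (hy : y ∈ I) : |f i x - f i y| ≤ B * |x - y| := by
  rcases hi.eq_or_lt with rfl | hi
  · exact H.lipschitz x hx y hy
  · exact hI.norm_image_sub_le_of_norm_hasDerivWithin_le (fun x hx => H.hasDeriv i hi x hx)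
      (fun x hx => H.bound (i + 1) hi x hx) hy hx

/-- The derivative of a Taylor error is the Taylor error of the derivative, one degree lower. The
induction starts from a Lipschitz bound, so the top level gains a power of `b - a` without a further
derivative. -/
theorem abs_sub_towerPoly_le (H : IsTower n B I f) {a b : ℝ} (hab : a ≤ b) (hI : Icc a b ⊆ I)
    (m : ℕ) : ∀ i, i + m ≤ n → ∀ x ∈ Icc a b,
      |f i x - (towerPoly f a i m).eval x| ≤ B * (b - a) ^ (m + 1) := by
  have haI := left_mem_Icc.mpr hab
  have hB : 0 ≤ B := (abs_nonneg _).trans (H.bound 0 (Nat.zero_le n) a (hI haI))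
  induction m with
  | zero =>
    intro i hi x hx
    have h2 : |f i x - f i a| ≤ B * |x - a| := by
      rcases (show i ≤ n by omega).eq_or_lt with rfl | hi
      · exact H.lipschitz x (hI hx) a (hI haI)
      · exact (convex_Icc a b).norm_image_sub_le_of_norm_hasDerivWithin_le
          (fun x hx => (H.hasDeriv i hi x (hI hx)).mono hI)
          (fun x hx => H.bound (i + 1) hi x (hI hx)) haI hx
    have h1 : (towerPoly f a i 0).eval x = f i a := by simp [towerPoly]
    rw [h1, zero_add, pow_one]
    refine h2.trans ?_
    rw [abs_of_nonneg (sub_nonneg.mpr hx.1)]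
    gcongr
    exact hx.2
  | succ m ih =>
    intro i hi x hx
    have h := (convex_Icc a b).norm_image_sub_le_of_norm_hasDerivWithin_le
      (f := fun x => f i x - (towerPoly f a i (m + 1)).eval x)
      (fun x hx => ((H.hasDeriv i (by omega) x (hI hx)).mono hI).fun_sub
        (((towerPoly f a i (m + 1)).hasDerivAt x).hasDerivWithinAt))
      (C := B * (b - a) ^ (m + 1))
      (fun x hx => by
        rw [derivative_towerPoly]
        exact ih (i + 1) (by omega) x hx) haI hx
    rw [eval_towerPoly, sub_self, sub_zero, Real.norm_eq_abs, Real.norm_eq_abs,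
      abs_of_nonneg (sub_nonneg.mpr hx.1)] at h
    refine h.trans ?_
    rw [pow_succ _ (m + 1), ← mul_assoc]
    have : 0 ≤ b - a := by linarith
    gcongr
    exact hx.2

/-- The Radau coefficient annihilates polynomials of degree at most `k`, so only the Taylor
remainder contributes. -/
theorem abs_radauCoeff_le (H : IsTower n B I f) {a b e C : ℝ} {k i m : ℕ} (hab : a < b)
    (hI : Icc a b ⊆ I)
    (hC : ∀ (v : ℝ → ℝ) (S : ℝ), (∀ x ∈ Icc a b, |v x| ≤ S) → |radauCoeff k a b e v| ≤ C * S)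
    (him : i + m ≤ n) (hm : m ≤ k) : |radauCoeff k a b e (f i)| ≤ C * (B * (b - a) ^ (m + 1)) := by
  have h1 := hC _ _ (H.abs_sub_towerPoly_le hab.le hI m i him)
  rwa [radauCoeff_sub hab ((H.continuousOn (by omega)).mono hI)
    (towerPoly f a i m).continuousOn, radauCoeff_eval hab ((natDegree_towerPoly_le _ _ _ _).trans hm),
    sub_zero] at h1

/-- The Taylor polynomial of degree `k+1` has no derivative error at these points; the remainder is
`O(h^{k+2})` and its projection loses one power by differentiation. -/
theorem abs_deriv_sub_radau_le (H : IsTower n B I f) {a b e e' C : ℝ} {k i : ℕ} (hab : a < b)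
    (hee : e = a ∧ e' = b ∨ e = b ∧ e' = a) (hI : Icc a b ⊆ I)
    (hC : ∀ (v : ℝ → ℝ) (S : ℝ), (∀ x ∈ Icc a b, |v x| ≤ S) →
      ∀ x ∈ Icc a b, |(derivative (radauFormula k a b e v)).eval x| ≤ C * S / (b - a))
    (him : i + (k + 1) ≤ n) {x : ℝ} (hx : x ∈ Ioo a b)
    (hx0 : (cellPoly a b (k + 1)).eval x
      + (cellPoly a b k).eval e * (cellPoly a b (k + 1)).eval e * (cellPoly a b k).eval x = 0) :
    |f (i + 1) x - (derivative (radauFormula k a b e (f i))).eval x|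
      ≤ (1 + C) * (B * (b - a) ^ (k + 1)) := by
  have hpos : 0 < b - a := by linarith
  have he : e = a ∨ e = b := hee.imp And.left And.left
  set p := towerPoly f a i (k + 1) with hp
  have hcont := (H.continuousOn (show i ≤ n by omega)).mono hI
  have h1 := hC _ _ (H.abs_sub_towerPoly_le hab.le hI (k + 1) i him) x ⟨hx.1.le, hx.2.le⟩
  have h2 := H.abs_sub_towerPoly_le hab.le hI k (i + 1) (by omega) x ⟨hx.1.le, hx.2.le⟩
  rw [← derivative_towerPoly] at h2
  rw [radauFormula_sub hab hcont p.continuousOn, derivative_sub, eval_sub] at h1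
  have hP := isRadauProj_radauFormula (k := k) hab he (v := fun x => p.eval x) p.continuousOn
  have h3 : (derivative (p - radauFormula k a b e fun x => p.eval x)).eval x = 0 := by
    refine eval_derivative_eq_zero_of_radau hab hee ?_ (fun w hw => ?_) ?_ hx hx0
    · exact (natDegree_sub_le _ _).trans
        (max_le (natDegree_towerPoly_le _ _ _ _) (hP.1.trans k.le_succ))
    · simp only [eval_sub, sub_mul]
      rw [intervalIntegral.integral_sub (Continuous.intervalIntegrable (by fun_prop) _ _)
        (Continuous.intervalIntegrable (by fun_prop) _ _), hP.2.1 w hw, sub_self]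
    · rw [eval_sub, hP.2.2, sub_self]
  rw [derivative_sub, eval_sub, sub_eq_zero] at h3
  have h4 : C * (B * (b - a) ^ (k + 1 + 1)) / (b - a) = C * (B * (b - a) ^ (k + 1)) := by
    rw [pow_succ _ (k + 1)]; field_simp
  rw [h4, ← h3] at h1
  rw [abs_le] at h1 h2 ⊢
  constructor <;> linarith

end IsTower

/-- `L_k(e) L_{k+1}(e)` is `1` at the right end and `-1` at the left end. This is why interpolation
at one end goes with the Radau points named after the other end. -/
theorem eq_zero_of_mem_leftRadau {a b x : ℝ} {k : ℕ} (hab : a < b) (hx : x ∈ leftRadau a b k) :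
    (cellPoly a b (k + 1)).eval x
      + (cellPoly a b k).eval b * (cellPoly a b (k + 1)).eval b * (cellPoly a b k).eval x = 0 := by
  rw [eval_cellPoly_right hab, eval_cellPoly_right hab, eval_cellPoly, eval_cellPoly]
  linear_combination hx.2

theorem eq_zero_of_mem_rightRadau {a b x : ℝ} {k : ℕ} (hab : a < b) (hx : x ∈ rightRadau a b k) :
    (cellPoly a b (k + 1)).eval x
      + (cellPoly a b k).eval a * (cellPoly a b (k + 1)).eval a * (cellPoly a b k).eval x = 0 := by
  rw [eval_cellPoly_left hab, eval_cellPoly_left hab, pow_succ, ← mul_assoc, ← mul_pow,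
    neg_mul_neg, one_mul, one_pow, eval_cellPoly, eval_cellPoly]
  linear_combination hx.2


/-! ### Weak derivatives on `(0, 2π)` are classical -/

open scoped ContDiff

/-- Test functions on `(0, 2π)`. -/
structure IsTest (φ : ℝ → ℝ) : Prop where
  contDiff : ContDiff ℝ ∞ φ
  hasCompactSupport : HasCompactSupport φ
  tsupport_subset : tsupport φ ⊆ Omega

namespace IsTest

variable {φ ψ : ℝ → ℝ}

theorem eq_zero (h : IsTest φ) {x : ℝ} (hx : x ∉ Omega) : φ x = 0 :=
  image_eq_zero_of_notMem_tsupport fun hx' => hx (h.tsupport_subset hx')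

theorem zero_left (h : IsTest φ) : φ 0 = 0 := h.eq_zero fun hx => lt_irrefl _ hx.1

theorem zero_right (h : IsTest φ) : φ (2 * Real.pi) = 0 := h.eq_zero fun hx => lt_irrefl _ hx.2

theorem const_mul (h : IsTest φ) (c : ℝ) : IsTest fun x => c * φ x := by
  have hsub : tsupport (fun x => c * φ x) ⊆ tsupport φ :=
    closure_mono fun x hx h0 => hx (by change c * φ x = 0; rw [h0, mul_zero])
  exact ⟨contDiff_const.mul h.contDiff, h.hasCompactSupport.mul_left,
    hsub.trans h.tsupport_subset⟩

theorem sub (h : IsTest φ) (h' : IsTest ψ) : IsTest fun x => φ x - ψ x := by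
  have hsub : tsupport (fun x => φ x - ψ x) ⊆ tsupport φ ∪ tsupport ψ := by
    refine closure_minimal (fun x hx => ?_) ((isClosed_tsupport _).union (isClosed_tsupport _))
    by_contra hcon
    rw [mem_union, not_or] at hcon
    exact hx (by simp [image_eq_zero_of_notMem_tsupport hcon.1,
      image_eq_zero_of_notMem_tsupport hcon.2])
  exact ⟨h.contDiff.sub h'.contDiff,
    (h.hasCompactSupport.isCompact.union h'.hasCompactSupport.isCompact).of_isClosed_subset
      (isClosed_tsupport _) hsub, hsub.trans (union_subset h.tsupport_subset h'.tsupport_subset)⟩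

theorem deriv (h : IsTest φ) : IsTest (deriv φ) :=
  ⟨(contDiff_infty_iff_deriv.mp h.contDiff).2, h.hasCompactSupport.deriv,
    (tsupport_deriv_subset).trans h.tsupport_subset⟩

theorem intervalIntegral_eq (h : IsTest φ) : ∫ x in (0 : ℝ)..2 * Real.pi, φ x = ∫ x, φ x := by
  rw [intervalIntegral.integral_of_le Real.two_pi_pos.le]
  refine setIntegral_eq_integral_of_forall_compl_eq_zero fun x hx => h.eq_zero fun hx' => hx ?_
  exact ⟨hx'.1, hx'.2.le⟩

/-- The primitive from `0` vanishes to the left of the support trivially, and to the right of it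
because the total integral is zero. -/
theorem exists_primitive (h : IsTest φ) (h0 : ∫ x in (0 : ℝ)..2 * Real.pi, φ x = 0) :
    ∃ ψ, IsTest ψ ∧ _root_.deriv ψ = φ := by
  have hd : ∀ x, HasDerivAt (fun x => ∫ y in (0 : ℝ)..x, φ y) (φ x) x := fun x =>
    intervalIntegral.integral_hasDerivAt_right (h.contDiff.continuous.intervalIntegrable _ _)
      (h.contDiff.continuous.stronglyMeasurableAtFilter _ _) h.contDiff.continuous.continuousAt
  have hderiv : _root_.deriv (fun x => ∫ y in (0 : ℝ)..x, φ y) = φ := funext fun x => (hd x).deriv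
  refine ⟨fun x => ∫ y in (0 : ℝ)..x, φ y, ?_, hderiv⟩
  have hsupp : ∃ α β, 0 < α ∧ β < 2 * Real.pi ∧ tsupport φ ⊆ Icc α β := by
    rcases (tsupport φ).eq_empty_or_nonempty with he | hne
    · exact ⟨1, 0, one_pos, Real.two_pi_pos, by simp [he]⟩
    · have hc := h.hasCompactSupport.isCompact
      exact ⟨sInf (tsupport φ), sSup (tsupport φ),
        (h.tsupport_subset (hc.sInf_mem hne)).1, (h.tsupport_subset (hc.sSup_mem hne)).2,
        fun x hx => ⟨csInf_le hc.bddBelow hx, le_csSup hc.bddAbove hx⟩⟩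
  obtain ⟨α, β, hα, hβ, hsub⟩ := hsupp
  have hz : ∀ x, x ∉ Icc α β → φ x = 0 := fun x hx =>
    image_eq_zero_of_notMem_tsupport fun hx' => hx (hsub hx')
  have hts : tsupport (fun x => ∫ y in (0 : ℝ)..x, φ y) ⊆ Icc α β := by
    refine closure_minimal (fun x hx => ?_) isClosed_Icc
    by_contra hcon
    refine hx ?_
    rcases lt_or_ge x α with hxα | hxα
    · refine (intervalIntegral.integral_congr (g := fun _ => 0) fun y hy => hz y fun hy' => ?_).trans
        intervalIntegral.integral_zero
      have := hy.2
      rcases max_cases (0 : ℝ) x with h | h <;> linarith [hy'.1]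
    · have hxβ : β < x := by
        by_contra hxβ
        exact hcon ⟨hxα, not_lt.mp hxβ⟩
      have h1 : ∫ y in x..2 * Real.pi, φ y = 0 :=
        (intervalIntegral.integral_congr (g := fun _ => 0) fun y hy => hz y fun hy' => by
          have := hy.1
          rcases min_cases x (2 * Real.pi) with h | h <;> linarith [hy'.2]).trans
          intervalIntegral.integral_zero
      have h2 := intervalIntegral.integral_add_adjacent_intervals
        (h.contDiff.continuous.intervalIntegrable (μ := volume) 0 x)
        (h.contDiff.continuous.intervalIntegrable x (2 * Real.pi))
      rw [h1, h0, add_zero] at h2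
      exact h2
  exact ⟨contDiff_infty_iff_deriv.mpr ⟨fun x => (hd x).differentiableAt, by
      rw [hderiv]; exact h.contDiff⟩,
    isCompact_Icc.of_isClosed_subset (isClosed_tsupport _) hts,
    hts.trans (Icc_subset_Ioo hα hβ)⟩

theorem integrable_mul (h : IsTest φ) {f : ℝ → ℝ} (hf : LocallyIntegrableOn f Omega) :
    IntegrableOn (fun x => f x * φ x) Omega := by
  have h1 : IntegrableOn f (tsupport φ) :=
    hf.integrableOn_compact_subset h.tsupport_subset h.hasCompactSupport.isCompact
  have h2 : IntegrableOn (fun x => f x * φ x) (tsupport φ) :=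
    h1.mul_continuousOn h.contDiff.continuous.continuousOn h.hasCompactSupport.isCompact
  refine IntegrableOn.of_forall_sdiff_eq_zero h2 measurableSet_Ioo fun x hx => ?_
  rw [image_eq_zero_of_notMem_tsupport hx.2, mul_zero]

end IsTest

theorem exists_isTest_integral_eq_one : ∃ χ, IsTest χ ∧ ∫ x in (0 : ℝ)..2 * Real.pi, χ x = 1 := by
  let f : ContDiffBump (Real.pi : ℝ) := ⟨1, 2, one_pos, one_lt_two⟩
  have h : IsTest (f.normed volume) := by
    refine ⟨f.contDiff_normed, f.hasCompactSupport_normed, ?_⟩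
    rw [f.tsupport_normed_eq, Real.closedBall_eq_Icc]
    have := Real.pi_gt_three
    exact Icc_subset_Ioo (by change 0 < Real.pi - 2; linarith)
      (by change Real.pi + 2 < 2 * Real.pi; linarith)
  exact ⟨_, h, by rw [h.intervalIntegral_eq, f.integral_normed]⟩

theorem setIntegral_Omega (f : ℝ → ℝ) :
    ∫ x in Omega, f x = ∫ x in (0 : ℝ)..2 * Real.pi, f x := by
  rw [intervalIntegral.integral_of_le Real.two_pi_pos.le, Omega, integral_Ioc_eq_integral_Ioo]

theorem ae_eq_zero_of_forall_isTest {f : ℝ → ℝ} (hf : LocallyIntegrableOn f Omega)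
    (h : ∀ φ, IsTest φ → ∫ x in Omega, f x * φ x = 0) : ∀ᵐ x, x ∈ Omega → f x = 0 := by
  refine isOpen_Ioo.ae_eq_zero_of_integral_contDiff_smul_eq_zero hf fun φ h1 h2 h3 => ?_
  have hφ : IsTest φ := ⟨h1, h2, h3⟩
  rw [← h φ hφ, ← integral_indicator (show MeasurableSet Omega from measurableSet_Ioo)]
  congr 1
  ext x
  by_cases hx : x ∈ Omega
  · rw [indicator_of_mem hx, smul_eq_mul, mul_comm]
  · rw [indicator_of_notMem hx, hφ.eq_zero hx, zero_smul]

theorem locallyIntegrableOn_const_Omega (c : ℝ) : LocallyIntegrableOn (fun _ => c) Omega :=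
  (continuous_const.locallyIntegrable (μ := volume)).locallyIntegrableOn _

/-- The lemma of du Bois-Reymond. -/
theorem ae_eq_const_of_forall_isTest {f : ℝ → ℝ} (hf : LocallyIntegrableOn f Omega)
    (h : ∀ φ, IsTest φ → ∫ x in Omega, f x * deriv φ x = 0) : ∃ c, ∀ᵐ x, x ∈ Omega → f x = c := by
  obtain ⟨χ, hχ, hχ1⟩ := exists_isTest_integral_eq_one
  refine ⟨∫ x in Omega, f x * χ x, ?_⟩
  set c := ∫ x in Omega, f x * χ x with hc
  have := ae_eq_zero_of_forall_isTest (hf.sub (locallyIntegrableOn_const_Omega c)) fun φ hφ => by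
    set s := ∫ x in (0 : ℝ)..2 * Real.pi, φ x with hs
    -- Removing the mean of `φ` by a multiple of `χ` turns it into the derivative of a test
    -- function, to which the hypothesis applies.
    obtain ⟨ψ, hψ, hψ'⟩ := (hφ.sub (hχ.const_mul s)).exists_primitive (by
      rw [intervalIntegral.integral_sub (hφ.contDiff.continuous.intervalIntegrable _ _)
        ((hχ.const_mul s).contDiff.continuous.intervalIntegrable _ _),
        intervalIntegral.integral_const_mul, hχ1, mul_one, sub_self])
    have h1 := h ψ hψ
    rw [hψ'] at h1
    simp only [mul_sub] at h1
    rw [integral_sub (hφ.integrable_mul hf) ((hχ.const_mul s).integrable_mul hf)] at h1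
    simp only [mul_left_comm _ s] at h1
    rw [integral_const_mul, ← hc] at h1
    simp only [Pi.sub_apply, sub_mul]
    rw [integral_sub (hφ.integrable_mul hf)
      (hφ.integrable_mul (locallyIntegrableOn_const_Omega c)), integral_const_mul,
      setIntegral_Omega φ, ← hs]
    linarith
  filter_upwards [this] with x hx hx'
  exact sub_eq_zero.mp (hx hx')

/-- A primitive of the merely integrable `g` is absolutely continuous, so it has weak derivative `g`
by integration by parts. Its difference from `f` has weak derivative zero. -/
theorem ae_eq_primitive_of_forall_isTest {f g : ℝ → ℝ} (hf : LocallyIntegrableOn f Omega)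
    (hg : IntervalIntegrable g volume 0 (2 * Real.pi))
    (h : ∀ φ, IsTest φ → ∫ x in Omega, f x * deriv φ x = -∫ x in Omega, g x * φ x) :
    ∃ c, ∀ᵐ x, x ∈ Omega → f x = c + ∫ y in (0 : ℝ)..x, g y := by
  set G := fun x => ∫ y in (0 : ℝ)..x, g y with hG
  have hac : AbsolutelyContinuousOnInterval G 0 (2 * Real.pi) :=
    hg.absolutelyContinuousOnInterval_intervalIntegral (by simp)
  have hGc : ContinuousOn G Omega := hac.continuousOn.mono (by
    rw [uIcc_of_le Real.two_pi_pos.le]; exact Ioo_subset_Icc_self)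
  have hGi : LocallyIntegrableOn G Omega := hGc.locallyIntegrableOn measurableSet_Ioo
  have hparts : ∀ φ, IsTest φ → ∫ x in Omega, G x * deriv φ x = -∫ x in Omega, g x * φ x := by
    intro φ hφ
    have hφac : AbsolutelyContinuousOnInterval φ 0 (2 * Real.pi) :=
      ContDiffOn.absolutelyContinuousOnInterval
        ((hφ.contDiff.of_le (by norm_cast)).contDiffOn)
    rw [setIntegral_Omega, setIntegral_Omega, hac.integral_mul_deriv_eq_deriv_mul hφac,
      hφ.zero_left, hφ.zero_right, mul_zero, mul_zero, sub_zero, zero_sub]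
    congr 1
    refine intervalIntegral.integral_congr_ae ?_
    filter_upwards [hg.ae_hasDerivAt_integral] with x hx hx'
    rw [(hx (uIoc_subset_uIcc hx') 0 (by simp)).deriv]
  obtain ⟨c, hc⟩ := ae_eq_const_of_forall_isTest (hf.sub hGi) fun φ hφ => by
    simp only [Pi.sub_apply, sub_mul]
    rw [integral_sub (hφ.deriv.integrable_mul hf) (hφ.deriv.integrable_mul hGi), h φ hφ,
      hparts φ hφ, sub_self]
  refine ⟨c, ?_⟩
  filter_upwards [hc] with x hx hx'
  have := hx hx'
  rw [Pi.sub_apply] at this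
  linarith

/-! ### Classical derivatives from weak ones -/

theorem convex_OmegaBar : Convex ℝ OmegaBar := convex_Icc _ _

theorem uniqueDiffOn_OmegaBar : UniqueDiffOn ℝ OmegaBar := uniqueDiffOn_Icc Real.two_pi_pos

theorem ae_restrict_Omega_of_ae {p : ℝ → Prop} (h : ∀ᵐ x, x ∈ Omega → p x) :
    ∀ᵐ x ∂volume.restrict OmegaBar, p x := by
  rw [OmegaBar, ← restrict_Ioo_eq_restrict_Icc]
  exact (ae_restrict_iff' measurableSet_Ioo).mpr h

theorem abs_le_of_ae_abs_le {G : ℝ → ℝ} {S : ℝ} (hG : Continuous G)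
    (h : ∀ᵐ x, x ∈ Omega → |G x| ≤ S) : ∀ x ∈ OmegaBar, |G x| ≤ S := by
  have := Measure.eqOn_Icc_of_ae_eq (μ := volume) Real.two_pi_pos.ne
    (f := fun x => max |G x| S) (g := fun _ => S)
    (by filter_upwards [ae_restrict_Omega_of_ae h] with x hx using max_eq_right hx)
    (by fun_prop) (by fun_prop)
  exact fun x hx => max_eq_right_iff.mp (this hx)

/-- Each `D i` is almost everywhere a primitive `G i` of `D (i+1)`. The `G i` form a chain of
classical derivatives, the last with a bounded integrand and hence Lipschitz; continuity identifies
`f` with `G 0`, and then `dx^[i] f` with `G i`. -/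
theorem isTower_of_isWeakDeriv {n : ℕ} {S : ℝ} {f : ℝ → ℝ} (hf : ContinuousOn f OmegaBar)
    {D : ℕ → ℝ → ℝ} (hD : ∀ i ≤ n + 1, IsWeakDeriv i f (D i))
    (hS : ∀ i ≤ n + 1, ∀ᵐ x, x ∈ Omega → |D i x| ≤ S) :
    IsTower n S OmegaBar fun i => dx^[i] f := by
  have hS0 : 0 ≤ S := by
    by_contra hneg
    have h1 : ∀ᵐ x, x ∉ Omega := by
      filter_upwards [hS 0 (Nat.zero_le _)] with x hx hx'
      linarith [abs_nonneg (D 0 x), hx hx']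
    have h2 : volume Omega = 0 := by simpa [ae_iff] using h1
    rw [Omega, Real.volume_Ioo, ENNReal.ofReal_eq_zero] at h2
    linarith [Real.two_pi_pos]
  have hint : ∀ i ≤ n + 1, IntegrableOn (D i) Omega := fun i hi => by
    have hm := ((hD i hi).2.1).aestronglyMeasurable
    have : IsFiniteMeasure (volume.restrict Omega) := by unfold Omega; infer_instance
    exact Integrable.of_bound hm S ((ae_restrict_iff' measurableSet_Ioo).mpr (hS i hi))
  set g : ℕ → ℝ → ℝ := fun i => Omega.indicator (D i) with hg
  have hgint : ∀ i ≤ n + 1, Integrable (g i) := fun i hi =>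
    (integrable_indicator_iff measurableSet_Ioo).mpr (hint i hi)
  have hgS : ∀ i ≤ n + 1, ∀ᵐ x, |g i x| ≤ S := fun i hi => by
    filter_upwards [hS i hi] with x hx
    by_cases hx' : x ∈ Omega
    · simpa [hg, hx'] using hx hx'
    · simpa [hg, hx'] using hS0
  have hprim : ∀ i ≤ n, ∃ c, ∀ᵐ x, x ∈ Omega → D i x = c + ∫ y in (0 : ℝ)..x, g (i + 1) y := by
    intro i hi
    refine ae_eq_primitive_of_forall_isTest (hD i (by omega)).2.1
      (hgint (i + 1) (by omega)).intervalIntegrable fun φ hφ => ?_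
    have h1 := (hD i (by omega)).2.2 (deriv φ) hφ.deriv.contDiff hφ.deriv.hasCompactSupport
      hφ.deriv.tsupport_subset
    have h2 := (hD (i + 1) (by omega)).2.2 φ hφ.contDiff hφ.hasCompactSupport hφ.tsupport_subset
    rw [iteratedDeriv_succ', h1, pow_succ, mul_neg_one, neg_mul, ← mul_neg] at h2
    rw [mul_left_cancel₀ (pow_ne_zero i (by norm_num)) h2]
    congr 1
    refine setIntegral_congr_fun measurableSet_Ioo fun x hx => ?_
    change _ = Omega.indicator (D (i + 1)) x * φ x
    rw [indicator_of_mem hx]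
  choose! c hc using hprim
  set G : ℕ → ℝ → ℝ := fun i x => c i + ∫ y in (0 : ℝ)..x, g (i + 1) y with hGdef
  have hGc : ∀ i ≤ n, Continuous (G i) := fun i hi =>
    continuous_const.add (intervalIntegral.continuous_primitive
      (fun a b => (hgint (i + 1) (by omega)).intervalIntegrable) 0)
  have hGb : ∀ i ≤ n, ∀ x ∈ OmegaBar, |G i x| ≤ S := fun i hi => by
    refine abs_le_of_ae_abs_le (hGc i hi) ?_
    filter_upwards [hc i hi, hS i (by omega)] with x hx hx' hxΩ
    rw [hGdef]
    simp only
    rw [← hx hxΩ]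
    exact hx' hxΩ
  have hGd : ∀ i < n, ∀ x ∈ OmegaBar, HasDerivWithinAt (G i) (G (i + 1) x) OmegaBar x := by
    intro i hi
    have hH : ∀ x, HasDerivAt (fun x => c i + ∫ y in (0 : ℝ)..x, G (i + 1) y) (G (i + 1) x) x :=
      fun x => (intervalIntegral.integral_hasDerivAt_right
        ((hGc (i + 1) hi).intervalIntegrable _ _)
        ((hGc (i + 1) hi).stronglyMeasurableAtFilter _ _) (hGc (i + 1) hi).continuousAt).const_add _
    have heq : EqOn (G i) (fun x => c i + ∫ y in (0 : ℝ)..x, G (i + 1) y) OmegaBar := by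
      intro x hx
      rw [hGdef]
      simp only
      congr 1
      -- `D` is controlled on the open interval only; the end point `2π` of the range of integration
      -- is a null set.
      have hends : ∀ᵐ y : ℝ, y ≠ 2 * Real.pi := by simp [ae_iff]
      refine intervalIntegral.integral_congr_ae ?_
      filter_upwards [hc (i + 1) hi, hends] with y hy hy2 hy'
      rw [uIoc_of_le hx.1] at hy'
      have hyΩ : y ∈ Omega := ⟨hy'.1, lt_of_le_of_ne (hy'.2.trans hx.2) hy2⟩
      rw [← hy hyΩ]
      exact indicator_of_mem hyΩ _
    exact fun x hx => ((hH x).hasDerivWithinAt).congr heq (heq hx)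
  have hG0 : EqOn f (G 0) OmegaBar := by
    refine Measure.eqOn_Icc_of_ae_eq (μ := volume) Real.two_pi_pos.ne ?_ hf
      (hGc 0 (Nat.zero_le n)).continuousOn
    have h1 := ae_eq_zero_of_forall_isTest (((hD 0 (by omega)).1).sub (hD 0 (by omega)).2.1)
      fun φ hφ => by
        have h2 := (hD 0 (by omega)).2.2 φ hφ.contDiff hφ.hasCompactSupport hφ.tsupport_subset
        rw [iteratedDeriv_zero, pow_zero, one_mul] at h2
        simp only [Pi.sub_apply, sub_mul]
        rw [integral_sub (hφ.integrable_mul (hD 0 (by omega)).1)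
          (hφ.integrable_mul (hD 0 (by omega)).2.1), h2, sub_self]
    refine ae_restrict_Omega_of_ae ?_
    filter_upwards [h1, hc 0 (Nat.zero_le n)] with x hx hx' hxΩ
    rw [sub_eq_zero.mp (hx hxΩ)]
    exact hx' hxΩ
  have hdx : ∀ i ≤ n, EqOn (dx^[i] f) (G i) OmegaBar := by
    intro i
    induction i with
    | zero => exact fun _ => hG0
    | succ i ih =>
      intro hi x hx
      rw [Function.iterate_succ_apply', dx, derivWithin_congr (ih (by omega)) (ih (by omega) hx)]
      exact (hGd i hi x hx).derivWithin (uniqueDiffOn_OmegaBar x hx)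
  refine ⟨fun i hi x hx => ?_, fun i hi x hx => ?_, fun x hx y hy => ?_⟩
  · have := (hGd i hi x hx).congr (hdx i hi.le) (hdx i hi.le hx)
    rwa [← hdx (i + 1) hi hx] at this
  · rw [hdx i hi hx]
    exact hGb i hi x hx
  · rw [hdx n le_rfl hx, hdx n le_rfl hy, hGdef]
    simp only [add_sub_add_left_eq_sub]
    rw [intervalIntegral.integral_interval_sub_left (hgint _ le_rfl).intervalIntegrable
      (hgint _ le_rfl).intervalIntegrable]
    exact intervalIntegral.norm_integral_le_of_norm_le_const_ae (f := g (n + 1))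
      ((hgS _ le_rfl).mono fun x hx _ => hx)

/-- The norm is an infimum over choices of weak derivatives, so a bound comes only with every `S >
B`. The functions `dx^[i] f` do not depend on that choice, which permits the passage to `S = B`. -/
theorem isTower_of_sobolevNorm_le {n : ℕ} {B : ℝ} {f : ℝ → ℝ} (hf : ContinuousOn f OmegaBar)
    (hB : 0 ≤ B) (h : sobolevNorm (n + 1) f ≤ ENNReal.ofReal B) :
    IsTower n B OmegaBar fun i => dx^[i] f := by
  have key : ∀ S, B < S → IsTower n S OmegaBar fun i => dx^[i] f := by
    intro S hS
    have h1 : sobolevNorm (n + 1) f < ENNReal.ofReal S :=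
      h.trans_lt ((ENNReal.ofReal_lt_ofReal_iff (hB.trans_lt hS)).mpr hS)
    rw [sobolevNorm] at h1
    obtain ⟨D, h2⟩ := iInf_lt_iff.mp h1
    obtain ⟨hD, h3⟩ := iInf_lt_iff.mp h2
    refine isTower_of_isWeakDeriv hf hD fun i hi => ?_
    have h4 : eLpNorm (D i) ⊤ (volume.restrict Omega) ≤ ENNReal.ofReal S :=
      (le_iSup₂ (f := fun i (_ : i ≤ n + 1) => eLpNorm (D i) ⊤ (volume.restrict Omega)) i hi).trans
        h3.le
    rw [eLpNorm_exponent_top] at h4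
    have h5 := ae_le_eLpNormEssSup (f := D i) (μ := volume.restrict Omega)
    refine (ae_restrict_iff' measurableSet_Ioo).mp ?_
    filter_upwards [h5] with x hx
    have h6 := hx.trans h4
    rw [← ofReal_norm, ENNReal.ofReal_le_ofReal_iff (hB.trans hS.le)] at h6
    exact h6
  have hB1 := key (B + 1) (lt_add_one B)
  refine ⟨hB1.hasDeriv, fun i hi x hx => le_of_forall_gt_imp_ge_of_dense fun S hS =>
    (key S hS).bound i hi x hx, fun x hx y hy => ?_⟩
  rcases eq_or_ne x y with rfl | hne
  · simp
  · have hpos : 0 < |x - y| := abs_pos.mpr (sub_ne_zero.mpr hne)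
    rw [← div_le_iff₀ hpos]
    refine le_of_forall_gt_imp_ge_of_dense fun S hS => ?_
    rw [div_le_iff₀ hpos]
    exact (key S hS).lipschitz x hx y hy


/-! ### Regularity in time of a solution of the heat equation -/

open Filter Topology

theorem abs_deriv_le_of_abs_sub_le {W : ℝ → ℝ} {w x A E : ℝ} (hx : x ∈ OmegaBar)
    (hW : HasDerivWithinAt W w OmegaBar x)
    (h : ∀ y ∈ OmegaBar, |W y - W x| ≤ (A * |y - x| + E) * |y - x|) : |w| ≤ E := by
  rw [hasDerivWithinAt_iff_tendsto_slope] at hW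
  have : (𝓝[OmegaBar \ {x}] x).NeBot :=
    accPt_principal_iff_nhdsWithin.mp (uniqueDiffWithinAt_iff_accPt.mp (uniqueDiffOn_OmegaBar x hx))
  have h1 : Tendsto (fun y => A * |y - x| + E) (𝓝[OmegaBar \ {x}] x) (𝓝 E) := by
    have : ContinuousAt (fun y => A * |y - x| + E) x := by fun_prop
    have h2 := this.tendsto.mono_left (nhdsWithin_le_nhds (s := OmegaBar \ {x}))
    simpa using h2
  refine le_of_tendsto_of_tendsto hW.abs h1 ?_
  filter_upwards [self_mem_nhdsWithin] with y hy
  have hpos : 0 < |y - x| := abs_pos.mpr (sub_ne_zero.mpr hy.2)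
  rw [slope_def_field, abs_div, div_le_iff₀ hpos]
  exact h y hy.1

/-- An interpolation inequality of Landau type. -/
theorem abs_deriv_le_of_abs_le {d d' : ℝ → ℝ} {A ε η : ℝ} (hη : 0 < η) (hηπ : η ≤ Real.pi)
    (hd : ∀ x ∈ OmegaBar, HasDerivWithinAt d (d' x) OmegaBar x)
    (hlip : ∀ x ∈ OmegaBar, ∀ y ∈ OmegaBar, |d' x - d' y| ≤ A * |x - y|)
    (hε : ∀ x ∈ OmegaBar, |d x| ≤ ε) (hA : 0 ≤ A) {x : ℝ} (hx : x ∈ OmegaBar) :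
    |d' x| ≤ 2 * ε / η + A * η := by
  -- The neighbour at distance `η` is taken on the side that has room; `η ≤ π` guarantees one.
  obtain ⟨y, hy, hxy⟩ : ∃ y ∈ OmegaBar, |y - x| = η := by
    rcases le_total x Real.pi with h | h
    · exact ⟨x + η, ⟨by linarith [hx.1], by linarith⟩, by simp [abs_of_pos hη]⟩
    · exact ⟨x - η, ⟨by linarith, by linarith [hx.2]⟩, by simp [abs_of_pos hη]⟩
  have hsub : uIcc x y ⊆ OmegaBar := convex_OmegaBar.ordConnected.uIcc_subset hx hy
  have h1 := (convex_uIcc x y).norm_image_sub_le_of_norm_hasDerivWithin_le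
    (f := fun z => d z - d' x * z) (f' := fun z => d' z - d' x) (C := A * η)
    (fun z hz => ((hd z (hsub hz)).mono hsub).fun_sub
      (by simpa using ((hasDerivAt_id z).const_mul (d' x)).hasDerivWithinAt))
    (fun z hz => by
      rw [Real.norm_eq_abs]
      refine (hlip z (hsub hz) x hx).trans ?_
      have := abs_sub_left_of_mem_uIcc hz
      rw [hxy] at this
      gcongr)
    left_mem_uIcc right_mem_uIcc
  rw [Real.norm_eq_abs, Real.norm_eq_abs, hxy] at h1
  have h2 := hε x hx
  have h3 := hε y hy
  have h4 : |d' x * (y - x)| ≤ 2 * ε + A * η * η := by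
    rw [abs_le] at *
    constructor <;> nlinarith
  rw [abs_mul, hxy] at h4
  rw [← sub_nonneg]
  have h5 : 2 * ε / η + A * η - |d' x| = (2 * ε + A * η * η - |d' x| * η) / η := by field_simp
  rw [h5]
  exact div_nonneg (by linarith) hη.le

section TimeRegularity

variable {fl : Flux} {bc : BoundaryCondition} {T B : ℝ} {n : ℕ} {u : ℝ → ℝ → ℝ}

/-- Induction on the order: `u` is uniformly continuous on a compact set, and if a difference in
time is small while its space derivative is `2B`-Lipschitz, then by interpolation this derivative is
small too. -/
theorem eventually_abs_sub_le (hu : IsHeatSolution fl bc T u)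
    (hU : ∀ t ∈ Icc 0 T, IsTower n B OmegaBar fun i => dx^[i] (u t)) {i : ℕ} (hi : i ≤ n) {s : ℝ}
    (hs : s ∈ Icc 0 T) {ε : ℝ} (hε : 0 < ε) :
    ∃ δ > 0, ∀ t ∈ Icc 0 T, |t - s| < δ → ∀ x ∈ OmegaBar,
      |dx^[i] (u t) x - dx^[i] (u s) x| ≤ ε := by
  have hB : 0 ≤ B := (abs_nonneg _).trans
    ((hU s hs).bound 0 (Nat.zero_le n) 0 ⟨le_rfl, Real.two_pi_pos.le⟩)
  induction i generalizing ε with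
  | zero =>
    have huc := (isCompact_Icc.prod isCompact_Icc).uniformContinuousOn_of_continuous hu.continuousOn
    obtain ⟨δ, hδ, h⟩ := Metric.uniformContinuousOn_iff.mp huc ε hε
    refine ⟨δ, hδ, fun t ht hts x hx => ?_⟩
    have := h (t, x) ⟨ht, hx⟩ (s, x) ⟨hs, hx⟩ (by simpa [Prod.dist_eq, Real.dist_eq, hδ] using hts)
    exact this.le
  | succ i ih =>
    set η := min Real.pi (ε / (4 * B + 1)) with hη
    have hη0 : 0 < η := lt_min Real.pi_pos (by positivity)
    obtain ⟨δ, hδ, h⟩ := ih (by omega) (ε := η * ε / 4) (by positivity)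
    refine ⟨δ, hδ, fun t ht hts x hx => ?_⟩
    have h1 := abs_deriv_le_of_abs_le (A := 2 * B) hη0 (min_le_left _ _)
      (d := fun x => dx^[i] (u t) x - dx^[i] (u s) x)
      (d' := fun x => dx^[i + 1] (u t) x - dx^[i + 1] (u s) x)
      (fun x hx => ((hU t ht).hasDeriv i (by omega) x hx).fun_sub
        ((hU s hs).hasDeriv i (by omega) x hx))
      (fun x hx y hy => by
        have h1 := (hU t ht).lipschitz_of_le convex_OmegaBar hi hx hy
        have h2 := (hU s hs).lipschitz_of_le convex_OmegaBar hi hx hy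
        rw [abs_le] at *
        constructor <;> linarith) (h t ht hts) (by positivity) hx
    refine h1.trans ?_
    have h2 : 2 * (η * ε / 4) / η = ε / 2 := by field_simp; ring
    have h3 : 2 * B * η ≤ ε / 2 := by
      calc 2 * B * η ≤ 2 * B * (ε / (4 * B + 1)) := by gcongr; exact min_le_right _ _
        _ ≤ ε / 2 := by
          rw [← mul_div_assoc, div_le_iff₀ (by positivity)]
          nlinarith
    linarith

theorem hasDerivWithinAt_of_uniform {i j : ℕ} {s x : ℝ}
    (h : ∀ ε > 0, ∃ δ > 0, ∀ t ∈ Icc 0 T, |t - s| < δ → ∀ x ∈ OmegaBar,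
      |dx^[i] (u t) x - dx^[i] (u s) x - (t - s) * dx^[j] (u s) x| ≤ ε * |t - s|)
    (hx : x ∈ OmegaBar) :
    HasDerivWithinAt (fun t => dx^[i] (u t) x) (dx^[j] (u s) x) (Icc 0 T) s := by
  rw [hasDerivWithinAt_iff_isLittleO, Asymptotics.isLittleO_iff]
  intro ε hε
  obtain ⟨δ, hδ, h⟩ := h ε hε
  filter_upwards [self_mem_nhdsWithin, mem_nhdsWithin_of_mem_nhds (Metric.ball_mem_nhds s hδ)]
    with t ht hts
  exact h t ht (by rwa [Metric.mem_ball, Real.dist_eq] at hts) x hx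

/-- The heat equation holds classically only for `u` itself and for `t > 0`. Uniformity in `x` is
what lets the formula `∂_t = ∂_x²` be differentiated in space, without any assumption on mixed
derivatives. -/
theorem time_deriv_uniform (hu : IsHeatSolution fl bc T u)
    (hU : ∀ t ∈ Icc 0 T, IsTower n B OmegaBar fun i => dx^[i] (u t)) {i : ℕ} (hi : i + 2 ≤ n)
    {s : ℝ} (hs : s ∈ Icc 0 T) {ε : ℝ} (hε : 0 < ε) :
    ∃ δ > 0, ∀ t ∈ Icc 0 T, |t - s| < δ → ∀ x ∈ OmegaBar,
      |dx^[i] (u t) x - dx^[i] (u s) x - (t - s) * dx^[i + 2] (u s) x| ≤ ε * |t - s| := by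
  induction i generalizing s ε with
  | zero =>
    obtain ⟨δ, hδ, h⟩ := eventually_abs_sub_le hu hU hi hs hε
    -- The mean value theorem evaluates the equation only at interior times, so `s = 0` is reached
    -- through the continuity of `u_xx`.
    have key : ∀ x ∈ OmegaBar, ∀ p ∈ Icc 0 T, ∀ q ∈ Icc 0 T, p < q →
        ∃ r ∈ Ioo p q, u q x - u p x = (q - p) * dx^[2] (u r) x := by
      intro x hx p hp q hq hpq
      obtain ⟨r, hr, he⟩ := exists_hasDerivAt_eq_slope (fun t => u t x)
        (fun r => dx^[2] (u r) x) hpq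
        (fun t ht => by
          have ht' : t ∈ Icc 0 T := ⟨hp.1.trans ht.1, ht.2.trans hq.2⟩
          have h1 := hu.continuousOn (t, x) ⟨ht', hx⟩
          exact h1.comp (f := fun t => (t, x)) (s := Icc p q)
            (by fun_prop : Continuous fun t : ℝ => (t, x)).continuousWithinAt
            fun r hr => ⟨⟨hp.1.trans hr.1, hr.2.trans hq.2⟩, hx⟩)
        (fun r hr => (hu.equation r ⟨hp.1.trans_lt hr.1, (hr.2.trans_le hq.2).le⟩ x hx).hasDerivAt
          (Icc_mem_nhds (hp.1.trans_lt hr.1) (hr.2.trans_le hq.2)))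
      refine ⟨r, hr, ?_⟩
      have : q - p ≠ 0 := by linarith
      rw [he]
      field_simp
    refine ⟨δ, hδ, fun t ht hts x hx => ?_⟩
    have fin : ∀ r, r ∈ Icc 0 T → |r - s| < δ →
        u t x - u s x = (t - s) * dx^[2] (u r) x →
        |dx^[0] (u t) x - dx^[0] (u s) x - (t - s) * dx^[0 + 2] (u s) x| ≤ ε * |t - s| := by
      intro r hr hrs he
      have e : dx^[0] (u t) x - dx^[0] (u s) x - (t - s) * dx^[0 + 2] (u s) x
          = (dx^[0 + 2] (u r) x - dx^[0 + 2] (u s) x) * (t - s) := by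
        change u t x - u s x - _ = _
        rw [he, zero_add]; ring
      rw [e, abs_mul]
      exact mul_le_mul_of_nonneg_right (h r hr hrs x hx) (abs_nonneg _)
    rcases lt_trichotomy s t with hst | rfl | hst
    · obtain ⟨r, hr, he⟩ := key x hx s hs t ht hst
      refine fin r ⟨hs.1.trans hr.1.le, hr.2.le.trans ht.2⟩ ?_ he
      rw [abs_lt] at hts ⊢
      constructor <;> linarith [hr.1, hr.2]
    · simp
    · obtain ⟨r, hr, he⟩ := key x hx t ht s hs hst
      refine fin r ⟨ht.1.trans hr.1.le, hr.2.le.trans hs.2⟩ ?_ (by linarith)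
      rw [abs_lt] at hts ⊢
      constructor <;> linarith [hr.1, hr.2]
  | succ i ih =>
    obtain ⟨δ, hδ, h⟩ := eventually_abs_sub_le hu hU (i := i + 3) hi hs hε
    refine ⟨δ, hδ, fun t ht hts x hx => ?_⟩
    -- The derivative of `W` at `x` is the quantity to be bounded. Increments of `W` are estimated
    -- by the mean value inequality in time, with the induction hypothesis at the two points `x` and
    -- `y`. The Taylor remainder in space yields a term quadratic in `y - x`, which disappears as `y
    -- → x`.
    refine abs_deriv_le_of_abs_sub_le (A := B * |t - s|) hx
      (W := fun y => dx^[i] (u t) y - dx^[i] (u s) y - (t - s) * dx^[i + 3] (u s) x * y) ?_ ?_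
    · have h1 := ((hU t ht).hasDeriv i (by omega) x hx).fun_sub
        ((hU s hs).hasDeriv i (by omega) x hx)
      simpa using h1.fun_sub
        (((hasDerivAt_id x).const_mul ((t - s) * dx^[i + 3] (u s) x)).hasDerivWithinAt)
    · intro y hy
      have hsub : uIcc s t ⊆ Icc 0 T := (convex_Icc (0 : ℝ) T).ordConnected.uIcc_subset hs ht
      have hder := fun z (hz : z ∈ OmegaBar) r (hr : r ∈ uIcc s t) =>
        (hasDerivWithinAt_of_uniform (fun ε hε => ih (by omega) (hsub hr) hε) hz).mono hsub
      have h1 := (convex_uIcc s t).norm_image_sub_le_of_norm_hasDerivWithin_le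
        (f := fun r => dx^[i] (u r) y - dx^[i] (u r) x - (y - x) * dx^[i + 3] (u s) x * r)
        (f' := fun r => dx^[i + 2] (u r) y - dx^[i + 2] (u r) x - (y - x) * dx^[i + 3] (u s) x)
        (C := B * |y - x| * |y - x| + |y - x| * ε)
        (fun r hr => ((hder y hy r hr).fun_sub (hder x hx r hr)).fun_sub (by
          simpa using
            ((hasDerivAt_id r).const_mul ((y - x) * dx^[i + 3] (u s) x)).hasDerivWithinAt))
        (fun r hr => by
          have hrs : |r - s| < δ := (abs_sub_left_of_mem_uIcc hr).trans_lt hts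
          have h2 := h r (hsub hr) hrs x hx
          have hsub' : uIcc x y ⊆ OmegaBar := convex_OmegaBar.ordConnected.uIcc_subset hx hy
          have h3 := (convex_uIcc x y).norm_image_sub_le_of_norm_hasDerivWithin_le
            (f := fun z => dx^[i + 2] (u r) z - dx^[i + 3] (u r) x * z)
            (f' := fun z => dx^[i + 3] (u r) z - dx^[i + 3] (u r) x) (C := B * |y - x|)
            (fun z hz => (((hU r (hsub hr)).hasDeriv (i + 2) (by omega) z (hsub' hz)).mono
              hsub').fun_sub (by
                simpa using ((hasDerivAt_id z).const_mul (dx^[i + 3] (u r) x)).hasDerivWithinAt))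
            (fun z hz => by
              rw [Real.norm_eq_abs]
              refine ((hU r (hsub hr)).lipschitz_of_le convex_OmegaBar (i := i + 3) hi
                (hsub' hz) hx).trans ?_
              have hB : 0 ≤ B := (abs_nonneg _).trans
                ((hU s hs).bound 0 (Nat.zero_le n) 0 ⟨le_rfl, Real.two_pi_pos.le⟩)
              have := abs_sub_left_of_mem_uIcc hz
              gcongr)
            left_mem_uIcc right_mem_uIcc
          rw [Real.norm_eq_abs] at h3 ⊢
          have e : dx^[i + 2] (u r) y - dx^[i + 2] (u r) x - (y - x) * dx^[i + 3] (u s) x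
              = (dx^[i + 2] (u r) y - dx^[i + 3] (u r) x * y
                  - (dx^[i + 2] (u r) x - dx^[i + 3] (u r) x * x))
                + (y - x) * (dx^[i + 3] (u r) x - dx^[i + 3] (u s) x) := by ring
          rw [e]
          refine (abs_add_le _ _).trans (add_le_add h3 ?_)
          rw [abs_mul]
          exact mul_le_mul_of_nonneg_left h2 (abs_nonneg _))
        left_mem_uIcc right_mem_uIcc
      rw [Real.norm_eq_abs, Real.norm_eq_abs] at h1
      calc _ = |dx^[i] (u t) y - dx^[i] (u t) x - (y - x) * dx^[i + 3] (u s) x * t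
            - (dx^[i] (u s) y - dx^[i] (u s) x - (y - x) * dx^[i + 3] (u s) x * s)| := by
            congr 1; ring
        _ ≤ _ := h1
        _ = _ := by ring

/-- A linear functional on functions on `[a, b]` which is bounded in the supremum norm. -/
structure IsSupFunctional (a b : ℝ) (l : (ℝ → ℝ) → ℝ) : Prop where
  sub : ∀ v w : ℝ → ℝ, ContinuousOn v (Icc a b) → ContinuousOn w (Icc a b) →
    l (fun x => v x - w x) = l v - l w
  const_mul : ∀ (c : ℝ) (v : ℝ → ℝ), l (fun x => c * v x) = c * l v
  bound : ∃ C, 1 ≤ C ∧ ∀ (v : ℝ → ℝ) (S : ℝ), (∀ x ∈ Icc a b, |v x| ≤ S) → |l v| ≤ C * S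

/-- The difference quotients in time converge uniformly in `x`, so any functional bounded in the
supremum norm may be applied to the limit. -/
theorem IsSupFunctional.hasDerivWithinAt {a b : ℝ} {l : (ℝ → ℝ) → ℝ} (hl : IsSupFunctional a b l)
    (hab : Icc a b ⊆ OmegaBar) (hu : IsHeatSolution fl bc T u)
    (hU : ∀ t ∈ Icc 0 T, IsTower n B OmegaBar fun i => dx^[i] (u t)) {i : ℕ} (hi : i + 2 ≤ n)
    {s : ℝ} (hs : s ∈ Icc 0 T) :
    HasDerivWithinAt (fun t => l (dx^[i] (u t))) (l (dx^[i + 2] (u s))) (Icc 0 T) s := by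
  rw [hasDerivWithinAt_iff_isLittleO, Asymptotics.isLittleO_iff]
  intro ε hε
  obtain ⟨C, hC1, hC⟩ := hl.bound
  obtain ⟨δ, hδ, h⟩ := time_deriv_uniform hu hU hi hs (ε := ε / C) (by positivity)
  filter_upwards [self_mem_nhdsWithin, mem_nhdsWithin_of_mem_nhds (Metric.ball_mem_nhds s hδ)]
    with t ht hts
  have h1 := hC _ _ fun x hx =>
    h t ht (by rwa [Metric.mem_ball, Real.dist_eq] at hts) x (hab hx)
  have hc : ∀ j ≤ n, ∀ t ∈ Icc 0 T, ContinuousOn (dx^[j] (u t)) (Icc a b) := fun j hj t ht =>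
    ((hU t ht).continuousOn hj).mono hab
  rw [hl.sub (fun x => dx^[i] (u t) x - dx^[i] (u s) x) (fun x => (t - s) * dx^[i + 2] (u s) x)
    ((hc i (by omega) t ht).sub (hc i (by omega) s hs))
    (continuousOn_const.mul (hc (i + 2) hi s hs)), hl.const_mul,
    hl.sub _ _ (hc i (by omega) t ht) (hc i (by omega) s hs)] at h1
  rw [Real.norm_eq_abs, Real.norm_eq_abs, smul_eq_mul]
  refine h1.trans (le_of_eq ?_)
  field_simp

end TimeRegularity

/-! ### Radau coefficients and moments as bounded functionals -/

theorem isSupFunctional_radauCoeff {k : ℕ} {a b e : ℝ} (hab : a < b) (he : e = a ∨ e = b) :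
    IsSupFunctional a b (radauCoeff k a b e) := by
  refine ⟨fun v w hv hw => radauCoeff_sub hab hv hw, fun c v => ?_, ?_⟩
  · have : ∀ m, legendreCoeff a b (fun x => c * v x) m = c * legendreCoeff a b v m := fun m => by
      simp only [legendreCoeff, mul_assoc, intervalIntegral.integral_const_mul]
      ring
    simp only [radauCoeff, this, mul_assoc, ← Finset.mul_sum]
    ring
  · obtain ⟨C, hC1, hC⟩ := exists_radau_bound k
    exact ⟨C, hC1, fun v S hS => (hC a b e hab he v S hS).1⟩

theorem isSupFunctional_integral {a b : ℝ} (hab : a < b) (p : ℝ[X]) :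
    IsSupFunctional a b fun v => ∫ x in a..b, v x * p.eval x := by
  refine ⟨fun v w hv hw => ?_, fun c v => ?_, ?_⟩
  · simp only [sub_mul]
    exact intervalIntegral.integral_sub (intervalIntegrable_mul_eval hab hv _)
      (intervalIntegrable_mul_eval hab hw _)
  · simp only [mul_assoc, intervalIntegral.integral_const_mul]
  · obtain ⟨P, hP⟩ := isCompact_Icc.exists_bound_of_continuousOn (s := Icc a b)
      p.continuous.continuousOn
    refine ⟨1 + |P| * |b - a|, le_add_of_nonneg_right (by positivity), fun v S hS => ?_⟩
    have hS0 : 0 ≤ S := (abs_nonneg _).trans (hS a (left_mem_Icc.mpr hab.le))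
    have h1 : ‖∫ x in a..b, v x * p.eval x‖ ≤ S * |P| * |b - a| := by
      refine intervalIntegral.norm_integral_le_of_norm_le_const fun x hx => ?_
      rw [uIoc_of_le hab.le] at hx
      have hx' : x ∈ Icc a b := ⟨hx.1.le, hx.2⟩
      rw [norm_mul]
      exact mul_le_mul (hS x hx') ((hP x hx').trans (le_abs_self P)) (norm_nonneg _) hS0
    refine h1.trans ?_
    nlinarith


section Interp

variable {a b e e' : ℝ} {k : ℕ}

/-! ### The corrected interpolants -/

/-- The Gauss-Radau projection of `f 0`, with two correction steps; `f i` stands for the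
`i`-th derivative in space. -/
def interp (k : ℕ) (a b e e' : ℝ) (f : ℕ → ℝ → ℝ) : ℝ[X] :=
  radauFormula k a b e (f 0)
    - (C ((b - a) / 2 * radauCoeff k a b e' (f 1)) * corrector k a b e (cellPoly a b k)
      + C (((b - a) / 2) ^ 2 * radauCoeff k a b e (f 2))
        * corrector k a b e (corrector k a b e' (cellPoly a b k)))

theorem natDegree_interp_le (hab : a < b) (f : ℕ → ℝ → ℝ) :
    (interp k a b e e' f).natDegree ≤ k := by
  refine (natDegree_sub_le _ _).trans (max_le (natDegree_radauFormula_le hab _) ?_)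
  refine (natDegree_add_le _ _).trans (max_le ?_ ?_) <;>
  exact (natDegree_C_mul_le _ _).trans (natDegree_corrector_le hab _)

theorem eval_interp_end (hk : 2 ≤ k) (hab : a < b) (he : e = a ∨ e = b) (he' : e' = a ∨ e' = b)
    {f : ℕ → ℝ → ℝ} (hf : ContinuousOn (f 0) (Icc a b)) :
    (interp k a b e e' f).eval e = f 0 e := by
  rw [interp, eval_sub, eval_add, eval_mul, eval_mul,
    eval_corrector_end hab he (integral_cellPoly_eq_zero (by omega) hab),
    eval_corrector_end hab he (integral_corrector_cellPoly_eq_zero hk hab he'),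
    (isRadauProj_radauFormula hab he hf).2.2]
  ring

/-- Against polynomials of degree at most `k`, the projection differs from `v` only in its `L_k`
moment. This term is the residual that the correctors remove. -/
theorem integral_radauFormula_mul (hab : a < b) {v : ℝ → ℝ} (hv : ContinuousOn v (Icc a b))
    {w : ℝ[X]} (hw : w.natDegree ≤ k) :
    ∫ x in a..b, (radauFormula k a b e v).eval x * w.eval x
      = (∫ x in a..b, v x * w.eval x)
        - radauCoeff k a b e v * ∫ x in a..b, (cellPoly a b k).eval x * w.eval x := by
  have hL : ContinuousOn (fun x => radauCoeff k a b e v * (cellPoly a b k).eval x) (Icc a b) :=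
    by fun_prop
  have h := integral_mul_eval_congr (k := k) hab (radauFormula k a b e v).continuousOn
    (g := fun x => v x - radauCoeff k a b e v * (cellPoly a b k).eval x) (hv.sub hL)
    (fun m hm => by
      rw [integral_radauFormula_mul_cellPoly hab v hm]
      simp only [sub_mul]
      rw [intervalIntegral.integral_sub (intervalIntegrable_mul_eval hab hv _)
        (intervalIntegrable_mul_eval hab hL _)]
      simp only [mul_assoc, intervalIntegral.integral_const_mul, integral_cellPoly_mul_cellPoly hab,
        eq_comm (a := k)]
      split_ifs <;> simp) hw
  rw [h]
  simp only [sub_mul]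
  rw [intervalIntegral.integral_sub (intervalIntegrable_mul_eval hab hv _)
    (intervalIntegrable_mul_eval hab hL _)]
  simp only [mul_assoc, intervalIntegral.integral_const_mul]

theorem integral_interp_mul_eq (f : ℕ → ℝ → ℝ) (w : ℝ[X]) :
    ∫ x in a..b, (interp k a b e e' f).eval x * w.eval x
      = (∫ x in a..b, (radauFormula k a b e (f 0)).eval x * w.eval x)
        - (b - a) / 2 * radauCoeff k a b e' (f 1)
          * (∫ x in a..b, (corrector k a b e (cellPoly a b k)).eval x * w.eval x)
        - ((b - a) / 2) ^ 2 * radauCoeff k a b e (f 2)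
          * ∫ x in a..b, (corrector k a b e (corrector k a b e' (cellPoly a b k))).eval x
            * w.eval x := by
  have e1 : ∀ x, (interp k a b e e' f).eval x * w.eval x
      = (radauFormula k a b e (f 0)).eval x * w.eval x
        - (b - a) / 2 * radauCoeff k a b e' (f 1)
          * ((corrector k a b e (cellPoly a b k)).eval x * w.eval x)
        - ((b - a) / 2) ^ 2 * radauCoeff k a b e (f 2)
          * ((corrector k a b e (corrector k a b e' (cellPoly a b k))).eval x * w.eval x) :=
    fun x => by
      simp only [interp, eval_sub, eval_add, eval_mul, eval_C]
      ring
  simp only [e1]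
  rw [intervalIntegral.integral_sub (Continuous.intervalIntegrable (by fun_prop) _ _)
      (Continuous.intervalIntegrable (by fun_prop) _ _),
    intervalIntegral.integral_sub (Continuous.intervalIntegrable (by fun_prop) _ _)
      (Continuous.intervalIntegrable (by fun_prop) _ _),
    intervalIntegral.integral_const_mul, intervalIntegral.integral_const_mul]

theorem integral_interp_mul (hab : a < b) {f : ℕ → ℝ → ℝ} (hf : ContinuousOn (f 0) (Icc a b))
    {w : ℝ[X]} (hw : w.natDegree ≤ k) :
    ∫ x in a..b, (interp k a b e e' f).eval x * w.eval x
      = (∫ x in a..b, f 0 x * w.eval x)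
        - radauCoeff k a b e (f 0) * (∫ x in a..b, (cellPoly a b k).eval x * w.eval x)
        - (b - a) / 2 * radauCoeff k a b e' (f 1)
          * (∫ x in a..b, (corrector k a b e (cellPoly a b k)).eval x * w.eval x)
        - ((b - a) / 2) ^ 2 * radauCoeff k a b e (f 2)
          * ∫ x in a..b, (corrector k a b e (corrector k a b e' (cellPoly a b k))).eval x
            * w.eval x := by
  rw [integral_interp_mul_eq, integral_radauFormula_mul hab hf hw]

theorem integral_mul_derivative_of_hasDerivWithinAt (hab : a < b) {f f' : ℝ → ℝ}
    (hf : ∀ x ∈ Icc a b, HasDerivWithinAt f (f' x) (Icc a b) x) (hf' : ContinuousOn f' (Icc a b))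
    (w : ℝ[X]) :
    ∫ x in a..b, f x * (derivative w).eval x
      = f b * w.eval b - f a * w.eval a - ∫ x in a..b, f' x * w.eval x := by
  have hI : uIcc a b = Icc a b := uIcc_of_le hab.le
  refine intervalIntegral.integral_mul_deriv_eq_deriv_mul_of_hasDerivWithinAt
    (by rwa [hI]) (fun x _ => (w.hasDerivAt x).hasDerivWithinAt)
    (ContinuousOn.intervalIntegrable (by rwa [hI])) (intervalIntegrable_eval _ _ _)

/-- The consistency identity of the corrected interpolants. -/
theorem interp_consistency (hk : 2 ≤ k) (hab : a < b) (he : e = a ∨ e = b) (he' : e' = a ∨ e' = b)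
    {f : ℕ → ℝ → ℝ} (hf : ∀ x ∈ Icc a b, HasDerivWithinAt (f 0) (f 1 x) (Icc a b) x)
    (hf1 : ContinuousOn (f 1) (Icc a b)) {w : ℝ[X]} (hw : w.natDegree ≤ k) :
    -(∫ x in a..b, (interp k a b e e' f).eval x * (derivative w).eval x)
        + f 0 b * w.eval b - f 0 a * w.eval a
      = (∫ x in a..b, (interp k a b e' e fun i => f (i + 1)).eval x * w.eval x)
        + ((b - a) / 2) ^ 2 * radauCoeff k a b e' (f 3)
          * ∫ x in a..b, (corrector k a b e' (corrector k a b e (cellPoly a b k))).eval x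
            * w.eval x := by
  have hf0 : ContinuousOn (f 0) (Icc a b) := fun x hx => (hf x hx).continuousWithinAt
  have hne : b - a ≠ 0 := by linarith
  -- The boundary terms cancel those of the integration by parts. On the left each corrector is
  -- lowered by one level, matching a term of the shifted interpolant on the right; only the
  -- top-level term of the latter remains.
  rw [integral_interp_mul (f := fun i => f (i + 1)) hab hf1 hw, integral_interp_mul_eq,
    (isRadauProj_radauFormula hab he hf0).2.1 _
      (degree_derivative_lt_of_natDegree_le (by omega) hw),
    integral_mul_derivative_of_hasDerivWithinAt hab hf hf1,
    integral_corrector_mul_derivative (by omega) hab he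
      (integral_cellPoly_eq_zero (by omega) hab) hw,
    integral_corrector_mul_derivative (by omega) hab he
      (integral_corrector_cellPoly_eq_zero hk hab he') hw]
  simp only [zero_add, Nat.reduceAdd]
  field_simp
  ring

/-- The prescribed initial value contains the time derivative of a Radau coefficient. By `hd` it is
the coefficient of `u_xx`, so the initial value belongs to the family of interpolants built from
space derivatives alone. -/
theorem interpolant_eq (hab : a < b) {fl : Flux} {T : ℝ} {u : ℝ → ℝ → ℝ} {t : ℝ}
    (hc : ∀ s ∈ Icc 0 T, ContinuousOn (u s) (Icc a b)) (ht : t ∈ Icc 0 T)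
    (hc1 : ContinuousOn (dx (u t)) (Icc a b))
    (hd : ∀ e, (e = a ∨ e = b) → derivWithin (fun s => radauCoeff k a b e (u s)) (Icc 0 T) t
      = radauCoeff k a b e (dx^[2] (u t))) :
    interpolant k fl T u t a b = match fl with
      | .minusPlus => interp k a b b a fun i => dx^[i] (u t)
      | .plusMinus => interp k a b a b fun i => dx^[i] (u t) := by
  cases fl with
  | minusPlus =>
    have h1 : derivWithin (fun s => coeffMinus k a b (u s)) (Icc 0 T) t
        = radauCoeff k a b b (dx^[2] (u t)) := by
      rw [← hd b (Or.inr rfl)]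
      exact derivWithin_congr (fun s hs => coeffMinus_eq hab (hc s hs))
        (coeffMinus_eq hab (hc t ht))
    simp only [interpolant, interp]
    rw [h1, coeffPlus_eq hab hc1, F₁bar_eq hab, F₂_eq hab,
      radauProj_eq hab (Or.inr rfl) (hc t ht)]
    simp only [Function.iterate_zero, id, Function.iterate_one]
    ring
  | plusMinus =>
    have h1 : derivWithin (fun s => coeffPlus k a b (u s)) (Icc 0 T) t
        = radauCoeff k a b a (dx^[2] (u t)) := by
      rw [← hd a (Or.inl rfl)]
      exact derivWithin_congr (fun s hs => coeffPlus_eq hab (hc s hs))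
        (coeffPlus_eq hab (hc t ht))
    simp only [interpolant, interp]
    rw [h1, coeffMinus_eq hab hc1, F₂bar_eq hab, F₁_eq hab,
      radauProj_eq hab (Or.inl rfl) (hc t ht)]
    simp only [Function.iterate_zero, id, Function.iterate_one]

end Interp

/-! ### The discrete operators -/

theorem sum_succ_sub_castSucc {n : ℕ} (a : Fin (n + 2) → ℝ) :
    ∑ j : Fin (n + 1), (a j.succ - a j.castSucc) = a (Fin.last (n + 1)) - a 0 := by
  have h1 := Fin.sum_univ_succ a
  have h2 := Fin.sum_univ_castSucc a
  rw [Finset.sum_sub_distrib]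
  linarith

namespace Mesh

variable (M : Mesh) {k : ℕ}

theorem left_lt_right (j : Fin (M.n + 1)) : M.left j < M.right j :=
  M.strictMono (Fin.castSucc_lt_succ)

theorem width_pos (j : Fin (M.n + 1)) : 0 < M.width j := sub_pos.mpr (M.left_lt_right j)

theorem left_zero : M.left 0 = 0 := M.node_zero

theorem right_last : M.right (Fin.last M.n) = 2 * Real.pi := by
  rw [right, Fin.succ_last, M.node_last]

theorem cell_subset (j : Fin (M.n + 1)) : Icc (M.left j) (M.right j) ⊆ OmegaBar := by
  refine Icc_subset_Icc ?_ ?_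
  · rw [← M.node_zero]
    exact M.strictMono.monotone (Fin.zero_le _)
  · rw [← M.node_last]
    exact M.strictMono.monotone (Fin.le_last _)

theorem width_le_h (j : Fin (M.n + 1)) : M.width j ≤ M.h :=
  Finset.le_sup' M.width (Finset.mem_univ j)

theorem h_pos : 0 < M.h := (M.width_pos 0).trans_le (M.width_le_h 0)

theorem sum_width : ∑ j, M.width j = 2 * Real.pi := by
  have := sum_succ_sub_castSucc M.node
  rw [M.node_last, M.node_zero, sub_zero] at this
  exact this

theorem h_le : M.h ≤ 2 * Real.pi := by
  refine Finset.sup'_le _ _ fun j _ => ?_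
  rw [← M.sum_width]
  exact Finset.single_le_sum (fun j _ => (M.width_pos j).le) (Finset.mem_univ j)

/-- The `L²`-normalized Legendre polynomials on the cells. -/
def basisPoly (j : Fin (M.n + 1)) (m : ℕ) : ℝ[X] :=
  C (√((2 * m + 1) / M.width j)) * cellPoly (M.left j) (M.right j) m

theorem natDegree_basisPoly_le (j : Fin (M.n + 1)) (m : ℕ) : (M.basisPoly j m).natDegree ≤ m :=
  (natDegree_C_mul_le _ _).trans (natDegree_cellPoly (M.left_lt_right j) m).le

/-- The space of coordinates of piecewise polynomials of degree at most `k`. -/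
abbrev CoordSpace (k : ℕ) : Type := EuclideanSpace ℝ (Fin (M.n + 1) × Fin (k + 1))

/-- The coordinates with respect to `basisPoly`. -/
def coords (k : ℕ) (p : M.PiecewisePoly) : M.CoordSpace k :=
  WithLp.toLp 2 fun i => ∫ x in (M.left i.1)..(M.right i.1),
    (p i.1).eval x * (M.basisPoly i.1 i.2).eval x

theorem coords_apply (p : M.PiecewisePoly) (i : Fin (M.n + 1) × Fin (k + 1)) :
    M.coords k p i = ∫ x in (M.left i.1)..(M.right i.1),
      (p i.1).eval x * (M.basisPoly i.1 i.2).eval x := rfl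

/-- The piecewise polynomial with given coordinates. -/
def toPoly (c : M.CoordSpace k) : M.PiecewisePoly :=
  fun j => ∑ m : Fin (k + 1), C (c (j, m)) * M.basisPoly j m

theorem toPoly_coords {p : M.PiecewisePoly} (hp : ∀ j, (p j).natDegree ≤ k) :
    M.toPoly (M.coords k p) = p := by
  ext1 j
  conv_rhs => rw [eq_sum_legendreCoeff (M.left_lt_right j) (hp j)]
  rw [toPoly, ← Fin.sum_univ_eq_sum_range (fun m => C (legendreCoeff (M.left j) (M.right j)
    (fun x => (p j).eval x) m) * cellPoly (M.left j) (M.right j) m)]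
  refine Finset.sum_congr rfl fun m _ => ?_
  rw [coords_apply, basisPoly, ← mul_assoc, ← C_mul]
  congr 2
  have hw := M.width_pos j
  simp only [eval_mul, eval_C, mul_left_comm _ (√_), intervalIntegral.integral_const_mul]
  rw [mul_comm, ← mul_assoc, Real.mul_self_sqrt (by positivity)]
  rfl

theorem toPoly_add (c d : M.CoordSpace k) (j : Fin (M.n + 1)) :
    M.toPoly (c + d) j = M.toPoly c j + M.toPoly d j := by
  simp only [toPoly, PiLp.add_apply, C_add, add_mul, Finset.sum_add_distrib]

theorem toPoly_smul (s : ℝ) (c : M.CoordSpace k) (j : Fin (M.n + 1)) :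
    M.toPoly (s • c) j = C s * M.toPoly c j := by
  simp only [toPoly, PiLp.smul_apply, smul_eq_mul, C_mul, mul_assoc, Finset.mul_sum]

/-- The bilinear form of the scheme on the cell `j`, with given values at the nodes. -/
def cellForm (F : Fin (M.n + 2) → ℝ) (p : ℝ[X]) (j : Fin (M.n + 1)) (w : ℝ[X]) : ℝ :=
  -(∫ x in (M.left j)..(M.right j), p.eval x * (derivative w).eval x)
    + F j.succ * w.eval (M.right j) - F j.castSucc * w.eval (M.left j)

theorem cellForm_add (F G : Fin (M.n + 2) → ℝ) (p q : ℝ[X]) (j : Fin (M.n + 1)) (w : ℝ[X]) :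
    M.cellForm (fun i => F i + G i) (p + q) j w = M.cellForm F p j w + M.cellForm G q j w := by
  simp only [cellForm, eval_add, add_mul]
  rw [intervalIntegral.integral_add (Continuous.intervalIntegrable (by fun_prop) _ _)
    (Continuous.intervalIntegrable (by fun_prop) _ _)]
  ring

theorem cellForm_sub (F G : Fin (M.n + 2) → ℝ) (p q : ℝ[X]) (j : Fin (M.n + 1)) (w : ℝ[X]) :
    M.cellForm (fun i => F i - G i) (p - q) j w = M.cellForm F p j w - M.cellForm G q j w := by
  simp only [cellForm, eval_sub, sub_mul]
  rw [intervalIntegral.integral_sub (Continuous.intervalIntegrable (by fun_prop) _ _)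
    (Continuous.intervalIntegrable (by fun_prop) _ _)]
  ring

theorem cellForm_smul (s : ℝ) (F : Fin (M.n + 2) → ℝ) (p : ℝ[X]) (j : Fin (M.n + 1)) (w : ℝ[X]) :
    M.cellForm (fun i => s * F i) (C s * p) j w = s * M.cellForm F p j w := by
  simp only [cellForm, eval_mul, eval_C, mul_assoc, intervalIntegral.integral_const_mul]
  ring

theorem cellForm_sum (F : Fin (M.n + 2) → ℝ) (p : ℝ[X]) (j : Fin (M.n + 1)) (c : Fin (k + 1) → ℝ)
    (w : Fin (k + 1) → ℝ[X]) :
    M.cellForm F p j (∑ m, C (c m) * w m) = ∑ m, c m * M.cellForm F p j (w m) := by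
  have e : ∀ x, p.eval x * (derivative (∑ m, C (c m) * w m)).eval x
      = ∑ m, c m * (p.eval x * (derivative (w m)).eval x) := fun x => by
    rw [derivative_sum, eval_finsetSum, Finset.mul_sum]
    refine Finset.sum_congr rfl fun m _ => ?_
    rw [derivative_C_mul, eval_mul, eval_C]
    ring
  simp only [cellForm, e, eval_finsetSum, eval_mul, eval_C]
  rw [intervalIntegral.integral_finsetSum fun m _ =>
    Continuous.intervalIntegrable (by fun_prop) _ _]
  simp only [intervalIntegral.integral_const_mul, mul_add, mul_sub, Finset.sum_add_distrib,
    Finset.sum_sub_distrib, mul_neg, Finset.sum_neg_distrib, Finset.mul_sum]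
  congr 1
  · congr 1
    exact Finset.sum_congr rfl fun m _ => by ring
  · exact Finset.sum_congr rfl fun m _ => by ring

theorem traceMinus_succ (v : M.PiecewisePoly) (β : ℝ) (j : Fin (M.n + 1)) :
    M.traceMinus v β j.succ = (v j).eval (M.right j) := rfl

theorem traceMinus_zero (v : M.PiecewisePoly) (β : ℝ) : M.traceMinus v β 0 = β := rfl

theorem tracePlus_castSucc (v : M.PiecewisePoly) (β : ℝ) (j : Fin (M.n + 1)) :
    M.tracePlus v β j.castSucc = (v j).eval (M.left j) := by
  simp [tracePlus]

theorem tracePlus_last (v : M.PiecewisePoly) (β : ℝ) :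
    M.tracePlus v β (Fin.last (M.n + 1)) = β := by
  simp [tracePlus]

theorem traceMinus_eq {v : M.PiecewisePoly} {β : ℝ} {f : ℝ → ℝ} (hβ : β = f 0)
    (hv : ∀ j, (v j).eval (M.right j) = f (M.right j)) (i : Fin (M.n + 2)) :
    M.traceMinus v β i = f (M.node i) := by
  cases i using Fin.cases with
  | zero => rw [traceMinus_zero, hβ, M.node_zero]
  | succ j => rw [traceMinus_succ, hv]; rfl

theorem tracePlus_eq {v : M.PiecewisePoly} {β : ℝ} {f : ℝ → ℝ} (hβ : β = f (2 * Real.pi))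
    (hv : ∀ j, (v j).eval (M.left j) = f (M.left j)) (i : Fin (M.n + 2)) :
    M.tracePlus v β i = f (M.node i) := by
  cases i using Fin.lastCases with
  | last => rw [tracePlus_last, hβ, M.node_last]
  | cast j => rw [tracePlus_castSucc, hv]; rfl

theorem traceMinus_sub (v w : M.PiecewisePoly) (β γ : ℝ) (i : Fin (M.n + 2)) :
    M.traceMinus v β i - M.traceMinus w γ i = M.traceMinus (fun j => v j - w j) (β - γ) i := by
  cases i using Fin.cases with
  | zero => simp only [traceMinus_zero]
  | succ j => simp only [traceMinus_succ, eval_sub]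

theorem tracePlus_sub (v w : M.PiecewisePoly) (β γ : ℝ) (i : Fin (M.n + 2)) :
    M.tracePlus v β i - M.tracePlus w γ i = M.tracePlus (fun j => v j - w j) (β - γ) i := by
  cases i using Fin.lastCases with
  | last => simp only [tracePlus_last]
  | cast j => simp only [tracePlus_castSucc, eval_sub]

theorem traceMinus_add (v w : M.PiecewisePoly) (β γ : ℝ) (i : Fin (M.n + 2)) :
    M.traceMinus (fun j => v j + w j) (β + γ) i = M.traceMinus v β i + M.traceMinus w γ i := by
  cases i using Fin.cases with
  | zero => simp only [traceMinus_zero]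
  | succ j => simp only [traceMinus_succ, eval_add]

theorem tracePlus_add (v w : M.PiecewisePoly) (β γ : ℝ) (i : Fin (M.n + 2)) :
    M.tracePlus (fun j => v j + w j) (β + γ) i = M.tracePlus v β i + M.tracePlus w γ i := by
  cases i using Fin.lastCases with
  | last => simp only [tracePlus_last]
  | cast j => simp only [tracePlus_castSucc, eval_add]

theorem traceMinus_smul (s : ℝ) (v : M.PiecewisePoly) (β : ℝ) (i : Fin (M.n + 2)) :
    M.traceMinus (fun j => C s * v j) (s * β) i = s * M.traceMinus v β i := by
  cases i using Fin.cases with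
  | zero => simp only [traceMinus_zero]
  | succ j => simp only [traceMinus_succ, eval_mul, eval_C]

theorem tracePlus_smul (s : ℝ) (v : M.PiecewisePoly) (β : ℝ) (i : Fin (M.n + 2)) :
    M.tracePlus (fun j => C s * v j) (s * β) i = s * M.tracePlus v β i := by
  cases i using Fin.lastCases with
  | last => simp only [tracePlus_last]
  | cast j => simp only [tracePlus_castSucc, eval_mul, eval_C]

/-- Summation by parts: the two operators with opposite traces are negative adjoints. -/
theorem sum_cellForm_add_sum_cellForm (p r : M.PiecewisePoly) {β γ : ℝ}
    (h : γ * (p (Fin.last M.n)).eval (2 * Real.pi) = β * (r 0).eval 0) :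
    ∑ j, M.cellForm (M.traceMinus p β) (p j) j (r j)
      + ∑ j, M.cellForm (M.tracePlus r γ) (r j) j (p j) = 0 := by
  have h1 := sum_succ_sub_castSucc fun i => M.tracePlus r γ i * M.traceMinus p β i
  have h2 : M.tracePlus r γ 0 = (r 0).eval 0 := by
    have := M.tracePlus_castSucc r γ 0
    rwa [Fin.castSucc_zero, M.left_zero] at this
  have h3 : M.traceMinus p β (Fin.last (M.n + 1)) = (p (Fin.last M.n)).eval (2 * Real.pi) := by
    rw [← Fin.succ_last, M.traceMinus_succ, M.right_last]
  simp only [M.tracePlus_last, M.traceMinus_zero, h2, h3] at h1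
  rw [h, mul_comm β, sub_self] at h1
  rw [← Finset.sum_add_distrib, ← h1]
  refine Finset.sum_congr rfl fun j _ => ?_
  have h4 := integral_eval_mul_derivative (p j) (r j) (M.left j) (M.right j)
  have h5 : ∫ x in (M.left j)..(M.right j), (derivative (p j)).eval x * (r j).eval x
      = ∫ x in (M.left j)..(M.right j), (r j).eval x * (derivative (p j)).eval x := by
    congr 1; ext x; ring
  rw [h5] at h4
  simp only [cellForm, traceMinus_succ, tracePlus_castSucc]
  rw [h4]
  ring

end Mesh

/-- The boundary condition with zero data. -/
def BoundaryCondition.homog : BoundaryCondition → BoundaryCondition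
  | .periodic => .periodic
  | .mixed _ _ => .mixed (fun _ => 0) (fun _ => 0)

/-! ### Fluxes with zero boundary data and the discrete derivatives -/

section FluxOps

variable (M : Mesh) {k : ℕ} (fl : Flux) (bc : BoundaryCondition)

theorem firstValue_sub (t : ℝ) (v w : M.PiecewisePoly) :
    M.firstValue v (bc.firstDatum t) - M.firstValue w (bc.firstDatum t)
      = M.firstValue (fun j => v j - w j) (bc.homog.firstDatum 0) := by
  cases bc <;> simp [Mesh.firstValue, BoundaryCondition.firstDatum, BoundaryCondition.homog]

theorem lastValue_sub (t : ℝ) (v w : M.PiecewisePoly) :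
    M.lastValue v (bc.lastDatum t) - M.lastValue w (bc.lastDatum t)
      = M.lastValue (fun j => v j - w j) (bc.homog.lastDatum 0) := by
  cases bc <;> simp [Mesh.lastValue, BoundaryCondition.lastDatum, BoundaryCondition.homog]

theorem firstValue_add (v w : M.PiecewisePoly) :
    M.firstValue (fun j => v j + w j) (bc.homog.firstDatum 0)
      = M.firstValue v (bc.homog.firstDatum 0) + M.firstValue w (bc.homog.firstDatum 0) := by
  cases bc <;> simp [Mesh.firstValue, BoundaryCondition.firstDatum, BoundaryCondition.homog]

theorem lastValue_add (v w : M.PiecewisePoly) :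
    M.lastValue (fun j => v j + w j) (bc.homog.lastDatum 0)
      = M.lastValue v (bc.homog.lastDatum 0) + M.lastValue w (bc.homog.lastDatum 0) := by
  cases bc <;> simp [Mesh.lastValue, BoundaryCondition.lastDatum, BoundaryCondition.homog]

theorem firstValue_smul (s : ℝ) (v : M.PiecewisePoly) :
    M.firstValue (fun j => C s * v j) (bc.homog.firstDatum 0)
      = s * M.firstValue v (bc.homog.firstDatum 0) := by
  cases bc <;> simp [Mesh.firstValue, BoundaryCondition.firstDatum, BoundaryCondition.homog]

theorem lastValue_smul (s : ℝ) (v : M.PiecewisePoly) :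
    M.lastValue (fun j => C s * v j) (bc.homog.lastDatum 0)
      = s * M.lastValue v (bc.homog.lastDatum 0) := by
  cases bc <;> simp [Mesh.lastValue, BoundaryCondition.lastDatum, BoundaryCondition.homog]

/-- Two functions with the same boundary data differ by one with zero data, which no longer depends
on time; the time `0` on the right is arbitrary. -/
theorem uFlux_sub (t : ℝ) (v w : M.PiecewisePoly) :
    (fun i => uFlux M fl bc t v i - uFlux M fl bc t w i)
      = uFlux M fl bc.homog 0 fun j => v j - w j := by
  ext i
  cases fl <;> simp only [uFlux, Mesh.traceMinus_sub, Mesh.tracePlus_sub, firstValue_sub,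
    lastValue_sub]

theorem qFlux_sub (t : ℝ) (v w : M.PiecewisePoly) :
    (fun i => qFlux M fl bc t v i - qFlux M fl bc t w i)
      = qFlux M fl bc.homog 0 fun j => v j - w j := by
  ext i
  cases fl <;> simp only [qFlux, Mesh.traceMinus_sub, Mesh.tracePlus_sub, firstValue_sub,
    lastValue_sub]

theorem uFlux_add (v w : M.PiecewisePoly) :
    uFlux M fl bc.homog 0 (fun j => v j + w j)
      = fun i => uFlux M fl bc.homog 0 v i + uFlux M fl bc.homog 0 w i := by
  ext i
  cases fl <;> simp only [uFlux, firstValue_add, lastValue_add, Mesh.traceMinus_add,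
    Mesh.tracePlus_add]

theorem qFlux_add (v w : M.PiecewisePoly) :
    qFlux M fl bc.homog 0 (fun j => v j + w j)
      = fun i => qFlux M fl bc.homog 0 v i + qFlux M fl bc.homog 0 w i := by
  ext i
  cases fl <;> simp only [qFlux, firstValue_add, lastValue_add, Mesh.traceMinus_add,
    Mesh.tracePlus_add]

theorem uFlux_smul (s : ℝ) (v : M.PiecewisePoly) :
    uFlux M fl bc.homog 0 (fun j => C s * v j) = fun i => s * uFlux M fl bc.homog 0 v i := by
  ext i
  cases fl <;> simp only [uFlux, firstValue_smul, lastValue_smul, Mesh.traceMinus_smul,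
    Mesh.tracePlus_smul]

theorem qFlux_smul (s : ℝ) (v : M.PiecewisePoly) :
    qFlux M fl bc.homog 0 (fun j => C s * v j) = fun i => s * qFlux M fl bc.homog 0 v i := by
  ext i
  cases fl <;> simp only [qFlux, firstValue_smul, lastValue_smul, Mesh.traceMinus_smul,
    Mesh.tracePlus_smul]

/-- The discrete spatial derivative with the flux `û`, for zero boundary data. -/
def uOp (k : ℕ) : M.CoordSpace k →ₗ[ℝ] M.CoordSpace k where
  toFun c := WithLp.toLp 2 fun i => M.cellForm (uFlux M fl bc.homog 0 (M.toPoly c)) (M.toPoly c i.1)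
    i.1 (M.basisPoly i.1 i.2)
  map_add' c d := by
    ext i
    have h : M.toPoly (c + d) = fun j => M.toPoly c j + M.toPoly d j :=
      funext fun j => M.toPoly_add c d j
    simp only [h, uFlux_add, Mesh.cellForm_add, PiLp.add_apply]
  map_smul' s c := by
    ext i
    have h : M.toPoly (s • c) = fun j => C s * M.toPoly c j :=
      funext fun j => M.toPoly_smul s c j
    simp only [h, uFlux_smul, Mesh.cellForm_smul, PiLp.smul_apply, smul_eq_mul, RingHom.id_apply]

/-- The discrete spatial derivative with the flux `q̂`, for zero boundary data. -/
def qOp (k : ℕ) : M.CoordSpace k →ₗ[ℝ] M.CoordSpace k where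
  toFun c := WithLp.toLp 2 fun i => M.cellForm (qFlux M fl bc.homog 0 (M.toPoly c)) (M.toPoly c i.1)
    i.1 (M.basisPoly i.1 i.2)
  map_add' c d := by
    ext i
    have h : M.toPoly (c + d) = fun j => M.toPoly c j + M.toPoly d j :=
      funext fun j => M.toPoly_add c d j
    simp only [h, qFlux_add, Mesh.cellForm_add, PiLp.add_apply]
  map_smul' s c := by
    ext i
    have h : M.toPoly (s • c) = fun j => C s * M.toPoly c j :=
      funext fun j => M.toPoly_smul s c j
    simp only [h, qFlux_smul, Mesh.cellForm_smul, PiLp.smul_apply, smul_eq_mul, RingHom.id_apply]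

theorem uOp_apply (c : M.CoordSpace k) (i : Fin (M.n + 1) × Fin (k + 1)) :
    uOp M fl bc k c i = M.cellForm (uFlux M fl bc.homog 0 (M.toPoly c)) (M.toPoly c i.1)
      i.1 (M.basisPoly i.1 i.2) := rfl

theorem qOp_apply (c : M.CoordSpace k) (i : Fin (M.n + 1) × Fin (k + 1)) :
    qOp M fl bc k c i = M.cellForm (qFlux M fl bc.homog 0 (M.toPoly c)) (M.toPoly c i.1)
      i.1 (M.basisPoly i.1 i.2) := rfl

open scoped InnerProductSpace

theorem inner_uOp (c d : M.CoordSpace k) : ⟪uOp M fl bc k c, d⟫_ℝ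
    = ∑ j, M.cellForm (uFlux M fl bc.homog 0 (M.toPoly c)) (M.toPoly c j) j (M.toPoly d j) := by
  rw [PiLp.inner_apply, Fintype.sum_prod_type]
  refine Finset.sum_congr rfl fun j _ => ?_
  rw [Mesh.toPoly, Mesh.toPoly, Mesh.cellForm_sum]
  exact Finset.sum_congr rfl fun m _ => rfl

theorem inner_qOp (c d : M.CoordSpace k) : ⟪qOp M fl bc k c, d⟫_ℝ
    = ∑ j, M.cellForm (qFlux M fl bc.homog 0 (M.toPoly c)) (M.toPoly c j) j (M.toPoly d j) := by
  rw [PiLp.inner_apply, Fintype.sum_prod_type]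
  refine Finset.sum_congr rfl fun j _ => ?_
  rw [Mesh.toPoly, Mesh.toPoly, Mesh.cellForm_sum]
  exact Finset.sum_congr rfl fun m _ => rfl

/-- The boundary terms of summation by parts: in the periodic case the two products agree, in the
mixed case both are zero. -/
theorem lastValue_mul_eq (p r : M.PiecewisePoly) :
    M.lastValue r (bc.homog.lastDatum 0) * (p (Fin.last M.n)).eval (2 * Real.pi)
      = M.firstValue p (bc.homog.firstDatum 0) * (r 0).eval 0 := by
  cases bc <;> simp [Mesh.firstValue, BoundaryCondition.firstDatum, BoundaryCondition.homog,
    Mesh.lastValue, BoundaryCondition.lastDatum, mul_comm]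

/-- The fluxes take opposite one-sided limits, so summation by parts over the mesh leaves no jump
terms. This gives the error equations their `N`, `N†` structure. -/
theorem adjoint_uOp : LinearMap.adjoint (uOp M fl bc k) = -qOp M fl bc k := by
  symm
  rw [LinearMap.eq_adjoint_iff]
  intro d c
  rw [LinearMap.neg_apply, inner_neg_left, inner_qOp, ← real_inner_comm d, inner_uOp,
    neg_eq_iff_add_eq_zero]
  cases fl with
  | minusPlus =>
    have := M.sum_cellForm_add_sum_cellForm (M.toPoly c) (M.toPoly d)
      (lastValue_mul_eq M bc (M.toPoly c) (M.toPoly d))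
    rw [add_comm]
    exact this
  | plusMinus =>
    exact M.sum_cellForm_add_sum_cellForm (M.toPoly d) (M.toPoly c)
      (lastValue_mul_eq M bc (M.toPoly d) (M.toPoly c))

end FluxOps

/-! ### Norm estimates -/

/-- The coordinates are those of an orthonormal basis, and the cell lengths add up to `2π`, whence
the first bound. For the inverse inequality, normalization contributes `width^{-1/2}` and
differentiation `width^{-1}`. -/
theorem exists_coords_bound (k : ℕ) : ∃ D : ℝ, 1 ≤ D ∧ ∀ (M : Mesh),
    (∀ (p : M.PiecewisePoly) (S : ℝ), 0 ≤ S →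
      (∀ j, ∀ x ∈ Icc (M.left j) (M.right j), |(p j).eval x| ≤ S) → ‖M.coords k p‖ ≤ D * S) ∧
    ∀ (c : M.CoordSpace k) (j : Fin (M.n + 1)), ∀ x ∈ Icc (M.left j) (M.right j),
      |(derivative (M.toPoly c j)).eval x| ≤ D * ‖c‖ / (M.width j * √(M.width j)) := by
  obtain ⟨Λ, hC1, hC⟩ := exists_legendre_bound k
  set A := √(2 * (k : ℝ) + 1) * Λ with hA
  have hA1 : 1 ≤ A := one_le_mul_of_one_le_of_one_le (Real.one_le_sqrt.mpr (by
    have : (0 : ℝ) ≤ k := by positivity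
    linarith)) hC1
  -- The factor `7` serves both bounds: `7²` exceeds `2π`, and `7` exceeds the `2` from the affine
  -- map.
  set D := ((k : ℝ) + 1) * A * 7 with hD
  have hk1 : (1 : ℝ) ≤ (k : ℝ) + 1 := le_add_of_nonneg_left (by positivity)
  refine ⟨D, ?_, fun M => ⟨fun p S hS hp => ?_, fun c j x hx => ?_⟩⟩
  · have := one_le_mul_of_one_le_of_one_le hk1 hA1
    linarith
  all_goals
    have hbasis : ∀ j, ∀ m ≤ k, √((2 * (m : ℝ) + 1) / M.width j) * Λ ≤ A / √(M.width j) := by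
      intro j m hm
      have hmk : (m : ℝ) ≤ k := by exact_mod_cast hm
      rw [Real.sqrt_div (by positivity), hA, div_mul_eq_mul_div]
      gcongr
  · have hcoef : ∀ i, |M.coords k p i| ≤ S * A * √(M.width i.1) := by
      intro i
      have hw := M.width_pos i.1
      have h1 : ‖∫ x in (M.left i.1)..(M.right i.1), (p i.1).eval x * (M.basisPoly i.1 i.2).eval x‖
          ≤ S * (A / √(M.width i.1)) * |M.right i.1 - M.left i.1| := by
        refine intervalIntegral.norm_integral_le_of_norm_le_const fun x hx => ?_
        rw [uIoc_of_le (M.left_lt_right _).le] at hx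
        have hx' : x ∈ Icc (M.left i.1) (M.right i.1) := ⟨hx.1.le, hx.2⟩
        rw [norm_mul]
        refine mul_le_mul (hp _ x hx') ?_ (norm_nonneg _) hS
        rw [Mesh.basisPoly, eval_mul, eval_C, norm_mul, Real.norm_of_nonneg (Real.sqrt_nonneg _)]
        refine le_trans ?_ (hbasis i.1 i.2 (Nat.lt_succ_iff.mp i.2.2))
        exact mul_le_mul_of_nonneg_left (abs_eval_cellPoly_le (M.left_lt_right _) hC
          (Nat.lt_succ_iff.mp i.2.2) hx').1 (Real.sqrt_nonneg _)
      rw [M.coords_apply]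
      refine h1.trans (le_of_eq ?_)
      change S * (A / √(M.width i.1)) * |M.width i.1| = _
      rw [abs_of_pos hw]
      have := Real.mul_self_sqrt hw.le
      have h0 : √(M.width i.1) ≠ 0 := by positivity
      field_simp
      rw [sq, this]
    have hsq : ‖M.coords k p‖ ^ 2 ≤ ((k : ℝ) + 1) * (S * A) ^ 2 * (2 * Real.pi) := by
      rw [EuclideanSpace.norm_sq_eq, Fintype.sum_prod_type]
      calc _ ≤ ∑ j, ∑ _m : Fin (k + 1), (S * A) ^ 2 * M.width j := by
            refine Finset.sum_le_sum fun j _ => Finset.sum_le_sum fun m _ => ?_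
            have := pow_le_pow_left₀ (abs_nonneg _) (hcoef (j, m)) 2
            rwa [mul_pow, Real.sq_sqrt (M.width_pos j).le] at this
        _ = _ := by
            simp only [Finset.sum_const, Finset.card_univ, Fintype.card_fin, nsmul_eq_mul]
            rw [← Finset.mul_sum, ← Finset.mul_sum, M.sum_width]
            push_cast
            ring
    refine abs_le_of_sq_le_sq' (hsq.trans ?_) (by positivity) |>.2
    have hpi := Real.pi_lt_four
    rw [hD]
    calc ((k : ℝ) + 1) * (S * A) ^ 2 * (2 * Real.pi)
        ≤ ((k : ℝ) + 1) * (S * A) ^ 2 * 49 := by gcongr; linarith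
      _ ≤ ((k : ℝ) + 1) ^ 2 * (S * A) ^ 2 * 49 := by
          gcongr
          exact le_self_pow₀ hk1 two_ne_zero
      _ = _ := by ring
  · have hw := M.width_pos j
    have hterm : ∀ m : Fin (k + 1), |(derivative (C (c (j, m)) * M.basisPoly j m)).eval x|
        ≤ ‖c‖ * (2 * A / (M.width j * √(M.width j))) := by
      intro m
      have hm := Nat.lt_succ_iff.mp m.2
      rw [derivative_C_mul, Mesh.basisPoly, derivative_C_mul, eval_mul, eval_mul, eval_C, eval_C,
        abs_mul, abs_mul, abs_of_nonneg (Real.sqrt_nonneg _)]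
      refine mul_le_mul (PiLp.norm_apply_le c (j, m)) ?_ (by positivity) (norm_nonneg _)
      calc _ ≤ √((2 * (m : ℝ) + 1) / M.width j) * (2 * Λ / (M.right j - M.left j)) := by
            gcongr
            exact (abs_eval_cellPoly_le (M.left_lt_right j) hC hm hx).2
        _ = √((2 * (m : ℝ) + 1) / M.width j) * Λ * (2 / M.width j) := by rw [Mesh.width]; ring
        _ ≤ A / √(M.width j) * (2 / M.width j) := by
            gcongr
            exact hbasis j m hm
        _ = _ := by field_simp
    rw [Mesh.toPoly, derivative_sum, eval_finsetSum]
    refine (Finset.abs_sum_le_sum_abs _ _).trans ((Finset.sum_le_sum fun m _ => hterm m).trans ?_)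
    simp only [Finset.sum_const, Finset.card_univ, Fintype.card_fin, nsmul_eq_mul]
    push_cast
    rw [hD]
    have : 0 ≤ ((k : ℝ) + 1) * A * ‖c‖ / (M.width j * √(M.width j)) := by positivity
    have e1 : ((k : ℝ) + 1) * (‖c‖ * (2 * A / (M.width j * √(M.width j))))
        = 2 * (((k : ℝ) + 1) * A * ‖c‖ / (M.width j * √(M.width j))) := by ring
    have e2 : ((k : ℝ) + 1) * A * 7 * ‖c‖ / (M.width j * √(M.width j))
        = 7 * (((k : ℝ) + 1) * A * ‖c‖ / (M.width j * √(M.width j))) := by ring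
    rw [e1, e2]
    linarith


/-! ### The interpolants on the mesh -/

namespace Mesh

variable (M : Mesh)

/-- The end point of a cell at which the projection of `u` interpolates. -/
def uEnd (fl : Flux) (j : Fin (M.n + 1)) : ℝ :=
  match fl with
  | .minusPlus => M.right j
  | .plusMinus => M.left j

/-- The end point of a cell at which the projection of `q` interpolates. -/
def qEnd (fl : Flux) (j : Fin (M.n + 1)) : ℝ :=
  match fl with
  | .minusPlus => M.left j
  | .plusMinus => M.right j

/-- The end points `e j` and `e' j` of the cells are opposite. -/
def OppositeEnds (e e' : Fin (M.n + 1) → ℝ) : Prop :=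
  ∀ j, e j = M.left j ∧ e' j = M.right j ∨ e j = M.right j ∧ e' j = M.left j

theorem oppositeEnds (fl : Flux) : M.OppositeEnds (M.uEnd fl) (M.qEnd fl) := fun j => by
  cases fl <;> simp [uEnd, qEnd]

variable {M} {e e' : Fin (M.n + 1) → ℝ}

theorem OppositeEnds.symm (h : M.OppositeEnds e e') : M.OppositeEnds e' e := fun j =>
  (h j).symm.imp And.symm And.symm

theorem OppositeEnds.or (h : M.OppositeEnds e e') (j : Fin (M.n + 1)) :
    e j = M.left j ∨ e j = M.right j := (h j).imp And.left And.left

theorem OppositeEnds.or' (h : M.OppositeEnds e e') (j : Fin (M.n + 1)) :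
    e' j = M.left j ∨ e' j = M.right j := h.symm.or j

variable (M) (e e') (k : ℕ)

/-- The corrected interpolant on every cell. -/
def interpFn (f : ℕ → ℝ → ℝ) : M.PiecewisePoly := fun j =>
  interp k (M.left j) (M.right j) (e j) (e' j) f

/-- The defect of the corrected interpolant on every cell. -/
def defect (v : ℝ → ℝ) : M.PiecewisePoly := fun j =>
  C ((M.width j / 2) ^ 2 * radauCoeff k (M.left j) (M.right j) (e j) v)
    * corrector k (M.left j) (M.right j) (e j)
      (corrector k (M.left j) (M.right j) (e' j) (cellPoly (M.left j) (M.right j) k))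

theorem natDegree_interpFn_le (f : ℕ → ℝ → ℝ) (j : Fin (M.n + 1)) :
    (M.interpFn e e' k f j).natDegree ≤ k := natDegree_interp_le (M.left_lt_right j) f

theorem integral_defect_mul (v : ℝ → ℝ) (j : Fin (M.n + 1)) (w : ℝ[X]) :
    ∫ x in (M.left j)..(M.right j), (M.defect e e' k v j).eval x * w.eval x
      = (M.width j / 2) ^ 2 * radauCoeff k (M.left j) (M.right j) (e j) v
        * ∫ x in (M.left j)..(M.right j), (corrector k (M.left j) (M.right j) (e j)
          (corrector k (M.left j) (M.right j) (e' j) (cellPoly (M.left j) (M.right j) k))).eval x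
          * w.eval x := by
  simp only [defect, eval_mul, eval_C, mul_assoc, intervalIntegral.integral_const_mul]

variable {e e' k}

theorem cellForm_interpFn (hk : 2 ≤ k) (hee : M.OppositeEnds e e') {n : ℕ} {B : ℝ}
    {f : ℕ → ℝ → ℝ} (hf : IsTower n B OmegaBar f) (hn : 1 ≤ n) (j : Fin (M.n + 1)) {w : ℝ[X]}
    (hw : w.natDegree ≤ k) :
    M.cellForm (fun i => f 0 (M.node i)) (M.interpFn e e' k f j) j w
      = (∫ x in (M.left j)..(M.right j),
          (M.interpFn e' e k (fun i => f (i + 1)) j).eval x * w.eval x)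
        + ∫ x in (M.left j)..(M.right j), (M.defect e' e k (f 3) j).eval x * w.eval x := by
  rw [integral_defect_mul]
  exact interp_consistency hk (M.left_lt_right j) (hee.or j) (hee.or' j)
    (fun x hx => (hf.hasDeriv 0 (by omega) x (M.cell_subset j hx)).mono (M.cell_subset j))
    ((hf.continuousOn hn).mono (M.cell_subset j)) hw

theorem hasDerivWithinAt_coords {p : ℝ → M.PiecewisePoly} {d : M.CoordSpace k} {I : Set ℝ} {s : ℝ}
    (h : ∀ i : Fin (M.n + 1) × Fin (k + 1), HasDerivWithinAt
      (fun t => ∫ x in (M.left i.1)..(M.right i.1), (p t i.1).eval x * (M.basisPoly i.1 i.2).eval x)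
      (d i) I s) :
    HasDerivWithinAt (fun t => M.coords k (p t)) d I s := by
  rw [hasDerivWithinAt_iff_hasFDerivWithinAt, hasFDerivWithinAt_euclidean]
  intro i
  refine (h i).hasFDerivWithinAt.congr_fderiv ?_
  ext
  simp

theorem natDegree_basisPoly_le' (i : Fin (M.n + 1) × Fin (k + 1)) :
    (M.basisPoly i.1 i.2).natDegree ≤ k :=
  (M.natDegree_basisPoly_le i.1 i.2).trans (Nat.lt_succ_iff.mp i.2.2)

end Mesh

/-! ### The error equations -/

section ErrorEquations

variable {M : Mesh} {k n : ℕ} {fl : Flux} {bc : BoundaryCondition} {T B : ℝ} {u : ℝ → ℝ → ℝ}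
  {e e' : Fin (M.n + 1) → ℝ}

/-- The correctors vanish where the projection interpolates, so the interpolant has the exact trace
there. The remaining boundary value is exact by the boundary condition, hence the flux of `u_I`
carries no error. -/
theorem uFlux_interpFn (hk : 2 ≤ k) (hbc : bc.Holds fl T u) {s : ℝ} (hs : s ∈ Icc 0 T)
    (hU : ContinuousOn (u s) OmegaBar) :
    uFlux M fl bc s (M.interpFn (M.uEnd fl) (M.qEnd fl) k fun i => dx^[i] (u s))
      = fun i => u s (M.node i) := by
  ext i
  have hv : ∀ j, (M.interpFn (M.uEnd fl) (M.qEnd fl) k (fun i => dx^[i] (u s)) j).eval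
      (M.uEnd fl j) = u s (M.uEnd fl j) := fun j =>
    eval_interp_end hk (M.left_lt_right j) ((M.oppositeEnds fl).or j) ((M.oppositeEnds fl).or' j)
      (hU.mono (M.cell_subset j))
  have h := hbc s hs
  cases fl with
  | minusPlus =>
    refine M.traceMinus_eq ?_ hv i
    cases bc with
    | periodic =>
      rw [h.1, BoundaryCondition.firstDatum, Mesh.firstValue, ← M.right_last]
      exact hv _
    | mixed g₀ g₁ => exact h.1.symm
  | plusMinus =>
    refine M.tracePlus_eq ?_ hv i
    cases bc with
    | periodic =>
      rw [← h.1, BoundaryCondition.lastDatum, Mesh.lastValue, ← M.left_zero]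
      exact hv _
    | mixed g₀ g₁ => exact h.2.symm

theorem qFlux_interpFn (hk : 2 ≤ k) (hbc : bc.Holds fl T u) {s : ℝ} (hs : s ∈ Icc 0 T)
    (hU : ContinuousOn (dx (u s)) OmegaBar) :
    qFlux M fl bc s (M.interpFn (M.qEnd fl) (M.uEnd fl) k fun i => dx^[i + 1] (u s))
      = fun i => dx (u s) (M.node i) := by
  ext i
  have hv : ∀ j, (M.interpFn (M.qEnd fl) (M.uEnd fl) k (fun i => dx^[i + 1] (u s)) j).eval
      (M.qEnd fl j) = dx (u s) (M.qEnd fl j) := fun j =>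
    eval_interp_end hk (M.left_lt_right j) ((M.oppositeEnds fl).or' j) ((M.oppositeEnds fl).or j)
      (hU.mono (M.cell_subset j))
  have h := hbc s hs
  cases fl with
  | minusPlus =>
    refine M.tracePlus_eq ?_ hv i
    cases bc with
    | periodic =>
      rw [← h.2, BoundaryCondition.lastDatum, Mesh.lastValue, ← M.left_zero]
      exact hv _
    | mixed g₀ g₁ => exact h.2.symm
  | plusMinus =>
    refine M.traceMinus_eq ?_ hv i
    cases bc with
    | periodic =>
      rw [h.2, BoundaryCondition.firstDatum, Mesh.firstValue, ← M.right_last]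
      exact hv _
    | mixed g₀ g₁ => exact h.1.symm

/-- A moment of the interpolant is a fixed linear combination of moments and Radau coefficients of
`u, u_x, u_xx`. Each is differentiated through the heat equation, which shifts every index by two.
-/
theorem hasDerivWithinAt_integral_interpFn (hee : M.OppositeEnds e e')
    (hu : IsHeatSolution fl bc T u) (hU : ∀ t ∈ Icc 0 T, IsTower n B OmegaBar fun i => dx^[i] (u t))
    (hn : 4 ≤ n) {s : ℝ} (hs : s ∈ Icc 0 T) (j : Fin (M.n + 1)) {w : ℝ[X]} (hw : w.natDegree ≤ k) :
    HasDerivWithinAt (fun t => ∫ x in (M.left j)..(M.right j),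
        (M.interpFn e e' k (fun i => dx^[i] (u t)) j).eval x * w.eval x)
      (∫ x in (M.left j)..(M.right j),
        (M.interpFn e e' k (fun i => dx^[i + 2] (u s)) j).eval x * w.eval x) (Icc 0 T) s := by
  have hab := M.left_lt_right j
  have hI := M.cell_subset j
  have hform : ∀ t ∈ Icc 0 T, ∀ l ≤ 2, _ := fun t ht l hl =>
    integral_interp_mul (k := k) (e := e j) (e' := e' j) (f := fun i => dx^[i + l] (u t)) hab
      (((hU t ht).continuousOn (by omega : 0 + l ≤ n)).mono hI) hw
  have hκ : ∀ i ≤ 2, ∀ e, (e = M.left j ∨ e = M.right j) → _ := fun i hi e he =>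
    (isSupFunctional_radauCoeff (k := k) hab he).hasDerivWithinAt hI hu hU
      (by omega : i + 2 ≤ n) hs
  have hint := (isSupFunctional_integral hab w).hasDerivWithinAt hI hu hU (by omega : 0 + 2 ≤ n) hs
  refine HasDerivWithinAt.congr_deriv (HasDerivWithinAt.congr (((hint.sub
    ((hκ 0 (by omega) _ (hee.or j)).mul_const _)).sub
    (((hκ 1 (by omega) _ (hee.or' j)).const_mul ((M.right j - M.left j) / 2)).mul_const _)).sub
    (((hκ 2 (by omega) _ (hee.or j)).const_mul (((M.right j - M.left j) / 2) ^ 2)).mul_const _))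
    (fun t ht => hform t ht 0 (by omega)) (hform s hs 0 (by omega))) ?_
  exact (hform s hs 2 le_rfl).symm

theorem hasDerivWithinAt_coords_defect (hee : M.OppositeEnds e e')
    (hu : IsHeatSolution fl bc T u) (hU : ∀ t ∈ Icc 0 T, IsTower n B OmegaBar fun i => dx^[i] (u t))
    {i : ℕ} (hi : i + 2 ≤ n) {s : ℝ} (hs : s ∈ Icc 0 T) :
    HasDerivWithinAt (fun t => M.coords k (M.defect e e' k (dx^[i] (u t))))
      (M.coords k (M.defect e e' k (dx^[i + 2] (u s)))) (Icc 0 T) s := by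
  refine M.hasDerivWithinAt_coords fun l => ?_
  simp only [Mesh.coords_apply, Mesh.integral_defect_mul]
  exact (((isSupFunctional_radauCoeff (M.left_lt_right l.1) (hee.or l.1)).hasDerivWithinAt
    (M.cell_subset l.1) hu hU hi hs).const_mul _).mul_const _

theorem IsLDGSolution.hasDerivWithinAt_integral {uh qh : ℝ → M.PiecewisePoly}
    (H : IsLDGSolution M k fl bc T uh qh) (hT : 0 < T) {s : ℝ} (hs : s ∈ Icc 0 T)
    (j : Fin (M.n + 1)) {w : ℝ[X]} (hw : w.natDegree ≤ k) :
    HasDerivWithinAt (fun t => ∫ x in (M.left j)..(M.right j), (uh t j).eval x * w.eval x)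
      (M.cellForm (qFlux M fl bc s (qh s)) (qh s j) j w) (Icc 0 T) s := by
  have hd : ∀ i, HasDerivWithinAt (fun s => (uh s j).coeff i)
      (derivWithin (fun s => (uh s j).coeff i) (Icc 0 T) s) (Icc 0 T) s := fun i =>
    (H.differentiableOn j i s hs).hasDerivWithinAt
  have heval : ∀ t ∈ Icc 0 T, ∀ x, (uh t j).eval x
      = ∑ i ∈ Finset.range (k + 1), (uh t j).coeff i * x ^ i := fun t ht x =>
    eval_eq_sum_range' (Nat.lt_succ_iff.mpr (H.natDegree_u t ht j)) x
  have hdx : ∀ x, derivWithin (fun t => (uh t j).eval x) (Icc 0 T) s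
      = ∑ i ∈ Finset.range (k + 1), derivWithin (fun s => (uh s j).coeff i) (Icc 0 T) s * x ^ i :=
    fun x => by
      refine HasDerivWithinAt.derivWithin ?_ (uniqueDiffOn_Icc hT s hs)
      exact HasDerivWithinAt.congr (HasDerivWithinAt.fun_sum fun i _ => (hd i).mul_const (x ^ i))
        (fun t ht => heval t ht x) (heval s hs x)
  have hsum : ∀ c : ℕ → ℝ, ∫ x in (M.left j)..(M.right j),
      (∑ i ∈ Finset.range (k + 1), c i * x ^ i) * w.eval x
      = ∑ i ∈ Finset.range (k + 1), c i * ∫ x in (M.left j)..(M.right j), x ^ i * w.eval x := by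
    intro c
    simp only [Finset.sum_mul, mul_assoc]
    rw [intervalIntegral.integral_finsetSum fun i _ =>
      Continuous.intervalIntegrable (by fun_prop) _ _]
    simp only [intervalIntegral.integral_const_mul]
  have hint : ∀ t ∈ Icc 0 T, ∫ x in (M.left j)..(M.right j), (uh t j).eval x * w.eval x
      = ∑ i ∈ Finset.range (k + 1), (uh t j).coeff i
        * ∫ x in (M.left j)..(M.right j), x ^ i * w.eval x := fun t ht => by
    simp only [heval t ht, hsum]
  have heq := H.equation_u s hs j w hw
  simp only [hdx, hsum] at heq
  rw [Mesh.cellForm, ← heq]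
  exact HasDerivWithinAt.congr (HasDerivWithinAt.fun_sum fun i _ => (hd i).mul_const _)
    hint (hint s hs)

/-- Subtracting the scheme from the consistency identities of `u_I` and `q_I` leaves the defects.
The one in the equation of `u` involves the fourth space derivative, so it is the time derivative of
the defect built from the second; this is the origin of `W`. -/
theorem isErrorSystem_of_isLDGSolution (hk : 2 ≤ k) (hT : 0 < T) (hu : IsHeatSolution fl bc T u)
    (hU : ∀ t ∈ Icc 0 T, IsTower n B OmegaBar fun i => dx^[i] (u t)) (hn : 5 ≤ n)
    {uh qh : ℝ → M.PiecewisePoly} (H : IsLDGSolution M k fl bc T uh qh)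
    (h0 : ∀ j, uh 0 j = interpolant k fl T u 0 (M.left j) (M.right j))
    {t h G : ℝ} (ht : t ∈ Icc 0 T)
    (hg : ∀ s ∈ Icc 0 t,
      ‖M.coords k (M.defect (M.qEnd fl) (M.uEnd fl) k (dx^[3] (u s)))‖ ≤ G)
    (hW : ∀ s ∈ Icc 0 t,
      ‖M.coords k (M.defect (M.uEnd fl) (M.qEnd fl) k (dx^[2] (u s)))‖ ≤ G)
    (hW' : ∀ s ∈ Icc 0 t,
      ‖M.coords k (M.defect (M.uEnd fl) (M.qEnd fl) k (dx^[4] (u s)))‖ ≤ G / h)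
    (hg' : ∀ s ∈ Icc 0 t,
      ‖M.coords k (M.defect (M.qEnd fl) (M.uEnd fl) k (dx^[5] (u s)))‖ ≤ G / h ^ 2) :
    IsErrorSystem (uOp M fl bc k) t h G
      (fun s => M.coords k fun j =>
        M.interpFn (M.uEnd fl) (M.qEnd fl) k (fun i => dx^[i] (u s)) j - uh s j)
      (fun s => M.coords k fun j =>
        M.interpFn (M.qEnd fl) (M.uEnd fl) k (fun i => dx^[i + 1] (u s)) j - qh s j)
      (fun s => -M.coords k (M.defect (M.qEnd fl) (M.uEnd fl) k (dx^[3] (u s))))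
      (fun s => -M.coords k (M.defect (M.qEnd fl) (M.uEnd fl) k (dx^[5] (u s))))
      (fun s => M.coords k (M.defect (M.uEnd fl) (M.qEnd fl) k (dx^[2] (u s))))
      (fun s => M.coords k (M.defect (M.uEnd fl) (M.qEnd fl) k (dx^[4] (u s)))) := by
  have hIt : Icc 0 t ⊆ Icc 0 T := Icc_subset_Icc_right ht.2
  have hee := M.oppositeEnds fl
  have h0T : (0 : ℝ) ∈ Icc 0 T := left_mem_Icc.mpr hT.le
  have hcont : ∀ s ∈ Icc 0 T, ∀ i ≤ n, ContinuousOn (dx^[i] (u s)) OmegaBar := fun s hs i hi =>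
    (hU s hs).continuousOn hi
  have hsub : ∀ (p r w : ℝ[X]) (a b : ℝ), ∫ x in a..b, (p - r).eval x * w.eval x
      = (∫ x in a..b, p.eval x * w.eval x) - ∫ x in a..b, r.eval x * w.eval x := by
    intro p r w a b
    simp only [eval_sub, sub_mul]
    exact intervalIntegral.integral_sub (Continuous.intervalIntegrable (by fun_prop) _ _)
      (Continuous.intervalIntegrable (by fun_prop) _ _)
  refine ⟨?_, fun s hs => ?_, fun s hs => ?_, fun s hs => ?_, fun s hs => ?_, fun s hs => ?_, hW,
    hW', fun s hs => ?_⟩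
  · ext l
    have : M.interpFn (M.uEnd fl) (M.qEnd fl) k (fun i => dx^[i] (u 0)) l.1 = uh 0 l.1 := by
      rw [h0, interpolant_eq (u := u) (M.left_lt_right l.1)
        (fun s hs => (hcont s hs 0 (by omega)).mono (M.cell_subset l.1)) h0T
        ((hcont 0 h0T 1 (by omega)).mono (M.cell_subset l.1)) fun e he =>
          ((isSupFunctional_radauCoeff (M.left_lt_right l.1) he).hasDerivWithinAt (i := 0)
            (M.cell_subset l.1) hu hU (by omega) h0T).derivWithin (uniqueDiffOn_Icc hT 0 h0T)]
      cases fl <;> rfl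
    simp [Mesh.coords_apply, this]
  · have hs' := hIt hs
    ext l
    have hw := M.natDegree_basisPoly_le' l
    have h1 := M.cellForm_interpFn hk hee (hU s hs') (by omega) l.1 hw
    have h2 := H.equation_q s hs' l.1 _ hw
    simp only [PiLp.add_apply, PiLp.neg_apply, uOp_apply]
    rw [Mesh.toPoly_coords M fun j => (natDegree_sub_le _ _).trans
        (max_le (M.natDegree_interpFn_le _ _ _ _ j) (H.natDegree_u s hs' j)),
      ← uFlux_sub M fl bc s, Mesh.cellForm_sub, uFlux_interpFn hk hu.boundary hs'
        (hcont s hs' 0 (by omega)), Mesh.coords_apply, Mesh.coords_apply, hsub, h2]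
    simp only [Function.iterate_zero, id] at h1
    rw [h1, Mesh.cellForm]
    ring
  · have hs' := hIt hs
    rw [adjoint_uOp, LinearMap.neg_apply, neg_neg]
    refine HasDerivWithinAt.mono (M.hasDerivWithinAt_coords fun l => ?_) hIt
    have hw := M.natDegree_basisPoly_le' l
    have hU1 : IsTower (n - 1) B OmegaBar fun i => dx^[i + 1] (u s) :=
      ⟨fun i hi => (hU s hs').hasDeriv (i + 1) (by omega),
        fun i hi => (hU s hs').bound (i + 1) (by omega), by
          have := (hU s hs').lipschitz
          rwa [show n = n - 1 + 1 by omega] at this⟩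
    have h1 := M.cellForm_interpFn hk hee.symm hU1 (by omega) l.1 hw
    have h2 := (hasDerivWithinAt_integral_interpFn hee hu hU (by omega) hs' l.1 hw).sub
      (H.hasDerivWithinAt_integral hT hs' l.1 hw)
    simp only [hsub]
    refine h2.congr_deriv ?_
    simp only [PiLp.sub_apply, qOp_apply]
    rw [Mesh.toPoly_coords M fun j => (natDegree_sub_le _ _).trans
        (max_le (M.natDegree_interpFn_le _ _ _ _ j) (H.natDegree_q s hs' j)),
      ← qFlux_sub M fl bc s, Mesh.cellForm_sub, qFlux_interpFn hk hu.boundary hs'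
        (hcont s hs' 1 (by omega)), Mesh.coords_apply]
    simp only [zero_add, Function.iterate_one] at h1
    rw [h1]
    ring
  · exact ((hasDerivWithinAt_coords_defect hee.symm hu hU (by omega) (hIt hs)).neg).mono hIt
  · exact (hasDerivWithinAt_coords_defect hee hu hU (by omega) (hIt hs)).mono hIt
  · rw [norm_neg]
    exact hg s hs
  · rw [norm_neg]
    exact hg' s hs

end ErrorEquations


/-! ### The error estimates -/

theorem IsTower.nonneg {n : ℕ} {B : ℝ} {f : ℕ → ℝ → ℝ} (H : IsTower n B OmegaBar f) : 0 ≤ B :=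
  (abs_nonneg _).trans (H.bound 0 (Nat.zero_le n) 0 (left_mem_Icc.mpr Real.two_pi_pos.le))

theorem IsTower.shift {n : ℕ} {B : ℝ} {I : Set ℝ} {f : ℕ → ℝ → ℝ} (H : IsTower (n + 1) B I f) :
    IsTower n B I fun i => f (i + 1) :=
  ⟨fun i hi => H.hasDeriv (i + 1) (by omega), fun i hi => H.bound (i + 1) (by omega), H.lipschitz⟩

/-- Two powers of `h` come from the factor `h̄²` of the second correction, and `m + 1` from the
Radau coefficient of a function with `m` further derivatives. -/
theorem exists_norm_coords_defect_le (k : ℕ) : ∃ A : ℝ, 1 ≤ A ∧ ∀ (M : Mesh)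
    (e e' : Fin (M.n + 1) → ℝ), M.OppositeEnds e e' → ∀ (n : ℕ) (B : ℝ) (f : ℕ → ℝ → ℝ),
    IsTower n B OmegaBar f → ∀ i m, i + m ≤ n → m ≤ k →
      ‖M.coords k (M.defect e e' k (f i))‖ ≤ A * B * M.h ^ (m + 3) := by
  obtain ⟨D, hD1, hD⟩ := exists_coords_bound k
  obtain ⟨R, hR1, hR⟩ := exists_radau_bound k
  obtain ⟨Λ, hΛ1, hΛ⟩ := exists_corrector_bound k
  refine ⟨D * (R * Λ), one_le_mul_of_one_le_of_one_le hD1 (one_le_mul_of_one_le_of_one_le hR1 hΛ1),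
    fun M e e' hee n B f hf i m him hm => ?_⟩
  have hB := hf.nonneg
  have hh := M.h_pos
  refine ((hD M).1 _ (R * Λ * B * M.h ^ (m + 3)) (by positivity) fun j x hx => ?_).trans
    (le_of_eq (by ring))
  have hw := M.width_pos j
  have h1 := hf.abs_radauCoeff_le (k := k) (M.left_lt_right j) (M.cell_subset j)
    (fun v S hS => (hR _ _ _ (M.left_lt_right j) (hee.or j) v S hS).1) him hm
  have h2 := (hΛ _ _ _ _ (M.left_lt_right j) (hee.or j) (hee.or' j) x hx).2.2.1
  rw [Mesh.defect, eval_mul, eval_C, abs_mul, abs_mul, abs_of_nonneg (by positivity)]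
  calc _ ≤ (M.width j / 2) ^ 2 * (R * (B * M.width j ^ (m + 1))) * Λ := by
        gcongr
        exact h1
    _ = R * Λ * B * M.width j ^ (m + 3) / 4 := by ring
    _ ≤ R * Λ * B * M.width j ^ (m + 3) := by
        have : 0 ≤ R * Λ * B * M.width j ^ (m + 3) := by positivity
        linarith
    _ ≤ _ := by
        gcongr
        exact M.width_le_h j

/-- The projection superconverges at these points. The correctors need no cancellation: their
coefficients carry `h̄ h^{k+1}` and `h̄² h^{k+1}`, and differentiation costs one power. -/
theorem exists_abs_deriv_sub_interpFn_le (k : ℕ) : ∃ A : ℝ, 1 ≤ A ∧ ∀ (M : Mesh)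
    (e e' : Fin (M.n + 1) → ℝ), M.OppositeEnds e e' → ∀ (n : ℕ) (B : ℝ) (f : ℕ → ℝ → ℝ),
    IsTower n B OmegaBar f → k + 2 ≤ n → ∀ j, ∀ x ∈ Ioo (M.left j) (M.right j),
      (cellPoly (M.left j) (M.right j) (k + 1)).eval x
        + (cellPoly (M.left j) (M.right j) k).eval (e j)
          * (cellPoly (M.left j) (M.right j) (k + 1)).eval (e j)
          * (cellPoly (M.left j) (M.right j) k).eval x = 0 →
      |f 1 x - (derivative (M.interpFn e e' k f j)).eval x| ≤ A * B * M.h ^ (k + 1) := by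
  obtain ⟨R, hR1, hR⟩ := exists_radau_bound k
  obtain ⟨Λ, hΛ1, hΛ⟩ := exists_corrector_bound k
  refine ⟨5 * (R * Λ), ?_, fun M e e' hee n B f hf hn j x hx hx0 => ?_⟩
  · have := one_le_mul_of_one_le_of_one_le hR1 hΛ1
    linarith
  have hB := hf.nonneg
  have hw := M.width_pos j
  have hwh := M.width_le_h j
  have hab := M.left_lt_right j
  have hI := M.cell_subset j
  have h1 := hf.abs_deriv_sub_radau_le (i := 0) hab (hee j) hI
    (fun v S hS x hx => ((hR _ _ _ hab (hee.or j) v S hS).2 x hx).2) (by omega) hx hx0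
  have h2 := hf.abs_radauCoeff_le (i := 1) hab hI
    (fun v S hS => (hR _ _ _ hab (hee.or' j) v S hS).1) (by omega) le_rfl
  have h3 := hf.abs_radauCoeff_le (i := 2) hab hI
    (fun v S hS => (hR _ _ _ hab (hee.or j) v S hS).1) (by omega) le_rfl
  obtain ⟨-, h4, -, h5⟩ := hΛ _ _ _ _ hab (hee.or j) (hee.or' j) x ⟨hx.1.le, hx.2.le⟩
  change |_| ≤ (1 + R) * (B * M.width j ^ (k + 1)) at h1
  change |_| ≤ R * (B * M.width j ^ (k + 1)) at h3
  change |_| ≤ R * (B * M.width j ^ (k + 1)) at h2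
  change |_| ≤ Λ / M.width j at h4
  change |_| ≤ Λ / M.width j at h5
  set P := B * M.width j ^ (k + 1) with hP
  have hP0 : 0 ≤ P := by positivity
  have h6 : |M.width j / 2 * radauCoeff k (M.left j) (M.right j) (e' j) (f 1)
      * (derivative (corrector k (M.left j) (M.right j) (e j)
        (cellPoly (M.left j) (M.right j) k))).eval x| ≤ R * P * Λ / 2 := by
    rw [abs_mul, abs_mul, abs_of_nonneg (by positivity)]
    calc _ ≤ M.width j / 2 * (R * P) * (Λ / M.width j) := by gcongr
      _ = _ := by field_simp
  have h7 : |(M.width j / 2) ^ 2 * radauCoeff k (M.left j) (M.right j) (e j) (f 2)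
      * (derivative (corrector k (M.left j) (M.right j) (e j) (corrector k (M.left j) (M.right j)
        (e' j) (cellPoly (M.left j) (M.right j) k)))).eval x| ≤ 2 * (R * P * Λ) := by
    rw [abs_mul, abs_mul, abs_of_nonneg (by positivity)]
    have hw8 : M.width j ≤ 8 := by
      have := M.h_le
      have := Real.pi_lt_four
      linarith
    calc _ ≤ (M.width j / 2) ^ 2 * (R * P) * (Λ / M.width j) := by gcongr
      _ = M.width j * (R * P * Λ / 4) := by field_simp; ring
      _ ≤ 8 * (R * P * Λ / 4) := by gcongr
      _ = _ := by ring
  have h8 : |f 1 x - (derivative (M.interpFn e e' k f j)).eval x| ≤ 5 * (R * Λ) * P := by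
    have hRΛ : P ≤ R * Λ * P :=
      le_mul_of_one_le_left hP0 (one_le_mul_of_one_le_of_one_le hR1 hΛ1)
    have hRΛ' : R * P ≤ R * Λ * P := by
      have := le_mul_of_one_le_right (mul_nonneg (zero_le_one.trans hR1) hP0) hΛ1
      linarith
    have e1 : (derivative (M.interpFn e e' k f j)).eval x
        = (derivative (radauFormula k (M.left j) (M.right j) (e j) (f 0))).eval x
          - (M.width j / 2 * radauCoeff k (M.left j) (M.right j) (e' j) (f 1)
            * (derivative (corrector k (M.left j) (M.right j) (e j)
              (cellPoly (M.left j) (M.right j) k))).eval x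
          + (M.width j / 2) ^ 2 * radauCoeff k (M.left j) (M.right j) (e j) (f 2)
            * (derivative (corrector k (M.left j) (M.right j) (e j)
              (corrector k (M.left j) (M.right j) (e' j)
                (cellPoly (M.left j) (M.right j) k)))).eval x) := by
      simp only [Mesh.interpFn, interp, derivative_sub, derivative_add, derivative_C_mul, eval_sub,
        eval_add, eval_mul, eval_C, Mesh.width]
    rw [e1]
    rw [abs_le] at h1 h6 h7 ⊢
    simp only [zero_add] at h1
    constructor <;> linarith
  refine h8.trans ?_
  rw [hP, ← mul_assoc]
  gcongr

theorem inverse_sqrt_le {c h w : ℝ} (hc : 0 ≤ c) (hw : 0 < w) (h0 : 0 < h) (hcw : h ≤ c * w) :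
    1 / (w * √w) ≤ c * √c / (h * √h) := by
  rw [div_le_div_iff₀ (by positivity) (by positivity), one_mul]
  calc h * √h ≤ c * w * √(c * w) := by gcongr
    _ = c * √c * (w * √w) := by rw [Real.sqrt_mul hc]; ring

/-- A bound of the errors of the derivatives at the Radau points of the projections. -/
theorem exists_abs_deriv_sub_le (k : ℕ) (hk : 2 ≤ k) (c : ℝ) : ∃ K : ℝ, 0 < K ∧
    ∀ (M : Mesh), M.QuasiUniform c → ∀ (fl : Flux) (bc : BoundaryCondition) (T : ℝ), 0 < T →
    ∀ (u : ℝ → ℝ → ℝ), IsHeatSolution fl bc T u → ∀ B₀ : ℝ,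
      (∀ s ∈ Icc 0 T, IsTower (k + 3) B₀ OmegaBar fun i => dx^[i] (u s)) →
    ∀ (uh qh : ℝ → M.PiecewisePoly), IsLDGSolution M k fl bc T uh qh →
      (∀ j, uh 0 j = interpolant k fl T u 0 (M.left j) (M.right j)) →
    ∀ t ∈ Icc 0 T, ∀ B : ℝ,
      (∀ s ∈ Icc 0 t, IsTower (k + 3) B OmegaBar fun i => dx^[i] (u s)) →
    ∀ j, ∀ x ∈ Ioo (M.left j) (M.right j),
      ((cellPoly (M.left j) (M.right j) (k + 1)).eval x
        + (cellPoly (M.left j) (M.right j) k).eval (M.uEnd fl j)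
          * (cellPoly (M.left j) (M.right j) (k + 1)).eval (M.uEnd fl j)
          * (cellPoly (M.left j) (M.right j) k).eval x = 0 →
        |dx (u t) x - (derivative (uh t j)).eval x|
          ≤ K * (1 + t * √M.h) * M.h ^ (k + 1) * B) ∧
      ((cellPoly (M.left j) (M.right j) (k + 1)).eval x
        + (cellPoly (M.left j) (M.right j) k).eval (M.qEnd fl j)
          * (cellPoly (M.left j) (M.right j) (k + 1)).eval (M.qEnd fl j)
          * (cellPoly (M.left j) (M.right j) k).eval x = 0 →
        |dx (dx (u t)) x - (derivative (qh t j)).eval x|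
          ≤ K * (1 + √(t * M.h)) * M.h ^ (k + 1) * B) := by
  obtain ⟨D, hD1, hD⟩ := exists_coords_bound k
  obtain ⟨A, hA1, hA⟩ := exists_norm_coords_defect_le k
  obtain ⟨I, hI1, hI⟩ := exists_abs_deriv_sub_interpFn_le k
  set γ := max c 1 with hγ
  have hγ0 : 0 < γ := lt_max_of_lt_right one_pos
  refine ⟨I + 60 * (D * A * (γ * √γ)), by positivity, ?_⟩
  intro M hM fl bc T hT u hu B₀ hB₀ uh qh H h0 t ht B hB j x hx
  have htt : t ∈ Icc 0 t := right_mem_Icc.mpr ht.1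
  have hB0 := (hB t htt).nonneg
  have hh := M.h_pos
  have hw := M.width_pos j
  have hh7 : M.h ≤ 7 := by
    have := M.h_le
    have := Real.pi_lt_d2
    linarith
  have hinv : 1 / (M.width j * √(M.width j)) ≤ γ * √γ / (M.h * √M.h) :=
    inverse_sqrt_le hγ0.le hw hh ((hM j).trans (by gcongr; exact le_max_left c 1))
  have hee := M.oppositeEnds fl
  set G := A * B * M.h ^ (k + 3) with hG
  have hG0 : 0 ≤ G := by positivity
  have hle : ∀ i m : ℕ, ∀ e e', M.OppositeEnds e e' → i + m ≤ k + 3 → m ≤ k → ∀ s ∈ Icc 0 t,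
      ‖M.coords k (M.defect e e' k (dx^[i] (u s)))‖ ≤ A * B * M.h ^ (m + 3) :=
    fun i m e e' he him hm s hs => hA M e e' he _ _ _ (hB s hs) i m him hm
  -- The smoothing estimates want a scale at most `1`, while the mesh size may approach `2π`; hence
  -- the division by `7`. A derivative of order `i` has `k + 3 - i` further ones: orders `2` and `3`
  -- give the full size `G`, orders `4` and `5` lose one and two powers of `h`.
  have E := isErrorSystem_of_isLDGSolution (h := M.h / 7) (G := G) hk hT hu hB₀ (by omega) H h0 ht
    (hle 3 k _ _ hee.symm (by omega) le_rfl) (hle 2 k _ _ hee (by omega) le_rfl)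
    (fun s hs => (hle 4 (k - 1) _ _ hee (by omega) (by omega) s hs).trans (by
      have : 0 ≤ A * B * M.h ^ (k - 1 + 3) := by positivity
      rw [hG, show k + 3 = k - 1 + 3 + 1 by omega, pow_succ _ (k - 1 + 3),
        le_div_iff₀ (by positivity)]
      nlinarith))
    (fun s hs => (hle 5 (k - 2) _ _ hee.symm (by omega) (by omega) s hs).trans (by
      have : 0 ≤ A * B * M.h ^ (k - 2 + 3) * M.h ^ 2 := by positivity
      rw [hG, show k + 3 = k - 2 + 3 + 2 by omega, pow_add _ (k - 2 + 3) 2,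
        le_div_iff₀ (by positivity)]
      nlinarith))
  have hsq7 : 1 / √(M.h / 7) ≤ 3 / √M.h := by
    rw [Real.sqrt_div hh.le, one_div_div]
    gcongr
    rw [Real.sqrt_le_left (by norm_num)]
    norm_num
  have hX := E.norm_x_le ht.1 (by positivity) (by linarith)
  have hY := E.norm_y_le ht.1 (by positivity) (by linarith)
  have hfinal : ∀ (p r : M.PiecewisePoly) (f S : ℝ), (∀ j, (p j - r j).natDegree ≤ k) → 0 ≤ S →
      ‖M.coords k (fun j => p j - r j)‖ ≤ 20 * G * (1 / √(M.h / 7) + S) →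
      |f - (derivative (p j)).eval x| ≤ I * B * M.h ^ (k + 1) →
      |f - (derivative (r j)).eval x|
        ≤ (I + 60 * (D * A * (γ * √γ))) * (1 + S * √M.h) * M.h ^ (k + 1) * B := by
    intro p r f S hpr hS hnorm hf
    have h1 := (hD M).2 (M.coords k fun j => p j - r j) j x ⟨hx.1.le, hx.2.le⟩
    rw [M.toPoly_coords hpr, derivative_sub, eval_sub] at h1
    have h2 : D * ‖M.coords k fun j => p j - r j‖ / (M.width j * √(M.width j))
        ≤ 60 * (D * A * (γ * √γ)) * (1 + S * √M.h) * M.h ^ (k + 1) * B := by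
      have hs : √M.h ≠ 0 := by positivity
      have hss : √M.h ^ 2 = M.h := Real.sq_sqrt hh.le
      calc _ = D * ‖M.coords k fun j => p j - r j‖ * (1 / (M.width j * √(M.width j))) := by ring
        _ ≤ D * (20 * G * (3 / √M.h + 3 * S)) * (γ * √γ / (M.h * √M.h)) := by
            gcongr
            refine hnorm.trans ?_
            gcongr
            linarith
        _ = 60 * (D * A * (γ * √γ)) * B * M.h ^ (k + 1)
              * (M.h * (1 / √M.h + S) / √M.h) := by
            rw [hG, pow_add _ k 3, pow_succ _ k]
            field_simp
            ring
        _ = _ := by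
            have key : ∀ r h : ℝ, r ≠ 0 → r ^ 2 = h → h * (1 / r + S) / r = 1 + S * r := by
              rintro r _ hr rfl
              field_simp
            rw [key _ _ hs hss]
            ring
    have h3 : I * B * M.h ^ (k + 1) ≤ I * (1 + S * √M.h) * M.h ^ (k + 1) * B := by
      have : 0 ≤ I * B * M.h ^ (k + 1) * (S * √M.h) := by positivity
      linarith
    have h4 : f - (derivative (r j)).eval x = (f - (derivative (p j)).eval x)
        + ((derivative (p j)).eval x - (derivative (r j)).eval x) := by ring
    rw [h4]
    refine (abs_add_le _ _).trans ((add_le_add (hf.trans h3) (h1.trans h2)).trans (le_of_eq ?_))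
    ring
  refine ⟨fun hx0 => ?_, fun hx0 => ?_⟩
  · refine hfinal _ _ _ _ (fun j => (natDegree_sub_le _ _).trans
      (max_le (M.natDegree_interpFn_le _ _ _ _ j) (H.natDegree_u t ht j))) ht.1
      (hX.trans ?_) (hI M _ _ hee _ _ _ (hB t htt) (by omega) j x hx hx0)
    have ht0 := ht.1
    gcongr
    norm_num
  -- For `q = u_x` the tower is shifted by one and has exactly the `k + 2` levels that
  -- superconvergence needs.
  · rw [mul_comm t, Real.sqrt_mul hh.le, mul_comm (√M.h)]
    exact hfinal _ _ _ _ (fun j => (natDegree_sub_le _ _).trans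
      (max_le (M.natDegree_interpFn_le _ _ _ _ j) (H.natDegree_q t ht j))) (Real.sqrt_nonneg _)
      hY (hI M _ _ hee.symm _ _ _ (hB t htt).shift (by omega) j x hx hx0)

/-! ### From pointwise bounds to the Sobolev norm of the theorem -/

theorem sobolevNormUpTo_mono (m : ℕ) (u : ℝ → ℝ → ℝ) {t T : ℝ} (h : t ≤ T) :
    sobolevNormUpTo m u t ≤ sobolevNormUpTo m u T :=
  iSup₂_le fun τ hτ => le_iSup₂ (f := fun τ (_ : τ ∈ Icc 0 T) => sobolevNorm m (u τ)) τ
    ⟨hτ.1, hτ.2.trans h⟩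

theorem isTower_of_sobolevNormUpTo {n : ℕ} {u : ℝ → ℝ → ℝ} {t : ℝ}
    (h : sobolevNormUpTo (n + 1) u t < ⊤) (hu : ∀ s ∈ Icc 0 t, ContinuousOn (u s) OmegaBar) :
    ∀ s ∈ Icc 0 t, IsTower n (sobolevNormUpTo (n + 1) u t).toReal OmegaBar fun i => dx^[i] (u s) :=
  fun s hs => isTower_of_sobolevNorm_le (hu s hs) ENNReal.toReal_nonneg (by
    rw [ENNReal.ofReal_toReal h.ne]
    exact le_iSup₂ (f := fun τ (_ : τ ∈ Icc 0 t) => sobolevNorm (n + 1) (u τ)) s hs)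

theorem derivError_le {M : Mesh} {R : ℝ → ℝ → Set ℝ} {v : ℝ → ℝ} {vh : M.PiecewisePoly} {Q : ℝ}
    {S : ENNReal} (hS : S ≠ ⊤) (hQ : 0 ≤ Q) (h : ∀ j, ∀ x ∈ R (M.left j) (M.right j),
      |dx v x - (derivative (vh j)).eval x| ≤ Q * S.toReal) :
    derivError M R v vh ≤ ENNReal.ofReal Q * S := by
  refine iSup_le fun j => iSup₂_le fun x hx => ?_
  conv_rhs => rw [← ENNReal.ofReal_toReal hS]
  rw [← ENNReal.ofReal_mul hQ]
  exact ENNReal.ofReal_le_ofReal (h j x hx)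

end
end LDG

theorem theorem4p5 (k : ℕ) (hk : 2 ≤ k) (c : ℝ) :
    ∃ K : ℝ, 0 < K ∧
      ∀ (M : LDG.Mesh), M.QuasiUniform c →
      ∀ (fl : LDG.Flux) (bc : LDG.BoundaryCondition) (T : ℝ), 0 < T →
      ∀ (u : ℝ → ℝ → ℝ), LDG.IsHeatSolution fl bc T u →
        LDG.sobolevNormUpTo (k + 4) u T < ⊤ →
      ∀ (uh qh : ℝ → M.PiecewisePoly), LDG.IsLDGSolution M k fl bc T uh qh →
        (∀ j, uh 0 j = LDG.interpolant k fl T u 0 (M.left j) (M.right j)) →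
      ∀ t ∈ Set.Icc 0 T,
        match fl with
        | .minusPlus =>
          LDG.derivError M (LDG.leftRadau · · k) (u t) (uh t)
              ≤ ENNReal.ofReal (K * (1 + t * √M.h) * M.h ^ (k + 1))
                * LDG.sobolevNormUpTo (k + 4) u t ∧
          LDG.derivError M (LDG.rightRadau · · k) (LDG.dx (u t)) (qh t)
              ≤ ENNReal.ofReal (K * (1 + √(t * M.h)) * M.h ^ (k + 1))
                * LDG.sobolevNormUpTo (k + 4) u t
        | .plusMinus =>
          LDG.derivError M (LDG.rightRadau · · k) (u t) (uh t)
              ≤ ENNReal.ofReal (K * (1 + t * √M.h) * M.h ^ (k + 1))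
                * LDG.sobolevNormUpTo (k + 4) u t ∧
          LDG.derivError M (LDG.leftRadau · · k) (LDG.dx (u t)) (qh t)
              ≤ ENNReal.ofReal (K * (1 + √(t * M.h)) * M.h ^ (k + 1))
                * LDG.sobolevNormUpTo (k + 4) u t := by
  obtain ⟨K, hK, h⟩ := LDG.exists_abs_deriv_sub_le k hk c
  refine ⟨K, hK, fun M hM fl bc T hT u hu hS uh qh H h0 t ht => ?_⟩
  have hcont : ∀ s ∈ Icc 0 T, ContinuousOn (u s) LDG.OmegaBar := fun s hs =>
    (hu.contDiffOn s hs).continuousOn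
  have hSt := (LDG.sobolevNormUpTo_mono (k + 4) u ht.2).trans_lt hS
  -- The tower on `[0,T]` provides differentiability in time, with a bound that does not enter the
  -- result; the one on `[0,t]` carries the norm that appears in the estimate.
  have hmain := h M hM fl bc T hT u hu _ (LDG.isTower_of_sobolevNormUpTo hS hcont) uh qh H h0 t ht
    _ (LDG.isTower_of_sobolevNormUpTo hSt fun s hs => hcont s ⟨hs.1, hs.2.trans ht.2⟩)
  have hh := M.h_pos
  have ht0 : 0 ≤ t := ht.1
  cases fl with
  | minusPlus =>
    exact ⟨LDG.derivError_le hSt.ne (by positivity) fun j x hx => (hmain j x hx.1).1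
        (LDG.eq_zero_of_mem_leftRadau (M.left_lt_right j) hx),
      LDG.derivError_le hSt.ne (by positivity) fun j x hx => (hmain j x hx.1).2
        (LDG.eq_zero_of_mem_rightRadau (M.left_lt_right j) hx)⟩
  | plusMinus =>
    exact ⟨LDG.derivError_le hSt.ne (by positivity) fun j x hx => (hmain j x hx.1).1
        (LDG.eq_zero_of_mem_rightRadau (M.left_lt_right j) hx),
      LDG.derivError_le hSt.ne (by positivity) fun j x hx => (hmain j x hx.1).2
        (LDG.eq_zero_of_mem_leftRadau (M.left_lt_right j) hx)⟩
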